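/- Let $0<\alpha<2$, $a=1-\alpha$, $c>0$, let $f\in C^1(\mathbb R)$ and let $F$ satisfy $F'=-f$. Let $u\in C^2(\mathbb R)$ be a classical solution of $$u''+c\,\Delta^{\alpha/2}u+f(u)=0\quad\text{in }\mathbb R,\qquad \Delta^{\alpha/2}u(x)=\lim_{\epsilon\to0^+}\int_{|x-z|>\epsilon}\bigl(u(z)-u(x)\bigr)\frac{C_\alpha}{|x-z|^{1+\alpha}}\,dz,\qquad C_\alpha=\frac{\alpha 2^{\alpha-1}\,\Gamma(\frac{1+\alpha}{2})}{\sqrt\pi\,\Gamma(1-\frac\alpha2)},$$ where the truncated integrals converge absolutely and the limit exists for every $x\in\mathbb R$. Let $v$ be the Caffarelli–Silvestre extension of $u$ to $\mathbb R\times[0,\infty)$, that is $v(x,0)=u(x)$ and $$v(x,y)=\frac{\Gamma(\frac{1+\alpha}{2})}{\sqrt\pi\,\Gamma(\frac\alpha2)}\int_{\mathbb R}\frac{y^{\alpha}}{\bigl((x-z)^2+y^2\bigr)^{\frac{1+\alpha}{2}}}\,u(z)\,dz\qquad(y>0),$$ which satisfies $\operatorname{div}(y^a\nabla v)=0$ for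 $y>0$ and $-\lim_{y\to0^+}y^a\partial_yv=d_\alpha(-\Delta)^{\alpha/2}u$, where $(-\Delta)^{\alpha/2}=-\Delta^{\alpha/2}$ and $d_\alpha=2^{1-\alpha}\,\Gamma(1-\frac\alpha2)/\Gamma(\frac\alpha2)$. Assume that $\partial_xv(x,0)>0$ for all $x\in\mathbb R$ and that $\lim_{x\to+\infty}v(x,0)=\tau\in\mathbb R$. Then for all $x\in\mathbb R$ and all $y\ge0$ the integral below converges absolutely and $$d_\alpha\,(\partial_xv(x,0))^2+c\int_0^y t^{a}\left[(\partial_xv(x,t))^2-(\partial_yv(x,t))^2\right]dt<2d_\alpha\left[F(v(x,0))-F(\tau)\right].$$ -/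

import Mathlib

open Filter Topology MeasureTheory

noncomputable section

/-- The normalizing constant `C(1, α)` of the fractional Laplacian on the line:
`α 2^(α-1) π^(-1/2) Γ((1+α)/2) / Γ(1-α/2)`. -/
def fracLaplacianConst (α : ℝ) : ℝ :=
  α * (2 : ℝ) ^ (α - 1) * Real.pi ^ (-(1 / 2) : ℝ) * Real.Gamma ((1 + α) / 2) /
    Real.Gamma (1 - α / 2)

/-- `HasFracLaplacian α u x ℓ`: the operator `Δ^{α/2} = -(-Δ)^{α/2}` applied to `u : ℝ → ℝ` is
defined at `x` as a principal value, and its value is `ℓ`. Every truncated integral is required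
to converge absolutely. -/
def HasFracLaplacian (α : ℝ) (u : ℝ → ℝ) (x ℓ : ℝ) : Prop :=
  (∀ ε : ℝ, 0 < ε →
    IntegrableOn (fun z => (u z - u x) * (fracLaplacianConst α / |x - z| ^ (1 + α)))
      {z : ℝ | ε < |x - z|}) ∧
  Tendsto
    (fun ε : ℝ => ∫ z in {z : ℝ | ε < |x - z|},
      (u z - u x) * (fracLaplacianConst α / |x - z| ^ (1 + α)))
    (𝓝[>] 0) (𝓝 ℓ)

/-- `u` is a classical solution of `u'' + c Δ^{α/2} u + f(u) = 0` on the real line. -/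
def IsSolution (α c : ℝ) (f u : ℝ → ℝ) : Prop :=
  ContDiff ℝ 2 u ∧
    ∀ x : ℝ, ∃ ℓ : ℝ, HasFracLaplacian α u x ℓ ∧ deriv (deriv u) x + c * ℓ + f (u x) = 0

/-- The Poisson kernel of `div (y^(1-α) ∇v) = 0` in the half-plane `y > 0`; for each `y > 0` it
has integral one in `x`. -/
def extensionKernel (α x y : ℝ) : ℝ :=
  Real.Gamma ((1 + α) / 2) / (Real.sqrt Real.pi * Real.Gamma (α / 2)) *
    (y ^ α / (x ^ 2 + y ^ 2) ^ ((1 + α) / 2))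

/-- The Caffarelli–Silvestre extension of `u : ℝ → ℝ` to the half-plane `y ≥ 0`: the Poisson
integral of `u` for `y > 0`, with trace `u` on `y = 0`. -/
def extensionFunction (α : ℝ) (u : ℝ → ℝ) (x y : ℝ) : ℝ :=
  if 0 < y then ∫ z : ℝ, extensionKernel α (x - z) y * u z else u x

/-- The constant `d_α` of the Dirichlet-to-Neumann relation
`-lim_{y → 0} y^(1-α) ∂_y v = d_α (-Δ)^{α/2} u` for the extension `v` of `u`. -/
def extensionConst (α : ℝ) : ℝ :=
  (2 : ℝ) ^ (1 - α) * Real.Gamma (1 - α / 2) / Real.Gamma (α / 2)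

end

/-! The quantity to control is the Hamiltonian `H(x, y)`: the left side of the inequality minus the
right side. Write `m = u'`, `ℓ = Δ^{α/2} u`, and for the extension put `p = ∂_x v` and `w = t^a ∂_t
v`. These satisfy a Cauchy–Riemann type system, `∂_x w = t^a ∂_t p` and `∂_t w = -t^a ∂_x p`, so the
energy density `t^a (p² - (∂_t v)²)` and the flux `-2 p w` have the same mixed derivative. Green's
formula on `[x, R] × [ε, y]`, followed by `ε → 0` with the Neumann relation `w → d_α ℓ`, gives
`integral_energyDensity_sub`; the equation integrates `m ℓ` exactly
(`integral_deriv_mul_fracLaplacian`). As `R → ∞` the terms at `R` either vanish or have a favourable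
sign, and `hamiltonian_le_flux` remains: `H(x, y) ≤ 2c ∫_x^∞ p w dz` at height `y`.

The flux is strictly negative because `p` and `-w` are, up to positive factors, integrals of `m`
against `k(z - s)` and `(z - r) k(z - r)` with an even kernel `k`. Expanding the product over pairs
of sources and symmetrizing in `(s, r)` gives the weight `(2z - s - r) k(z - s) k(z - r)`. It is odd
about the midpoint of `s` and `r` and nonnegative to its right, so its integral over any right
half-line is nonnegative. Pairs straddling `x` give a positive lower bound that survives `y → 0`
(`integral_flux_le`), which yields strictness at `y = 0` too (`hamiltonian_neg`).

Two analytic points carry the rest. First, `u` may be unbounded at `-∞`; only the absolute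
convergence of a truncated integral is available. Writing `τ - u(z) = ∫_z^∞ m` and exchanging
integrals (`layer_integral`) turns every integral of `u` into one of `m ≥ 0` with weight `(s² +
1)^(-α/2)`, and shows that the Poisson kernel and the truncated fractional Laplacian regularize the
same principal value (`tendsto_conormalDeriv`). Second, `m(R) → 0` needs a bound on `u''` near `+∞`;
the equation bounds `u''(x)` by a small multiple of its local supremum plus constants, and an
interpolation argument closes the estimate (`exists_bound_of_local_estimate`, `tendsto_deriv_zero`).
-/

noncomputable section

/-! ### Potentials of a weighted density: domination, derivatives, continuity. -/

/-- The potential `∫ m(s) / ((x - s)² + t²)^b ds` of a density `m`. -/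
def potential (b : ℝ) (m : ℝ → ℝ) (x t : ℝ) : ℝ := ∫ s, ((x - s) ^ 2 + t ^ 2) ^ (-b) * m s

/-- The dipole potential `∫ (x - s) m(s) / ((x - s)² + t²)^b ds` of a density `m`. -/
def dipole (b : ℝ) (m : ℝ → ℝ) (x t : ℝ) : ℝ :=
  ∫ s, (x - s) * ((x - s) ^ 2 + t ^ 2) ^ (-b) * m s

lemma sq_add_sq_pos (z : ℝ) {t : ℝ} (ht : 0 < t) : 0 < z ^ 2 + t ^ 2 := by positivity

lemma continuous_sq_add_sq_rpow (x b : ℝ) {t : ℝ} (ht : 0 < t) :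
    Continuous fun s : ℝ => ((x - s) ^ 2 + t ^ 2) ^ b :=
  Continuous.rpow_const (by fun_prop) fun s => Or.inl (sq_add_sq_pos _ ht).ne'

lemma exists_mul_le_sq_add_sq (x₀ : ℝ) {t₀ : ℝ} (ht₀ : 0 < t₀) :
    ∃ c > 0, ∀ x t : ℝ, |x - x₀| ≤ t₀ / 2 → |t - t₀| ≤ t₀ / 2 →
      ∀ s, c * (s ^ 2 + 1) ≤ (x - s) ^ 2 + t ^ 2 := by
  set X := |x₀| + t₀ with hX
  -- From `(2x - s)² ≥ 0`, `s² ≤ 2(x - s)² + 2x²`; the leftover `2X² + 1` is paid for by `t² ≥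
  -- (t₀/2)²`.
  set K := 2 + (2 * X ^ 2 + 1) / (t₀ / 2) ^ 2 with hK
  have hK0 : 0 < K := by positivity
  refine ⟨K⁻¹, inv_pos.2 hK0, fun x t hx ht s => ?_⟩
  have htl : t₀ / 2 ≤ t := by linarith [(abs_le.1 ht).1]
  have hxX : |x| ≤ X := by
    have := abs_sub_abs_le_abs_sub x x₀
    rw [hX]; linarith
  have hx2 : x ^ 2 ≤ X ^ 2 := sq_le_sq' (by linarith [(abs_le.1 hxX).1]) (abs_le.1 hxX).2
  have ht2 : (t₀ / 2) ^ 2 ≤ t ^ 2 := by gcongr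
  have h1 : 2 * X ^ 2 + 1 ≤ (2 * X ^ 2 + 1) / (t₀ / 2) ^ 2 * t ^ 2 := by
    rw [div_mul_eq_mul_div, le_div_iff₀ (by positivity)]
    gcongr
  have h2 : 0 ≤ (2 * X ^ 2 + 1) / (t₀ / 2) ^ 2 * (x - s) ^ 2 := by positivity
  rw [inv_mul_le_iff₀ hK0, hK]
  nlinarith [sq_nonneg (2 * x - s), sq_nonneg t]

/-- One weight `(s² + 1)^(-α/2)` dominates every kernel with a larger exponent, locally uniformly in
`(x, t)`. Hence a single integrability hypothesis on `m` justifies all differentiations under the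
integral. -/
lemma exists_rpow_neg_le {α : ℝ} (x₀ : ℝ) {t₀ : ℝ} (ht₀ : 0 < t₀) {e : ℝ} (hα : 0 ≤ α)
    (he : α / 2 ≤ e) :
    ∃ C ≥ 0, ∀ x t : ℝ, |x - x₀| ≤ t₀ / 2 → |t - t₀| ≤ t₀ / 2 →
      ∀ s, ((x - s) ^ 2 + t ^ 2) ^ (-e) ≤ C * (s ^ 2 + 1) ^ (-(α / 2)) := by
  obtain ⟨c, hc, h⟩ := exists_mul_le_sq_add_sq x₀ ht₀
  refine ⟨c ^ (-e), by positivity, fun x t hx ht s => ?_⟩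
  calc ((x - s) ^ 2 + t ^ 2) ^ (-e) ≤ (c * (s ^ 2 + 1)) ^ (-e) :=
        Real.rpow_le_rpow_of_nonpos (by positivity) (h x t hx ht s) (by linarith)
    _ = c ^ (-e) * (s ^ 2 + 1) ^ (-e) := Real.mul_rpow hc.le (by positivity)
    _ ≤ c ^ (-e) * (s ^ 2 + 1) ^ (-(α / 2)) := by
        gcongr
        · nlinarith [sq_nonneg s]

/-- The dipole factor costs half a power, since `|z| ≤ (z² + t²)^(1/2)`; this is why dipoles below
need `(1 + α)/2 ≤ b` where potentials need `α/2 ≤ b`. -/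
lemma abs_mul_rpow_neg_le (z b : ℝ) {t : ℝ} (ht : 0 < t) :
    |z * (z ^ 2 + t ^ 2) ^ (-b)| ≤ (z ^ 2 + t ^ 2) ^ (-(b - 1 / 2)) := by
  have h := sq_add_sq_pos z ht
  have h1 : |z| ≤ (z ^ 2 + t ^ 2) ^ (1 / 2 : ℝ) := by
    rw [← Real.sqrt_eq_rpow, ← Real.sqrt_sq_eq_abs]
    exact Real.sqrt_le_sqrt (by nlinarith [sq_nonneg t])
  rw [abs_mul, abs_of_nonneg (Real.rpow_nonneg h.le _)]
  calc |z| * (z ^ 2 + t ^ 2) ^ (-b) ≤ (z ^ 2 + t ^ 2) ^ (1 / 2 : ℝ) * (z ^ 2 + t ^ 2) ^ (-b) := by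
        gcongr
    _ = _ := by rw [← Real.rpow_add h]; congr 1; ring

lemma hasDerivAt_sq_add_sq_rpow_left (x s b : ℝ) {t : ℝ} (ht : 0 < t) :
    HasDerivAt (fun x => ((x - s) ^ 2 + t ^ 2) ^ (-b))
      (-2 * b * ((x - s) * ((x - s) ^ 2 + t ^ 2) ^ (-(b + 1)))) x := by
  have h := ((((hasDerivAt_id x).sub_const s).pow 2).add_const (t ^ 2)).rpow_const (p := -b)
    (Or.inl (sq_add_sq_pos _ ht).ne')
  refine HasDerivAt.congr_deriv (f := fun _ => _) h ?_
  rw [show -(b + 1) = -b - 1 by ring]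
  simp
  ring

lemma hasDerivAt_sq_add_sq_rpow_right (x s b : ℝ) {t : ℝ} (ht : 0 < t) :
    HasDerivAt (fun t => ((x - s) ^ 2 + t ^ 2) ^ (-b))
      (-2 * b * t * ((x - s) ^ 2 + t ^ 2) ^ (-(b + 1))) t := by
  have h := (((hasDerivAt_id t).pow 2).const_add ((x - s) ^ 2)).rpow_const (p := -b)
    (Or.inl (sq_add_sq_pos _ ht).ne')
  refine HasDerivAt.congr_deriv (f := fun _ => _) h ?_
  rw [show -(b + 1) = -b - 1 by ring]
  simp
  left
  ring

section weighted

variable {α : ℝ} {m : ℝ → ℝ}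

lemma integrable_kernel_mul (hmc : Continuous m)
    (hm : Integrable fun s : ℝ => (s ^ 2 + 1) ^ (-(α / 2)) * m s) {k : ℝ → ℝ} {C : ℝ}
    (hk : Continuous k) (hb : ∀ s, |k s| ≤ C * (s ^ 2 + 1) ^ (-(α / 2))) :
    Integrable fun s => k s * m s := by
  refine (hm.norm.const_mul C).mono' (hk.mul hmc).aestronglyMeasurable (ae_of_all _ fun s => ?_)
  have h : 0 ≤ ((s ^ 2 + 1) ^ (-(α / 2)) : ℝ) := by positivity
  rw [Real.norm_eq_abs, Real.norm_eq_abs, abs_mul, abs_mul, abs_of_nonneg h, ← mul_assoc]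
  exact mul_le_mul_of_nonneg_right (hb s) (abs_nonneg _)

lemma hasDerivAt_integral_kernel_mul (hmc : Continuous m)
    (hm : Integrable fun s : ℝ => (s ^ 2 + 1) ^ (-(α / 2)) * m s) {k k' : ℝ → ℝ → ℝ}
    {θ₀ δ C : ℝ} (hδ : 0 < δ) (hk : ∀ θ, |θ - θ₀| ≤ δ → Continuous (k θ))
    (hk' : Continuous (k' θ₀)) (hi : Integrable fun s => k θ₀ s * m s)
    (hb : ∀ θ, |θ - θ₀| ≤ δ → ∀ s, |k' θ s| ≤ C * (s ^ 2 + 1) ^ (-(α / 2)))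
    (hd : ∀ θ, |θ - θ₀| ≤ δ → ∀ s, HasDerivAt (fun θ => k θ s) (k' θ s) θ) :
    HasDerivAt (fun θ => ∫ s, k θ s * m s) (∫ s, k' θ₀ s * m s) θ₀ := by
  have hball : ∀ θ ∈ Metric.ball θ₀ δ, |θ - θ₀| ≤ δ := fun θ h => by
    rw [Metric.mem_ball, Real.dist_eq] at h; exact h.le
  refine (hasDerivAt_integral_of_dominated_loc_of_deriv_le (F := fun θ s => k θ s * m s)
    (F' := fun θ s => k' θ s * m s)
    (bound := fun s => C * ‖(s ^ 2 + 1) ^ (-(α / 2)) * m s‖) (Metric.ball_mem_nhds θ₀ hδ)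
    ?_ hi (hk'.mul hmc).aestronglyMeasurable ?_ (hm.norm.const_mul C) ?_).2
  · filter_upwards [Metric.ball_mem_nhds θ₀ hδ] with θ hθ
    exact ((hk θ (hball θ hθ)).mul hmc).aestronglyMeasurable
  · refine ae_of_all _ fun s θ hθ => ?_
    have h : 0 ≤ ((s ^ 2 + 1) ^ (-(α / 2)) : ℝ) := by positivity
    rw [Real.norm_eq_abs, Real.norm_eq_abs, abs_mul, abs_mul, abs_of_nonneg h, ← mul_assoc]
    exact mul_le_mul_of_nonneg_right (hb θ (hball θ hθ) s) (abs_nonneg _)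
  · exact ae_of_all _ fun s θ hθ => (hd θ (hball θ hθ) s).mul_const _

lemma continuousAt_integral_kernel_mul (hmc : Continuous m)
    (hm : Integrable fun s : ℝ => (s ^ 2 + 1) ^ (-(α / 2)) * m s) {k : ℝ × ℝ → ℝ → ℝ}
    {p₀ : ℝ × ℝ} {δ C : ℝ} (hδ : 0 < δ)
    (hk : ∀ p : ℝ × ℝ, |p.1 - p₀.1| ≤ δ → |p.2 - p₀.2| ≤ δ → Continuous (k p))
    (hb : ∀ p : ℝ × ℝ, |p.1 - p₀.1| ≤ δ → |p.2 - p₀.2| ≤ δ →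
      ∀ s, |k p s| ≤ C * (s ^ 2 + 1) ^ (-(α / 2)))
    (hd : ∀ s, ContinuousAt (fun p => k p s) p₀) :
    ContinuousAt (fun p => ∫ s, k p s * m s) p₀ := by
  have hball : ∀ p ∈ Metric.ball p₀ δ, |p.1 - p₀.1| ≤ δ ∧ |p.2 - p₀.2| ≤ δ := fun p h => by
    rw [Metric.mem_ball, Prod.dist_eq, max_lt_iff, Real.dist_eq, Real.dist_eq] at h
    exact ⟨h.1.le, h.2.le⟩
  refine continuousAt_of_dominated (bound := fun s => C * ‖(s ^ 2 + 1) ^ (-(α / 2)) * m s‖)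
    ?_ ?_ (hm.norm.const_mul C) (ae_of_all _ fun s => (hd s).mul continuousAt_const)
  · filter_upwards [Metric.ball_mem_nhds p₀ hδ] with p hp
    exact ((hk p (hball p hp).1 (hball p hp).2).mul hmc).aestronglyMeasurable
  · filter_upwards [Metric.ball_mem_nhds p₀ hδ] with p hp
    refine ae_of_all _ fun s => ?_
    have h : 0 ≤ ((s ^ 2 + 1) ^ (-(α / 2)) : ℝ) := by positivity
    rw [Real.norm_eq_abs, Real.norm_eq_abs, abs_mul, abs_mul, abs_of_nonneg h, ← mul_assoc]
    exact mul_le_mul_of_nonneg_right (hb p (hball p hp).1 (hball p hp).2 s) (abs_nonneg _)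

lemma pos_of_abs_sub_le_half {t t₀ : ℝ} (ht₀ : 0 < t₀) (h : |t - t₀| ≤ t₀ / 2) : 0 < t := by
  linarith [(abs_le.1 h).1]

lemma abs_sub_self_le_half (x : ℝ) {t : ℝ} (ht : 0 < t) : |x - x| ≤ t / 2 := by
  simp; linarith

lemma integrable_potential (hα : 0 ≤ α) (hmc : Continuous m)
    (hm : Integrable fun s : ℝ => (s ^ 2 + 1) ^ (-(α / 2)) * m s) {b : ℝ} (hb : α / 2 ≤ b)
    (x : ℝ) {t : ℝ} (ht : 0 < t) :
    Integrable fun s => ((x - s) ^ 2 + t ^ 2) ^ (-b) * m s := by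
  obtain ⟨C, -, h⟩ := exists_rpow_neg_le x ht hα hb
  refine integrable_kernel_mul hmc hm (continuous_sq_add_sq_rpow x _ ht) (C := C) fun s => ?_
  rw [abs_of_nonneg (by positivity)]
  exact h x t (abs_sub_self_le_half x ht) (abs_sub_self_le_half t ht) s

lemma integrable_dipole (hα : 0 ≤ α) (hmc : Continuous m)
    (hm : Integrable fun s : ℝ => (s ^ 2 + 1) ^ (-(α / 2)) * m s) {b : ℝ}
    (hb : (1 + α) / 2 ≤ b) (x : ℝ) {t : ℝ} (ht : 0 < t) :
    Integrable fun s => (x - s) * ((x - s) ^ 2 + t ^ 2) ^ (-b) * m s := by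
  obtain ⟨C, -, h⟩ := exists_rpow_neg_le x ht hα (e := b - 1 / 2) (by linarith)
  refine integrable_kernel_mul hmc hm
    ((continuous_const.sub continuous_id).mul (continuous_sq_add_sq_rpow x _ ht)) (C := C)
    fun s => (abs_mul_rpow_neg_le _ _ ht).trans
      (h x t (abs_sub_self_le_half x ht) (abs_sub_self_le_half t ht) s)

lemma hasDerivAt_potential_left (hα : 0 ≤ α) (hmc : Continuous m)
    (hm : Integrable fun s : ℝ => (s ^ 2 + 1) ^ (-(α / 2)) * m s) {b : ℝ} (hb : α / 2 ≤ b)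
    (x : ℝ) {t : ℝ} (ht : 0 < t) :
    HasDerivAt (fun x => potential b m x t) (-2 * b * dipole (b + 1) m x t) x := by
  obtain ⟨C, hC, h⟩ := exists_rpow_neg_le x ht hα (e := b + 1 - 1 / 2) (by linarith)
  have := hasDerivAt_integral_kernel_mul hmc hm (θ₀ := x) (C := |-2 * b| * C) (half_pos ht)
    (k := fun x s => ((x - s) ^ 2 + t ^ 2) ^ (-b))
    (k' := fun x s => -2 * b * ((x - s) * ((x - s) ^ 2 + t ^ 2) ^ (-(b + 1))))
    (fun y _ => continuous_sq_add_sq_rpow y _ ht)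
    (((continuous_const.sub continuous_id).mul (continuous_sq_add_sq_rpow x _ ht)).const_mul _)
    (integrable_potential hα hmc hm hb x ht)
    (fun y hy s => by
      rw [abs_mul, mul_assoc]
      gcongr
      exact (abs_mul_rpow_neg_le _ _ ht).trans (h y t hy (abs_sub_self_le_half t ht) s))
    (fun y _ s => hasDerivAt_sq_add_sq_rpow_left y s b ht)
  unfold potential dipole
  rw [← integral_const_mul]
  simpa only [mul_assoc] using this

lemma hasDerivAt_potential_right (hα : 0 ≤ α) (hmc : Continuous m)
    (hm : Integrable fun s : ℝ => (s ^ 2 + 1) ^ (-(α / 2)) * m s) {b : ℝ} (hb : α / 2 ≤ b)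
    (x : ℝ) {t : ℝ} (ht : 0 < t) :
    HasDerivAt (fun t => potential b m x t) (-2 * b * t * potential (b + 1) m x t) t := by
  obtain ⟨C, hC, h⟩ := exists_rpow_neg_le x ht hα (e := b + 1) (by linarith)
  have := hasDerivAt_integral_kernel_mul hmc hm (θ₀ := t) (C := |2 * b| * (2 * t) * C)
    (half_pos ht)
    (k := fun t s => ((x - s) ^ 2 + t ^ 2) ^ (-b))
    (k' := fun t s => -2 * b * t * ((x - s) ^ 2 + t ^ 2) ^ (-(b + 1)))
    (fun y hy => continuous_sq_add_sq_rpow x _ (pos_of_abs_sub_le_half ht hy))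
    ((continuous_sq_add_sq_rpow x _ ht).const_mul _)
    (integrable_potential hα hmc hm hb x ht)
    (fun y hy s => by
      have hy0 := pos_of_abs_sub_le_half ht hy
      have hy1 : y ≤ 2 * t := by linarith [(abs_le.1 hy).2]
      have h1 := h x y (abs_sub_self_le_half x ht) hy s
      have h2 : (0 : ℝ) ≤ ((x - s) ^ 2 + y ^ 2) ^ (-(b + 1)) := by positivity
      rw [abs_mul, abs_mul, abs_of_nonneg h2, abs_of_pos hy0, mul_assoc, mul_assoc, mul_assoc,
        show -2 * b = -(2 * b) by ring, abs_neg]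
      gcongr)
    (fun y hy s => hasDerivAt_sq_add_sq_rpow_right x s b (pos_of_abs_sub_le_half ht hy))
  unfold potential
  rw [← integral_const_mul]
  simpa only [mul_assoc] using this

lemma hasDerivAt_dipole_left (hα : 0 ≤ α) (hmc : Continuous m)
    (hm : Integrable fun s : ℝ => (s ^ 2 + 1) ^ (-(α / 2)) * m s) {b : ℝ}
    (hb : (1 + α) / 2 ≤ b) (x : ℝ) {t : ℝ} (ht : 0 < t) :
    HasDerivAt (fun x => dipole b m x t)
      ((1 - 2 * b) * potential b m x t + 2 * b * t ^ 2 * potential (b + 1) m x t) x := by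
  obtain ⟨C, hC, h⟩ := exists_rpow_neg_le x ht hα (e := b) (by linarith)
  obtain ⟨C', hC', h'⟩ := exists_rpow_neg_le x ht hα (e := b + 1) (by linarith)
  have := hasDerivAt_integral_kernel_mul hmc hm (θ₀ := x)
    (C := |1 - 2 * b| * C + |2 * b * t ^ 2| * C') (half_pos ht)
    (k := fun x s => (x - s) * ((x - s) ^ 2 + t ^ 2) ^ (-b))
    (k' := fun x s => (1 - 2 * b) * ((x - s) ^ 2 + t ^ 2) ^ (-b) +
      2 * b * t ^ 2 * ((x - s) ^ 2 + t ^ 2) ^ (-(b + 1)))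
    (fun y _ => (continuous_const.sub continuous_id).mul (continuous_sq_add_sq_rpow y _ ht))
    (((continuous_sq_add_sq_rpow x _ ht).const_mul _).add
      ((continuous_sq_add_sq_rpow x _ ht).const_mul _))
    (integrable_dipole hα hmc hm hb x ht)
    (fun y hy s => by
      have h1 := h y t hy (abs_sub_self_le_half t ht) s
      have h2 := h' y t hy (abs_sub_self_le_half t ht) s
      have h3 : (0 : ℝ) ≤ ((y - s) ^ 2 + t ^ 2) ^ (-(b + 1)) := by positivity
      have h4 : (0 : ℝ) ≤ ((y - s) ^ 2 + t ^ 2) ^ (-b) := by positivity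
      refine (abs_add_le _ _).trans ?_
      rw [abs_mul, abs_mul (2 * b * t ^ 2), abs_of_nonneg h3, abs_of_nonneg h4, add_mul,
        mul_assoc _ C, mul_assoc _ C']
      gcongr)
    (fun y _ s => by
      have hd := ((hasDerivAt_id y).sub_const s).mul (hasDerivAt_sq_add_sq_rpow_left y s b ht)
      refine HasDerivAt.congr_deriv (f := fun _ => _) hd ?_
      have e : ((y - s) ^ 2 + t ^ 2) ^ (-b)
          = ((y - s) ^ 2 + t ^ 2) * ((y - s) ^ 2 + t ^ 2) ^ (-(b + 1)) := by
        rw [← Real.rpow_one_add' (by positivity) (by linarith)]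
        congr 1; ring
      simp only [id, e]
      ring)
  unfold potential dipole
  rw [← integral_const_mul, ← integral_const_mul, ← integral_add]
  · simpa only [mul_assoc, add_mul] using this
  · exact (integrable_potential hα hmc hm (by linarith) x ht).const_mul _
  · exact (integrable_potential hα hmc hm (by linarith) x ht).const_mul _

lemma hasDerivAt_dipole_right (hα : 0 ≤ α) (hmc : Continuous m)
    (hm : Integrable fun s : ℝ => (s ^ 2 + 1) ^ (-(α / 2)) * m s) {b : ℝ}
    (hb : (1 + α) / 2 ≤ b) (x : ℝ) {t : ℝ} (ht : 0 < t) :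
    HasDerivAt (fun t => dipole b m x t) (-2 * b * t * dipole (b + 1) m x t) t := by
  obtain ⟨C, hC, h⟩ := exists_rpow_neg_le x ht hα (e := b + 1 - 1 / 2) (by linarith)
  have := hasDerivAt_integral_kernel_mul hmc hm (θ₀ := t) (C := |2 * b| * (2 * t) * C)
    (half_pos ht)
    (k := fun t s => (x - s) * ((x - s) ^ 2 + t ^ 2) ^ (-b))
    (k' := fun t s => -2 * b * t * ((x - s) * ((x - s) ^ 2 + t ^ 2) ^ (-(b + 1))))
    (fun y hy => (continuous_const.sub continuous_id).mul
      (continuous_sq_add_sq_rpow x _ (pos_of_abs_sub_le_half ht hy)))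
    (((continuous_const.sub continuous_id).mul (continuous_sq_add_sq_rpow x _ ht)).const_mul _)
    (integrable_dipole hα hmc hm hb x ht)
    (fun y hy s => by
      have hy0 := pos_of_abs_sub_le_half ht hy
      have hy1 : y ≤ 2 * t := by linarith [(abs_le.1 hy).2]
      have h1 := (abs_mul_rpow_neg_le (x - s) (b + 1) hy0).trans
        (h x y (abs_sub_self_le_half x ht) hy s)
      rw [abs_mul, abs_mul, abs_of_pos hy0, mul_assoc, mul_assoc, mul_assoc,
        show -2 * b = -(2 * b) by ring, abs_neg]
      gcongr)
    (fun y hy s => by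
      have hd := (hasDerivAt_sq_add_sq_rpow_right x s b (pos_of_abs_sub_le_half ht hy)).const_mul
        (x - s)
      refine HasDerivAt.congr_deriv (f := fun _ => _) hd ?_
      ring)
  unfold dipole
  rw [← integral_const_mul]
  simpa only [mul_assoc] using this

lemma continuousAt_sq_add_sq_rpow (b s : ℝ) {p₀ : ℝ × ℝ} (h : 0 < p₀.2) :
    ContinuousAt (fun p : ℝ × ℝ => ((p.1 - s) ^ 2 + p.2 ^ 2) ^ b) p₀ :=
  ContinuousAt.rpow_const (by fun_prop) (Or.inl (sq_add_sq_pos _ h).ne')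

lemma continuousOn_potential (hα : 0 ≤ α) (hmc : Continuous m)
    (hm : Integrable fun s : ℝ => (s ^ 2 + 1) ^ (-(α / 2)) * m s) {b : ℝ} (hb : α / 2 ≤ b) :
    ContinuousOn (fun p : ℝ × ℝ => potential b m p.1 p.2) {p | 0 < p.2} := by
  intro p₀ (h₀ : 0 < p₀.2)
  refine ContinuousAt.continuousWithinAt ?_
  obtain ⟨C, -, h⟩ := exists_rpow_neg_le p₀.1 h₀ hα hb
  refine continuousAt_integral_kernel_mul hmc hm (half_pos h₀) (C := C)
    (fun p _ h2 => continuous_sq_add_sq_rpow _ _ (pos_of_abs_sub_le_half h₀ h2))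
    (fun p h1 h2 s => ?_) (fun s => continuousAt_sq_add_sq_rpow _ s h₀)
  rw [abs_of_nonneg (by positivity)]
  exact h _ _ h1 h2 s

lemma continuousOn_dipole (hα : 0 ≤ α) (hmc : Continuous m)
    (hm : Integrable fun s : ℝ => (s ^ 2 + 1) ^ (-(α / 2)) * m s) {b : ℝ}
    (hb : (1 + α) / 2 ≤ b) :
    ContinuousOn (fun p : ℝ × ℝ => dipole b m p.1 p.2) {p | 0 < p.2} := by
  intro p₀ (h₀ : 0 < p₀.2)
  refine ContinuousAt.continuousWithinAt ?_
  obtain ⟨C, -, h⟩ := exists_rpow_neg_le p₀.1 h₀ hα (e := b - 1 / 2) (by linarith)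
  exact continuousAt_integral_kernel_mul hmc hm (half_pos h₀) (C := C)
    (fun p _ h2 => (continuous_const.sub continuous_id).mul
      (continuous_sq_add_sq_rpow _ _ (pos_of_abs_sub_le_half h₀ h2)))
    (fun p h1 h2 s => (abs_mul_rpow_neg_le _ _ (pos_of_abs_sub_le_half h₀ h2)).trans
      (h _ _ h1 h2 s))
    (fun s => ContinuousAt.mul (by fun_prop) (continuousAt_sq_add_sq_rpow _ s h₀))

end weighted

/-! ### The integral of `(z² + 1)^(-b)`, its tails and scaling. -/

lemma integrable_sq_add_one_rpow {b : ℝ} (hb : 1 / 2 < b) :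
    Integrable fun z : ℝ => (z ^ 2 + 1) ^ (-b) := by
  have h := integrable_rpow_neg_one_add_norm_sq (E := ℝ) (μ := volume) (r := 2 * b)
    (by simp; linarith)
  refine h.congr (ae_of_all _ fun z => ?_)
  simp only [Real.norm_eq_abs, sq_abs]
  rw [add_comm, show -(2 * b) / 2 = -b by ring]

/-- Represent `(z² + 1)^(-b) Γ(b)` as a Gamma integral in `r`, exchange the integrals, and evaluate
the Gaussian in `z`. -/
lemma integral_sq_add_one_rpow {b : ℝ} (hb : 1 / 2 < b) :
    ∫ z : ℝ, (z ^ 2 + 1) ^ (-b) = √Real.pi * Real.Gamma (b - 1 / 2) / Real.Gamma b := by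
  have hG : 0 < Real.Gamma b := Real.Gamma_pos_of_pos (by linarith)
  have hinner : ∀ z : ℝ, ∫ r in Set.Ioi (0 : ℝ), r ^ (b - 1) * Real.exp (-((z ^ 2 + 1) * r))
      = (z ^ 2 + 1) ^ (-b) * Real.Gamma b := fun z => by
    rw [Real.integral_rpow_mul_exp_neg_mul_Ioi (by linarith) (by positivity), one_div,
      Real.inv_rpow (by positivity), Real.rpow_neg (by positivity)]
  have hint : Integrable (Function.uncurry fun z r : ℝ =>
      r ^ (b - 1) * Real.exp (-((z ^ 2 + 1) * r)))
      (volume.prod (volume.restrict (Set.Ioi (0 : ℝ)))) := by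
    rw [integrable_prod_iff (by
      refine Measurable.aestronglyMeasurable ?_
      unfold Function.uncurry
      fun_prop)]
    constructor
    · refine ae_of_all _ fun z => ?_
      -- A non-integrable function has integral zero by convention, so a nonzero value of the
      -- integral proves integrability.
      by_contra hcon
      have h0 := hinner z
      have hcon' := integral_undef hcon
      simp only [Function.uncurry] at hcon'
      rw [hcon'] at h0
      have : 0 < (z ^ 2 + 1) ^ (-b) * Real.Gamma b := by positivity
      linarith
    · refine ((integrable_sq_add_one_rpow hb).mul_const (Real.Gamma b)).congr
        (ae_of_all _ fun z => ?_)
      simp only [Function.uncurry]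
      rw [← hinner z]
      refine setIntegral_congr_fun measurableSet_Ioi fun r hr => ?_
      have hr0 : 0 < r := hr
      exact (Real.norm_of_nonneg (by positivity)).symm
  have hswap := integral_integral_swap hint
  simp_rw [hinner] at hswap
  rw [integral_mul_const] at hswap
  rw [eq_div_iff hG.ne', hswap, Real.Gamma_eq_integral (by linarith), ← integral_const_mul]
  refine setIntegral_congr_fun measurableSet_Ioi fun r hr => ?_
  have hr0 : 0 < r := hr
  have h1 : ∀ z : ℝ, r ^ (b - 1) * Real.exp (-((z ^ 2 + 1) * r))
      = r ^ (b - 1) * Real.exp (-r) * Real.exp (-r * z ^ 2) := fun z => by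
    rw [mul_assoc, ← Real.exp_add]; congr 2; ring
  simp only [h1]
  rw [integral_const_mul, integral_gaussian, Real.sqrt_div Real.pi_pos.le, Real.sqrt_eq_rpow r,
    show b - 1 / 2 - 1 = b - 1 - 1 / 2 by ring, Real.rpow_sub hr0 (b - 1)]
  ring

/-- The tail `∫_q^∞ (z² + 1)^(-b) dz`. -/
def tailIntegral (b q : ℝ) : ℝ := ∫ z in Set.Ioi q, (z ^ 2 + 1) ^ (-b)

lemma continuous_sq_add_one_rpow (b : ℝ) : Continuous fun z : ℝ => (z ^ 2 + 1) ^ b :=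
  Continuous.rpow_const (by fun_prop) fun s => Or.inl (by positivity)

lemma tailIntegral_nonneg (b q : ℝ) : 0 ≤ tailIntegral b q :=
  setIntegral_nonneg measurableSet_Ioi fun z _ => by positivity

lemma hasDerivAt_tailIntegral {b : ℝ} (hb : 1 / 2 < b) (q : ℝ) :
    HasDerivAt (tailIntegral b) (-(q ^ 2 + 1) ^ (-b)) q := by
  have hi := integrable_sq_add_one_rpow hb
  have e : tailIntegral b = fun q => tailIntegral b 0 - ∫ z in (0 : ℝ)..q, (z ^ 2 + 1) ^ (-b) := by
    funext q
    rw [tailIntegral, tailIntegral, ← intervalIntegral.integral_interval_add_Ioi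
      (hi.integrableOn (s := Set.Ioi 0)) (hi.integrableOn (s := Set.Ioi q))]
    ring
  rw [e]
  exact ((continuous_sq_add_one_rpow (-b)).integral_hasStrictDerivAt 0 q).hasDerivAt.const_sub _

lemma sq_add_sq_rpow_eq_scaled (z b : ℝ) {t : ℝ} (ht : 0 < t) :
    (z ^ 2 + t ^ 2) ^ (-b) = t ^ (-(2 * b)) * ((z / t) ^ 2 + 1) ^ (-b) := by
  have : z ^ 2 + t ^ 2 = t ^ 2 * ((z / t) ^ 2 + 1) := by field_simp
  rw [this, Real.mul_rpow (by positivity) (by positivity), ← Real.rpow_natCast t 2,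
    ← Real.rpow_mul ht.le]
  congr 2
  push_cast; ring

lemma integral_Iio_sq_add_sq_rpow (x s b : ℝ) {t : ℝ} (ht : 0 < t) :
    ∫ z in Set.Iio s, ((x - z) ^ 2 + t ^ 2) ^ (-b)
      = t ^ (1 - 2 * b) * tailIntegral b ((x - s) / t) := by
  set g : ℝ → ℝ := (Set.Ioi ((x - s) / t)).indicator fun q => (q ^ 2 + 1) ^ (-b) with hg
  have h1 : ∀ z, (Set.Iio s).indicator (fun z => ((x - z) ^ 2 + t ^ 2) ^ (-b)) z
      = t ^ (-(2 * b)) * g ((x - z) / t) := fun z => by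
    by_cases hz : z < s
    · have : (x - z) / t ∈ Set.Ioi ((x - s) / t) := by
        rw [Set.mem_Ioi]; gcongr
      rw [Set.indicator_of_mem (Set.mem_Iio.2 hz), hg, Set.indicator_of_mem this,
        sq_add_sq_rpow_eq_scaled _ _ ht]
    · have : (x - z) / t ∉ Set.Ioi ((x - s) / t) := by
        rw [Set.mem_Ioi, not_lt]; gcongr; linarith
      rw [Set.indicator_of_notMem (Set.notMem_Iio.2 (not_lt.1 hz)), hg, Set.indicator_of_notMem this, mul_zero]
  rw [← integral_indicator measurableSet_Iio]
  simp_rw [h1]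
  rw [integral_const_mul, integral_sub_left_eq_self (fun z => g (z / t)) volume x,
    Measure.integral_comp_div, abs_of_pos ht, hg, integral_indicator measurableSet_Ioi,
    smul_eq_mul, ← mul_assoc, show 1 - 2 * b = -(2 * b) + 1 by ring, Real.rpow_add_one ht.ne']
  rfl

lemma integral_sq_add_sq_rpow (x b : ℝ) {t : ℝ} (ht : 0 < t) :
    ∫ z, ((x - z) ^ 2 + t ^ 2) ^ (-b) = t ^ (1 - 2 * b) * ∫ z : ℝ, (z ^ 2 + 1) ^ (-b) := by
  simp_rw [sq_add_sq_rpow_eq_scaled _ b ht]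
  rw [integral_const_mul, integral_sub_left_eq_self (fun z => ((z / t) ^ 2 + 1) ^ (-b)) volume x,
    Measure.integral_comp_div (fun z => (z ^ 2 + 1) ^ (-b)), abs_of_pos ht,
    smul_eq_mul, ← mul_assoc, show 1 - 2 * b = -(2 * b) + 1 by ring, Real.rpow_add_one ht.ne']

/-- Only the window of length `√(s² + 1)` to the left of `s` is kept; there `z² + 1 ≤ 5(s² + 1)`.
The bound has the decay of `(s² + 1)^(1/2 - b)` for both signs of `s`, including `s → -∞`. -/
lemma le_integral_Iio_sq_add_one_rpow {b : ℝ} (hb : 1 / 2 < b) (s : ℝ) :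
    (5 : ℝ) ^ (-b) * (s ^ 2 + 1) ^ (1 / 2 - b) ≤ ∫ z in Set.Iio s, (z ^ 2 + 1) ^ (-b) := by
  set h := √(s ^ 2 + 1) with hh
  have hs : 0 < s ^ 2 + 1 := by positivity
  have h0 : 0 < h := Real.sqrt_pos.2 hs
  have hsq : h ^ 2 = s ^ 2 + 1 := Real.sq_sqrt hs.le
  have habs : |s| ≤ h := by
    rw [← Real.sqrt_sq_eq_abs]; exact Real.sqrt_le_sqrt (by linarith)
  have hle : ∀ z ∈ Set.Ico (s - h) s, (5 * (s ^ 2 + 1)) ^ (-b) ≤ (z ^ 2 + 1) ^ (-b) := by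
    intro z hz
    refine Real.rpow_le_rpow_of_nonpos (by positivity) ?_ (by linarith)
    have h1 : |z| ≤ 2 * h := abs_le.2 ⟨by linarith [hz.1, (abs_le.1 habs).1],
      by linarith [hz.2, (abs_le.1 habs).2]⟩
    have h2 : z ^ 2 ≤ (2 * h) ^ 2 := sq_le_sq' (by linarith [(abs_le.1 h1).1]) (abs_le.1 h1).2
    nlinarith [sq_nonneg s]
  calc (5 : ℝ) ^ (-b) * (s ^ 2 + 1) ^ (1 / 2 - b)
      = ∫ z in Set.Ico (s - h) s, (5 * (s ^ 2 + 1)) ^ (-b) := by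
        rw [setIntegral_const, measureReal_def, Real.volume_Ico, sub_sub_cancel,
          ENNReal.toReal_ofReal h0.le, Real.mul_rpow (by norm_num) hs.le, sub_eq_add_neg,
          Real.rpow_add hs, ← Real.sqrt_eq_rpow, smul_eq_mul]
        ring
    _ ≤ ∫ z in Set.Ico (s - h) s, (z ^ 2 + 1) ^ (-b) :=
        setIntegral_mono_on (integrableOn_const (by simp))
          (integrable_sq_add_one_rpow hb).integrableOn measurableSet_Ico hle
    _ ≤ _ := setIntegral_mono_set (integrable_sq_add_one_rpow hb).integrableOn
        (ae_of_all _ fun z => by simp only [Pi.zero_apply]; positivity)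
        (Set.Ico_subset_Iio_self).eventuallyLE

/-! ### Layer representation: integrals of `τ - u` as integrals of `u'`. -/

section layer

variable {u m : ℝ → ℝ} {τ : ℝ}

lemma integrableOn_Ioi_of_hasDerivAt (hd : ∀ x, HasDerivAt u (m x) x) (hm0 : ∀ x, 0 ≤ m x)
    (hlim : Tendsto u atTop (𝓝 τ)) (x : ℝ) : IntegrableOn m (Set.Ioi x) :=
  integrableOn_Ioi_deriv_of_nonneg' (fun y _ => hd y) (fun y _ => hm0 y) hlim

lemma integral_Ioi_eq_sub (hd : ∀ x, HasDerivAt u (m x) x) (hm0 : ∀ x, 0 ≤ m x)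
    (hlim : Tendsto u atTop (𝓝 τ)) (x : ℝ) : ∫ s in Set.Ioi x, m s = τ - u x :=
  integral_Ioi_of_hasDerivAt_of_nonneg' (fun y _ => hd y) (fun y _ => hm0 y) hlim

/-- This is Tonelli after inserting `τ - u(z) = ∫_z^∞ m`. All factors are nonnegative, so
integrability passes from the `u` side to the `m` side, and no boundary term at `-∞` has to be
discussed. -/
lemma layer_integral (hd : ∀ x, HasDerivAt u (m x) x) (hmc : Continuous m) (hm0 : ∀ x, 0 ≤ m x)
    (hlim : Tendsto u atTop (𝓝 τ)) {k : ℝ → ℝ} (hk : Measurable k) (hk0 : ∀ z, 0 ≤ k z)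
    (hki : Integrable fun z => k z * (τ - u z)) :
    Integrable (fun s => (∫ z in Set.Iio s, k z) * m s) ∧
      ∫ z, k z * (τ - u z) = ∫ s, (∫ z in Set.Iio s, k z) * m s := by
  set Θ : ℝ → ℝ → ℝ := fun z s => if z < s then k z * m s else 0 with hΘ
  have h1 : ∀ z, Θ z = (Set.Ioi z).indicator fun s => k z * m s := fun z => by
    funext s; simp [hΘ, Set.indicator_apply]
  have h2 : ∀ s, (fun z => Θ z s) = (Set.Iio s).indicator fun z => k z * m s := fun s => by
    funext z; simp [hΘ, Set.indicator_apply]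
  have hin : ∀ z, ∫ s, Θ z s = k z * (τ - u z) := fun z => by
    rw [h1, integral_indicator measurableSet_Ioi, integral_const_mul,
      integral_Ioi_eq_sub hd hm0 hlim]
  have hout : ∀ s, ∫ z, Θ z s = (∫ z in Set.Iio s, k z) * m s := fun s => by
    rw [h2, integral_indicator measurableSet_Iio, integral_mul_const]
  have hΘ0 : ∀ z s, 0 ≤ Θ z s := fun z s => by
    simp only [hΘ]; split_ifs
    · exact mul_nonneg (hk0 z) (hm0 s)
    · exact le_rfl
  have hmeas : Measurable (Function.uncurry Θ) :=
    Measurable.ite (measurableSet_lt measurable_fst measurable_snd)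
      ((hk.comp measurable_fst).mul (hmc.measurable.comp measurable_snd)) measurable_const
  have hint : Integrable (Function.uncurry Θ) (volume.prod volume) := by
    rw [integrable_prod_iff hmeas.aestronglyMeasurable]
    constructor
    · refine ae_of_all _ fun z => ?_
      simp only [Function.uncurry]
      change Integrable (Θ z) volume
      rw [h1, integrable_indicator_iff measurableSet_Ioi]
      exact (integrableOn_Ioi_of_hasDerivAt hd hm0 hlim z).const_mul _
    · refine hki.congr (ae_of_all _ fun z => ?_)
      simp only [Function.uncurry, Real.norm_of_nonneg (hΘ0 z _)]
      exact (hin z).symm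
  constructor
  · refine hint.integral_prod_right.congr (ae_of_all _ fun s => ?_)
    exact hout s
  · have := integral_integral_swap hint
    simp_rw [hin, hout] at this
    exact this

/-- The inner integral of the layer representation is bounded below by a multiple of `(s² +
1)^(-α/2)`, so integrating by parts gains half a power of the weight. -/
lemma integrable_weight_mul_deriv {α : ℝ} (hα : 0 < α) (hd : ∀ x, HasDerivAt u (m x) x)
    (hmc : Continuous m) (hm0 : ∀ x, 0 ≤ m x) (hlim : Tendsto u atTop (𝓝 τ))
    (hw : Integrable fun z : ℝ => (z ^ 2 + 1) ^ (-((1 + α) / 2)) * (τ - u z)) :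
    Integrable fun s : ℝ => (s ^ 2 + 1) ^ (-(α / 2)) * m s := by
  have h := (layer_integral hd hmc hm0 hlim (continuous_sq_add_one_rpow _).measurable
    (fun z => by positivity) hw).1.const_mul ((5 : ℝ) ^ ((1 + α) / 2))
  refine h.mono' ((continuous_sq_add_one_rpow _).mul hmc).aestronglyMeasurable
    (ae_of_all _ fun s => ?_)
  have h1 := le_integral_Iio_sq_add_one_rpow (b := (1 + α) / 2) (by linarith) s
  rw [show 1 / 2 - (1 + α) / 2 = -(α / 2) by ring, Real.rpow_neg (by norm_num),
    inv_mul_le_iff₀ (by positivity)] at h1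
  rw [Real.norm_of_nonneg (mul_nonneg (by positivity) (hm0 s)), ← mul_assoc]
  exact mul_le_mul_of_nonneg_right h1 (hm0 s)

end layer

/-! ### Constants, and convergence of the Poisson integral. -/

lemma fracLaplacianConst_pos {α : ℝ} (hα₀ : 0 < α) (hα₂ : α < 2) : 0 < fracLaplacianConst α := by
  have h1 : 0 < Real.Gamma ((1 + α) / 2) := Real.Gamma_pos_of_pos (by linarith)
  have h2 : 0 < Real.Gamma (1 - α / 2) := Real.Gamma_pos_of_pos (by linarith)
  have := Real.pi_pos
  unfold fracLaplacianConst
  positivity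

lemma extensionConst_pos {α : ℝ} (hα₀ : 0 < α) (hα₂ : α < 2) : 0 < extensionConst α := by
  have h1 : 0 < Real.Gamma (α / 2) := Real.Gamma_pos_of_pos (by linarith)
  have h2 : 0 < Real.Gamma (1 - α / 2) := Real.Gamma_pos_of_pos (by linarith)
  unfold extensionConst
  positivity

/-- One truncated integral, at the point `0` with `ε = 1`, is enough: outside `[-1, 1]` its kernel
dominates the weight, and on the compact remainder `u` is continuous. This replaces any boundedness
assumption on `u`. -/
lemma HasFracLaplacian.integrable_weight_mul {α : ℝ} (hα₀ : 0 < α) (hα₂ : α < 2) {u : ℝ → ℝ}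
    {ℓ : ℝ} (τ : ℝ) (huc : Continuous u) (h : HasFracLaplacian α u 0 ℓ) :
    Integrable fun z : ℝ => (z ^ 2 + 1) ^ (-((1 + α) / 2)) * (τ - u z) := by
  have hC := fracLaplacianConst_pos hα₀ hα₂
  have hcont : Continuous fun z : ℝ => (z ^ 2 + 1) ^ (-((1 + α) / 2)) * (u z - u 0) :=
    (continuous_sq_add_one_rpow _).mul (huc.sub continuous_const)
  have hmeas : MeasurableSet {z : ℝ | 1 < |0 - z|} :=
    (isOpen_lt (by fun_prop) (by fun_prop)).measurableSet
  have h1 : IntegrableOn (fun z : ℝ => (z ^ 2 + 1) ^ (-((1 + α) / 2)) * (u z - u 0))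
      {z : ℝ | 1 < |0 - z|} := by
    refine ((h.1 1 one_pos).norm.const_mul (fracLaplacianConst α)⁻¹).mono'
      hcont.aestronglyMeasurable ((ae_restrict_iff' hmeas).2 (ae_of_all _ fun z hz => ?_))
    have hz' : 1 < |z| := by simpa using hz
    have hz0 : 0 < |z| := by linarith
    have e : |z| ^ (1 + α) = (z ^ 2) ^ ((1 + α) / 2) := by
      rw [← sq_abs, ← Real.rpow_natCast |z| 2, ← Real.rpow_mul hz0.le]
      congr 1; push_cast; ring
    have h2 : (z ^ 2 + 1) ^ (-((1 + α) / 2)) ≤ (z ^ 2) ^ (-((1 + α) / 2)) :=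
      Real.rpow_le_rpow_of_nonpos (by rw [← sq_abs]; positivity) (by linarith) (by linarith)
    rw [norm_mul, norm_mul, zero_sub, abs_neg, e,
      Real.norm_of_nonneg (Real.rpow_nonneg (by positivity) _),
      Real.norm_of_nonneg (div_nonneg hC.le (Real.rpow_nonneg (by positivity) _)),
      div_eq_mul_inv (fracLaplacianConst α), ← Real.rpow_neg (by positivity)]
    calc _ ≤ (z ^ 2) ^ (-((1 + α) / 2)) * ‖u z - u 0‖ := by gcongr
      _ = _ := by field_simp
  have h2 : IntegrableOn (fun z : ℝ => (z ^ 2 + 1) ^ (-((1 + α) / 2)) * (u z - u 0))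
      {z : ℝ | 1 < |0 - z|}ᶜ := by
    refine (hcont.continuousOn.integrableOn_compact (isCompact_Icc (a := -1) (b := 1))).mono_set ?_
    intro z hz
    simp only [zero_sub, abs_neg, Set.mem_compl_iff, Set.mem_ofPred_eq, not_lt] at hz
    exact abs_le.1 hz
  have h3 := ((integrable_sq_add_one_rpow (b := (1 + α) / 2) (by linarith)).mul_const
    (τ - u 0)).sub (integrableOn_univ.1 (Set.union_compl_self _ ▸ h1.union h2))
  refine h3.congr (ae_of_all _ fun z => ?_)
  simp only [Pi.sub_apply]
  ring

/-! ### Monotone profiles and the first derivatives of their extension. -/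

/-- `u` is nondecreasing with continuous derivative `m`, tends to `τ` at `+∞`, and its Poisson
integrals converge. -/
structure IsProfile (α τ : ℝ) (u m : ℝ → ℝ) : Prop where
  hasDerivAt : ∀ x, HasDerivAt u (m x) x
  continuous_deriv : Continuous m
  nonneg : ∀ x, 0 ≤ m x
  tendsto : Tendsto u atTop (𝓝 τ)
  integrable : Integrable fun z : ℝ => (z ^ 2 + 1) ^ (-((1 + α) / 2)) * (τ - u z)

/-- The normalizing constant of the Poisson kernel. -/
def poissonConst (α : ℝ) : ℝ :=
  Real.Gamma ((1 + α) / 2) / (√Real.pi * Real.Gamma (α / 2))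

/-- The tangential derivative of the extension, in terms of the derivative `m` of the trace. -/
def tangentialDeriv (α : ℝ) (m : ℝ → ℝ) (x t : ℝ) : ℝ :=
  poissonConst α * t ^ α * potential ((1 + α) / 2) m x t

/-- The conormal derivative `t^(1-α) ∂_t v` of the extension, in terms of the derivative `m` of
the trace. -/
def conormalDeriv (α : ℝ) (m : ℝ → ℝ) (x t : ℝ) : ℝ :=
  -poissonConst α * dipole ((1 + α) / 2) m x t

lemma poissonConst_pos {α : ℝ} (hα : 0 < α) : 0 < poissonConst α := by
  have h1 : 0 < Real.Gamma ((1 + α) / 2) := Real.Gamma_pos_of_pos (by linarith)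
  have h2 : 0 < Real.Gamma (α / 2) := Real.Gamma_pos_of_pos (by linarith)
  have := Real.pi_pos
  unfold poissonConst
  positivity

lemma poissonConst_mul_integral {α : ℝ} (hα : 0 < α) :
    poissonConst α * ∫ z : ℝ, (z ^ 2 + 1) ^ (-((1 + α) / 2)) = 1 := by
  have h1 : 0 < Real.Gamma ((1 + α) / 2) := Real.Gamma_pos_of_pos (by linarith)
  have h2 : 0 < Real.Gamma (α / 2) := Real.Gamma_pos_of_pos (by linarith)
  have := Real.pi_pos
  rw [integral_sq_add_one_rpow (by linarith), poissonConst, show (1 + α) / 2 - 1 / 2 = α / 2 by ring]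
  field_simp

lemma poissonConst_mul_integral_sq_add_sq {α : ℝ} (hα : 0 < α) (x : ℝ) {t : ℝ} (ht : 0 < t) :
    poissonConst α * t ^ α * ∫ z : ℝ, ((x - z) ^ 2 + t ^ 2) ^ (-((1 + α) / 2)) = 1 := by
  rw [integral_sq_add_sq_rpow x _ ht, show 1 - 2 * ((1 + α) / 2) = -α by ring,
    Real.rpow_neg ht.le]
  linear_combination poissonConst_mul_integral hα + poissonConst α *
    (∫ z : ℝ, (z ^ 2 + 1) ^ (-((1 + α) / 2))) *
      mul_inv_cancel₀ (Real.rpow_pos_of_pos ht α).ne'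

/-- This identity makes the principal value in the conormal derivative and the one in the fractional
Laplacian differ exactly by the factor `d_α`. -/
lemma poissonConst_eq {α : ℝ} (hα₀ : 0 < α) (hα₂ : α < 2) :
    poissonConst α = extensionConst α * fracLaplacianConst α / α := by
  have h1 : 0 < Real.Gamma ((1 + α) / 2) := Real.Gamma_pos_of_pos (by linarith)
  have h2 : 0 < Real.Gamma (α / 2) := Real.Gamma_pos_of_pos (by linarith)
  have h3 : 0 < Real.Gamma (1 - α / 2) := Real.Gamma_pos_of_pos (by linarith)
  have h4 : (2 : ℝ) ^ (1 - α) * (2 : ℝ) ^ (α - 1) = 1 := by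
    rw [← Real.rpow_add two_pos]; simp
  have h5 : Real.pi ^ (-(1 / 2) : ℝ) = (√Real.pi)⁻¹ := by
    rw [Real.rpow_neg Real.pi_pos.le, Real.sqrt_eq_rpow]
  have h6 : 0 < √Real.pi := Real.sqrt_pos.2 Real.pi_pos
  unfold poissonConst extensionConst fracLaplacianConst
  rw [h5]
  generalize Real.Gamma (1 - α / 2) = G at *
  field_simp
  rw [h4]

namespace IsProfile

variable {α τ : ℝ} {u m : ℝ → ℝ}

lemma continuous (h : IsProfile α τ u m) : Continuous u :=
  continuous_iff_continuousAt.2 fun x => (h.hasDerivAt x).continuousAt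

lemma monotone (h : IsProfile α τ u m) : Monotone u :=
  monotone_of_hasDerivAt_nonneg h.hasDerivAt h.nonneg

lemma le_lim (h : IsProfile α τ u m) (x : ℝ) : u x ≤ τ := h.monotone.ge_of_tendsto h.tendsto x

lemma integrable_deriv (h : IsProfile α τ u m) (hα : 0 < α) :
    Integrable fun s : ℝ => (s ^ 2 + 1) ^ (-(α / 2)) * m s :=
  integrable_weight_mul_deriv hα h.hasDerivAt h.continuous_deriv h.nonneg h.tendsto h.integrable

lemma integrable_poisson (h : IsProfile α τ u m) (hα : 0 < α) (x : ℝ) {t : ℝ} (ht : 0 < t) :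
    Integrable fun z : ℝ => ((x - z) ^ 2 + t ^ 2) ^ (-((1 + α) / 2)) * (τ - u z) := by
  obtain ⟨C, -, hC⟩ := exists_rpow_neg_le x ht (α := 1 + α) (e := (1 + α) / 2) (by linarith) le_rfl
  refine integrable_kernel_mul (continuous_const.sub h.continuous) h.integrable
    (continuous_sq_add_sq_rpow x _ ht) (C := C) fun s => ?_
  rw [abs_of_nonneg (by positivity)]
  exact hC x t (abs_sub_self_le_half x ht) (abs_sub_self_le_half t ht) s

lemma layer_poisson (h : IsProfile α τ u m) (hα : 0 < α) (x : ℝ) {t : ℝ} (ht : 0 < t) :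
    Integrable (fun s => tailIntegral ((1 + α) / 2) ((x - s) / t) * m s) ∧
      ∫ z, ((x - z) ^ 2 + t ^ 2) ^ (-((1 + α) / 2)) * (τ - u z)
        = t ^ (-α) * ∫ s, tailIntegral ((1 + α) / 2) ((x - s) / t) * m s := by
  have hl := layer_integral h.hasDerivAt h.continuous_deriv h.nonneg h.tendsto
    (continuous_sq_add_sq_rpow x (-((1 + α) / 2)) ht).measurable (fun z => by positivity)
    (h.integrable_poisson hα x ht)
  simp_rw [integral_Iio_sq_add_sq_rpow x _ _ ht, show 1 - 2 * ((1 + α) / 2) = -α by ring,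
    mul_assoc, integral_const_mul] at hl
  refine ⟨(integrable_const_mul_iff ?_ _).1 hl.1, hl.2⟩
  exact (Real.rpow_pos_of_pos ht _).ne'.isUnit

/-- The Poisson kernel has mass one, so `v = τ` minus the Poisson integral of `τ - u`, to which the
layer representation applies. In this form `x` and `t` enter only through the tail function at `(x -
s)/t`, so both derivatives fall on the tail and produce explicit kernels acting on `m`. -/
lemma extensionFunction_eq (h : IsProfile α τ u m) (hα : 0 < α) (x : ℝ) {t : ℝ} (ht : 0 < t) :
    extensionFunction α u x t
      = τ - poissonConst α * ∫ s, tailIntegral ((1 + α) / 2) ((x - s) / t) * m s := by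
  have ht' := (Real.rpow_pos_of_pos ht α).ne'
  have e : ∀ z, extensionKernel α (x - z) t * u z
      = poissonConst α * t ^ α * (τ * ((x - z) ^ 2 + t ^ 2) ^ (-((1 + α) / 2))
        - ((x - z) ^ 2 + t ^ 2) ^ (-((1 + α) / 2)) * (τ - u z)) := fun z => by
    rw [extensionKernel, poissonConst, Real.rpow_neg (by positivity)]
    ring
  have hi : Integrable fun z : ℝ => ((x - z) ^ 2 + t ^ 2) ^ (-((1 + α) / 2)) := by
    by_contra hcon
    have h1 := poissonConst_mul_integral_sq_add_sq hα x ht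
    rw [integral_undef hcon] at h1
    simp at h1
  rw [extensionFunction, if_pos ht]
  simp_rw [e]
  rw [integral_const_mul, integral_sub (hi.const_mul τ) (h.integrable_poisson hα x ht),
    integral_const_mul, (h.layer_poisson hα x ht).2, Real.rpow_neg ht.le, mul_sub]
  congr 1
  · linear_combination τ * poissonConst_mul_integral_sq_add_sq hα x ht
  · field_simp

lemma hasDerivAt_extensionFunction_left (h : IsProfile α τ u m) (hα : 0 < α) (x : ℝ) {t : ℝ}
    (ht : 0 < t) :
    HasDerivAt (fun x => extensionFunction α u x t) (tangentialDeriv α m x t) x := by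
  obtain ⟨C, hC, hb⟩ := exists_rpow_neg_le x ht hα.le (e := (1 + α) / 2) (by linarith)
  have hcont : Continuous (tailIntegral ((1 + α) / 2)) := continuous_iff_continuousAt.2 fun q =>
    (hasDerivAt_tailIntegral (by linarith) q).continuousAt
  have hT : ∀ y s : ℝ, HasDerivAt (fun y => tailIntegral ((1 + α) / 2) ((y - s) / t))
      (-(t ^ α * ((y - s) ^ 2 + t ^ 2) ^ (-((1 + α) / 2)))) y := fun y s => by
    have h1 := (hasDerivAt_tailIntegral (b := (1 + α) / 2) (by linarith) ((y - s) / t)).comp y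
      (((hasDerivAt_id y).sub_const s).div_const t)
    refine HasDerivAt.congr_deriv (f := fun _ => _) h1 ?_
    rw [sq_add_sq_rpow_eq_scaled _ _ ht, ← mul_assoc, ← Real.rpow_add ht,
      show α + -(2 * ((1 + α) / 2)) = -1 by ring, Real.rpow_neg_one]
    ring
  have hder := hasDerivAt_integral_kernel_mul h.continuous_deriv (h.integrable_deriv hα)
    (θ₀ := x) (C := t ^ α * C) (half_pos ht)
    (k := fun y s => tailIntegral ((1 + α) / 2) ((y - s) / t))
    (k' := fun y s => -(t ^ α * ((y - s) ^ 2 + t ^ 2) ^ (-((1 + α) / 2))))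
    (fun y _ => hcont.comp (by fun_prop))
    ((continuous_sq_add_sq_rpow x _ ht).const_mul _).neg (h.layer_poisson hα x ht).1
    (fun y hy s => by
      rw [abs_neg, abs_of_nonneg (by positivity), mul_assoc]
      have := hb y t hy (abs_sub_self_le_half t ht) s
      gcongr)
    (fun y _ s => hT y s)
  have h2 := (hder.const_mul (poissonConst α)).const_sub τ
  simp_rw [h.extensionFunction_eq hα _ ht]
  refine h2.congr_deriv ?_
  simp_rw [neg_mul, mul_assoc]
  rw [integral_neg, integral_const_mul, tangentialDeriv, potential]
  ring

lemma hasDerivAt_extensionFunction_right (h : IsProfile α τ u m) (hα : 0 < α) (x : ℝ) {t : ℝ}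
    (ht : 0 < t) :
    HasDerivAt (fun t => extensionFunction α u x t) (t ^ (α - 1) * conormalDeriv α m x t) t := by
  obtain ⟨C, hC, hb⟩ := exists_rpow_neg_le x ht hα.le (e := (1 + α) / 2 - 1 / 2) (by linarith)
  have hcont : Continuous (tailIntegral ((1 + α) / 2)) := continuous_iff_continuousAt.2 fun q =>
    (hasDerivAt_tailIntegral (by linarith) q).continuousAt
  have hT : ∀ r s : ℝ, 0 < r → HasDerivAt (fun r => tailIntegral ((1 + α) / 2) ((x - s) / r))
      (r ^ (α - 1) * ((x - s) * ((x - s) ^ 2 + r ^ 2) ^ (-((1 + α) / 2)))) r := fun r s hr => by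
    have h1 := (hasDerivAt_tailIntegral (b := (1 + α) / 2) (by linarith) ((x - s) / r)).comp r
      ((hasDerivAt_const r (x - s)).div (hasDerivAt_id r) hr.ne')
    refine HasDerivAt.congr_deriv (f := fun _ => _) h1 ?_
    rw [sq_add_sq_rpow_eq_scaled _ _ hr, mul_left_comm (x - s), ← mul_assoc, ← Real.rpow_add hr,
      show α - 1 + -(2 * ((1 + α) / 2)) = -2 by ring, Real.rpow_neg hr.le]
    norm_num
    ring
  -- The sign of `α - 1` is not known, so `r^(α - 1)` is bounded by compactness instead of
  -- monotonicity.
  obtain ⟨B, hB⟩ := (isCompact_Icc (a := t / 2) (b := 2 * t)).exists_bound_of_continuousOn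
    (f := fun r : ℝ => r ^ (α - 1))
    (fun r hr => (Real.continuousAt_rpow_const r (α - 1)
      (Or.inl (by linarith [hr.1] : 0 < r).ne')).continuousWithinAt)
  have hder := hasDerivAt_integral_kernel_mul h.continuous_deriv (h.integrable_deriv hα)
    (θ₀ := t) (C := B * C) (half_pos ht)
    (k := fun r s => tailIntegral ((1 + α) / 2) ((x - s) / r))
    (k' := fun r s => r ^ (α - 1) * ((x - s) * ((x - s) ^ 2 + r ^ 2) ^ (-((1 + α) / 2))))
    (fun r _ => hcont.comp (by fun_prop))
    (((continuous_const.sub continuous_id).mul (continuous_sq_add_sq_rpow x _ ht)).const_mul _)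
    (h.layer_poisson hα x ht).1
    (fun r hr s => by
      have hr0 := pos_of_abs_sub_le_half ht hr
      have h1 := (abs_mul_rpow_neg_le (x - s) ((1 + α) / 2) hr0).trans
        (hb x r (abs_sub_self_le_half x ht) hr s)
      have h2 := hB r ⟨by linarith [(abs_le.1 hr).1], by linarith [(abs_le.1 hr).2]⟩
      rw [Real.norm_eq_abs] at h2
      rw [abs_mul, mul_assoc]
      exact mul_le_mul h2 h1 (abs_nonneg _) ((abs_nonneg _).trans h2))
    (fun r hr s => hT r s (pos_of_abs_sub_le_half ht hr))
  have h2 := (hder.const_mul (poissonConst α)).const_sub τ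
  have h3 := h2.congr_of_eventuallyEq (f₁ := fun t => extensionFunction α u x t) (by
    filter_upwards [lt_mem_nhds ht] with r hr using h.extensionFunction_eq hα x hr)
  refine h3.congr_deriv ?_
  simp_rw [mul_assoc]
  rw [integral_const_mul, conormalDeriv, dipole]
  simp_rw [mul_assoc]
  ring

end IsProfile

/-! ### Odd kernels of size `|z|^(-α)` and their principal values. -/

/-- The function `|z|^(1-α)` cut off outside `[-ρ, ρ]`. -/
def nearWeight (α ρ z : ℝ) : ℝ := if |z| ≤ ρ then |z| ^ (1 - α) else 0

lemma integral_nearWeight {α ρ : ℝ} (hα₂ : α < 2) (hρ : 0 < ρ) :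
    ∫ z, nearWeight α ρ z = 2 * ρ ^ (2 - α) / (2 - α) := by
  have h1 := integral_comp_abs (f := fun r : ℝ => if r ≤ ρ then r ^ (1 - α) else 0)
  have h2 : ∫ r in Set.Ioi (0 : ℝ), (if r ≤ ρ then r ^ (1 - α) else 0)
      = ∫ r in (0 : ℝ)..ρ, r ^ (1 - α) := by
    rw [intervalIntegral.integral_of_le hρ.le, ← Set.Ioi_inter_Iic,
      ← setIntegral_indicator measurableSet_Iic]
    rfl
  rw [h2, integral_rpow (Or.inl (by linarith)), show 1 - α + 1 = 2 - α by ring,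
    Real.zero_rpow (by linarith)] at h1
  unfold nearWeight
  rw [h1]
  ring

lemma integrable_nearWeight {α ρ : ℝ} (hα₂ : α < 2) (hρ : 0 < ρ) :
    Integrable (nearWeight α ρ) := by
  by_contra hcon
  have h := integral_nearWeight hα₂ hρ
  rw [integral_undef hcon] at h
  have : 0 < 2 * ρ ^ (2 - α) / (2 - α) := div_pos (by positivity) (by linarith)
  linarith

lemma measurableSet_abs_sub_le (x ρ : ℝ) : MeasurableSet {s : ℝ | |x - s| ≤ ρ} :=
  (isClosed_le (by fun_prop) (by fun_prop)).measurableSet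

/-- The density `m` minus its value at `x` on the interval of radius `ρ` around `x`. -/
def centered (m : ℝ → ℝ) (ρ x s : ℝ) : ℝ := m s - if |x - s| ≤ ρ then m x else 0

section oddKernel

variable {α ρ x A : ℝ} {k m b : ℝ → ℝ}

lemma integral_odd_cutoff_eq_zero (hodd : ∀ z, k (-z) = -k z) (x ρ c : ℝ) :
    ∫ s, k (x - s) * (if |x - s| ≤ ρ then c else 0) = 0 := by
  rw [integral_sub_left_eq_self (fun z => k z * (if |z| ≤ ρ then c else 0)) volume x]
  have h := integral_neg_eq_self (fun z => k z * (if |z| ≤ ρ then c else 0)) volume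
  simp_rw [abs_neg, hodd, neg_mul, integral_neg] at h
  linarith

lemma integrable_cutoff {K : ℝ} (hk : Measurable k) (hK : ∀ z, |k z| ≤ K) (x ρ c : ℝ) :
    Integrable fun s => k (x - s) * (if |x - s| ≤ ρ then c else 0) := by
  have hfin : IntegrableOn (fun _ : ℝ => K * |c|) {s : ℝ | |x - s| ≤ ρ} := by
    have hsub : {s : ℝ | |x - s| ≤ ρ} ⊆ Set.Icc (x - ρ) (x + ρ) := fun s hs => by
      rw [Set.mem_ofPred_eq] at hs
      have := abs_le.1 hs
      exact ⟨by linarith, by linarith⟩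
    exact (integrableOn_const (by simp)).mono_set hsub
  refine ((integrable_indicator_iff (measurableSet_abs_sub_le x ρ)).2 hfin).mono'
    ((hk.comp (measurable_const.sub measurable_id)).mul (Measurable.ite
      (measurableSet_abs_sub_le x ρ) measurable_const measurable_const)).aestronglyMeasurable
    (ae_of_all _ fun s => ?_)
  by_cases hs : |x - s| ≤ ρ
  · rw [if_pos hs, Set.indicator_of_mem (by exact hs), Real.norm_eq_abs, abs_mul]
    exact mul_le_mul_of_nonneg_right (hK _) (abs_nonneg _)
  · rw [if_neg hs, Set.indicator_of_notMem (by exact hs)]; simp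

/-- Oddness allows `m(x)` to be subtracted near `x` at no cost. The remaining Lipschitz difference
improves `|z|^(-α)` to `|z|^(1-α)`, integrable at `0` because `α < 2`. -/
lemma integral_kernel_eq_centered {K : ℝ} (hk : Measurable k) (hK : ∀ z, |k z| ≤ K)
    (hodd : ∀ z, k (-z) = -k z) (hi : Integrable fun s => k (x - s) * m s) (ρ : ℝ) :
    Integrable (fun s => k (x - s) * centered m ρ x s) ∧
      ∫ s, k (x - s) * m s = ∫ s, k (x - s) * centered m ρ x s := by
  simp_rw [centered, mul_sub]
  have hc := integrable_cutoff hk hK x ρ (m x)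
  exact ⟨hi.sub hc, by rw [integral_sub hi hc, integral_odd_cutoff_eq_zero hodd, sub_zero]⟩

lemma rpow_mul_centered_le (hα₀ : 0 < α) (hL : ∀ s, |x - s| ≤ ρ → |m s - m x| ≤ A * |x - s|)
    (hb0 : ∀ s, 0 ≤ b s) (hb : ∀ s, ρ < |x - s| → |x - s| ^ (-α) * |m s| ≤ b s) (hA : 0 ≤ A)
    (s : ℝ) :
    |x - s| ^ (-α) * |centered m ρ x s| ≤ A * nearWeight α ρ (x - s) + b s := by
  unfold centered nearWeight
  by_cases hs : |x - s| ≤ ρ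
  · simp only [if_pos hs]
    -- At `s = x` the convention `0^(-α) = 0` makes the left side vanish.
    rcases eq_or_ne (x - s) 0 with h0 | h0
    · have : s = x := by linarith
      have h1 := hb0 s
      simp only [h0, abs_zero, Real.zero_rpow (neg_ne_zero.2 hα₀.ne'), zero_mul]
      positivity
    · have h1 : |x - s| ^ (1 - α) = |x - s| ^ (-α) * |x - s| := by
        rw [← Real.rpow_add_one (abs_pos.2 h0).ne']; congr 1; ring
      have h2 := hL s hs
      have h3 := hb0 s
      calc _ ≤ |x - s| ^ (-α) * (A * |x - s|) := by gcongr
        _ = A * |x - s| ^ (1 - α) := by rw [h1]; ring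
        _ ≤ _ := by linarith
  · simp only [if_neg hs, sub_zero, mul_zero, zero_add]
    exact hb s (not_le.1 hs)

lemma integrable_dominating (hα₂ : α < 2) (hρ : 0 < ρ) (hbi : Integrable b) (x A : ℝ) :
    Integrable fun s => A * nearWeight α ρ (x - s) + b s :=
  (((integrable_nearWeight hα₂ hρ).comp_sub_left x).const_mul A).add hbi

/-- The radius `ρ` stays explicit because the interpolation argument exploits the smallness of
`ρ^(2-α)` in front of the Lipschitz constant `A`. -/
lemma abs_integral_odd_kernel_le {K : ℝ} (hα₀ : 0 < α) (hα₂ : α < 2) (hρ : 0 < ρ) (hA : 0 ≤ A)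
    (hk : Measurable k) (hK : ∀ z, |k z| ≤ K) (hodd : ∀ z, k (-z) = -k z)
    (hkα : ∀ z, |k z| ≤ |z| ^ (-α)) (hi : Integrable fun s => k (x - s) * m s)
    (hL : ∀ s, |x - s| ≤ ρ → |m s - m x| ≤ A * |x - s|)
    (hb0 : ∀ s, 0 ≤ b s) (hb : ∀ s, ρ < |x - s| → |x - s| ^ (-α) * |m s| ≤ b s)
    (hbi : Integrable b) :
    |∫ s, k (x - s) * m s| ≤ A * (2 * ρ ^ (2 - α) / (2 - α)) + ∫ s, b s := by
  rw [(integral_kernel_eq_centered hk hK hodd hi ρ).2, ← Real.norm_eq_abs]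
  refine (norm_integral_le_of_norm_le (integrable_dominating hα₂ hρ hbi x A)
    (ae_of_all _ fun s => ?_)).trans_eq ?_
  · rw [norm_mul, Real.norm_eq_abs, Real.norm_eq_abs]
    exact (mul_le_mul_of_nonneg_right (hkα _) (abs_nonneg _)).trans
      (rpow_mul_centered_le hα₀ hL hb0 hb hA s)
  · rw [integral_add (((integrable_nearWeight hα₂ hρ).comp_sub_left x).const_mul A) hbi,
      integral_const_mul, integral_sub_left_eq_self (nearWeight α ρ) volume x,
      integral_nearWeight hα₂ hρ]

/-- The principal value of `∫ sign(x - s) |x - s|^(-α) m(s) ds`. -/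
def principalValue (α ρ : ℝ) (m : ℝ → ℝ) (x : ℝ) : ℝ :=
  ∫ s, (SignType.sign (x - s) : ℝ) * |x - s| ^ (-α) * centered m ρ x s

/-- Dominated convergence for the centered density. The limit does not depend on the regularizing
family, so two different families can be compared through it. -/
lemma tendsto_integral_odd_kernel {k : ℝ → ℝ → ℝ} {K : ℝ → ℝ} (hα₀ : 0 < α) (hα₂ : α < 2)
    (hρ : 0 < ρ) (hA : 0 ≤ A)
    (hk : ∀ t, 0 < t → Measurable (k t)) (hK : ∀ t, 0 < t → ∀ z, |k t z| ≤ K t)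
    (hodd : ∀ t, 0 < t → ∀ z, k t (-z) = -k t z)
    (hkα : ∀ t, 0 < t → ∀ z, |k t z| ≤ |z| ^ (-α))
    (hi : ∀ t, 0 < t → Integrable fun s => k t (x - s) * m s)
    (hlim : ∀ z, z ≠ 0 →
      Tendsto (fun t => k t z) (𝓝[>] 0) (𝓝 ((SignType.sign z : ℝ) * |z| ^ (-α))))
    (hL : ∀ s, |x - s| ≤ ρ → |m s - m x| ≤ A * |x - s|)
    (hb0 : ∀ s, 0 ≤ b s) (hb : ∀ s, ρ < |x - s| → |x - s| ^ (-α) * |m s| ≤ b s)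
    (hbi : Integrable b) :
    Tendsto (fun t => ∫ s, k t (x - s) * m s) (𝓝[>] 0) (𝓝 (principalValue α ρ m x)) := by
  have hpos : ∀ᶠ t : ℝ in 𝓝[>] 0, 0 < t := self_mem_nhdsWithin
  refine Tendsto.congr' (f₁ := fun t => ∫ s, k t (x - s) * centered m ρ x s) ?_ ?_
  · filter_upwards [hpos] with t ht
    exact (integral_kernel_eq_centered (hk t ht) (hK t ht) (hodd t ht) (hi t ht) ρ).2.symm
  · refine tendsto_integral_filter_of_dominated_convergence
      (fun s => A * nearWeight α ρ (x - s) + b s) ?_ ?_ (integrable_dominating hα₂ hρ hbi x A) ?_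
    · filter_upwards [hpos] with t ht
      exact (integral_kernel_eq_centered (hk t ht) (hK t ht) (hodd t ht) (hi t ht)
        ρ).1.aestronglyMeasurable
    · filter_upwards [hpos] with t ht
      refine ae_of_all _ fun s => ?_
      rw [norm_mul, Real.norm_eq_abs, Real.norm_eq_abs]
      exact (mul_le_mul_of_nonneg_right (hkα t ht _) (abs_nonneg _)).trans
        (rpow_mul_centered_le hα₀ hL hb0 hb hA s)
    · have hne : ∀ᵐ s : ℝ, s ≠ x := by
        simp [ae_iff, measure_singleton]
      filter_upwards [hne] with s hs
      exact (hlim _ (sub_ne_zero.2 hs.symm)).mul_const _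

end oddKernel

/-! ### The two regularized kernels, Poisson and truncated. -/

section kernels

variable {α : ℝ}

/-- The odd kernel `z (z² + t²)^(-(1+α)/2)` of the conormal derivative. -/
def conormalKernel (α t z : ℝ) : ℝ := z * (z ^ 2 + t ^ 2) ^ (-((1 + α) / 2))

/-- The odd kernel `sign(z) max(|z|, t)^(-α)` of the truncated fractional Laplacian. -/
def truncatedKernel (α t z : ℝ) : ℝ := (SignType.sign z : ℝ) * max |z| t ^ (-α)

lemma conormalKernel_neg (t z : ℝ) : conormalKernel α t (-z) = -conormalKernel α t z := by
  simp [conormalKernel]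

lemma truncatedKernel_neg (t z : ℝ) : truncatedKernel α t (-z) = -truncatedKernel α t z := by
  simp [truncatedKernel, Left.sign_neg]

lemma sq_rpow_neg_half (z α : ℝ) : (z ^ 2) ^ (-(α / 2)) = |z| ^ (-α) := by
  rw [← sq_abs, ← Real.rpow_natCast |z| 2, ← Real.rpow_mul (abs_nonneg z)]
  congr 1; push_cast; ring

lemma abs_conormalKernel_le {t : ℝ} (ht : 0 < t) (hα : 0 < α) (z : ℝ) :
    |conormalKernel α t z| ≤ |z| ^ (-α) := by
  rcases eq_or_ne z 0 with rfl | hz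
  · simp [conormalKernel, Real.zero_rpow (neg_ne_zero.2 hα.ne')]
  · refine (abs_mul_rpow_neg_le z _ ht).trans ?_
    rw [show -((1 + α) / 2 - 1 / 2) = -(α / 2) by ring, ← sq_rpow_neg_half]
    exact Real.rpow_le_rpow_of_nonpos (by positivity) (by nlinarith [sq_nonneg t]) (by linarith)

lemma abs_conormalKernel_le_const {t : ℝ} (ht : 0 < t) (hα : 0 < α) (z : ℝ) :
    |conormalKernel α t z| ≤ t ^ (-α) := by
  refine (abs_mul_rpow_neg_le z _ ht).trans ?_
  rw [show -((1 + α) / 2 - 1 / 2) = -(α / 2) by ring]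
  nth_rw 2 [← abs_of_pos ht]
  rw [← sq_rpow_neg_half]
  exact Real.rpow_le_rpow_of_nonpos (by positivity) (by nlinarith [sq_nonneg z]) (by linarith)

lemma abs_sign_le_one (z : ℝ) : |(SignType.sign z : ℝ)| ≤ 1 := by
  rcases lt_trichotomy z 0 with h | rfl | h
  · simp [sign_neg h]
  · simp
  · simp [sign_pos h]

lemma abs_truncatedKernel_le_max {t : ℝ} (ht : 0 < t) (z : ℝ) :
    |truncatedKernel α t z| ≤ max |z| t ^ (-α) := by
  have h : 0 ≤ max |z| t ^ (-α) := Real.rpow_nonneg (ht.le.trans (le_max_right _ _)) _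
  rw [truncatedKernel, abs_mul, abs_of_nonneg h]
  exact mul_le_of_le_one_left h (abs_sign_le_one z)

lemma abs_truncatedKernel_le {t : ℝ} (ht : 0 < t) (hα : 0 < α) (z : ℝ) :
    |truncatedKernel α t z| ≤ |z| ^ (-α) := by
  rcases eq_or_ne z 0 with rfl | hz
  · simp [truncatedKernel, Real.zero_rpow (neg_ne_zero.2 hα.ne')]
  · exact (abs_truncatedKernel_le_max ht z).trans
      (Real.rpow_le_rpow_of_nonpos (abs_pos.2 hz) (le_max_left _ _) (by linarith))

lemma abs_truncatedKernel_le_const {t : ℝ} (ht : 0 < t) (hα : 0 < α) (z : ℝ) :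
    |truncatedKernel α t z| ≤ t ^ (-α) :=
  (abs_truncatedKernel_le_max ht z).trans
    (Real.rpow_le_rpow_of_nonpos ht (le_max_right _ _) (by linarith))

lemma measurable_conormalKernel (α t : ℝ) : Measurable (conormalKernel α t) := by
  unfold conormalKernel; fun_prop

lemma measurable_truncatedKernel (α t : ℝ) : Measurable (truncatedKernel α t) := by
  unfold truncatedKernel
  have h : Measurable fun z : ℝ => ((SignType.sign z : SignType) : ℝ) := by
    have : (fun z : ℝ => ((SignType.sign z : SignType) : ℝ))
        = fun z => if 0 < z then 1 else if z < 0 then -1 else 0 := by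
      funext z
      simp only [sign_apply]
      split_ifs <;> simp
    rw [this]
    exact Measurable.ite measurableSet_Ioi measurable_const
      (Measurable.ite measurableSet_Iio measurable_const measurable_const)
  exact h.mul (by fun_prop)

lemma tendsto_conormalKernel {z : ℝ} (hz : z ≠ 0) :
    Tendsto (fun t => conormalKernel α t z) (𝓝[>] 0)
      (𝓝 ((SignType.sign z : ℝ) * |z| ^ (-α))) := by
  have hc : ContinuousAt (fun t => conormalKernel α t z) 0 := by
    unfold conormalKernel
    exact continuousAt_const.mul (ContinuousAt.rpow_const (by fun_prop)
      (Or.inl (by positivity)))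
  have h0 : conormalKernel α 0 z = (SignType.sign z : ℝ) * |z| ^ (-α) := by
    have hz' := abs_pos.2 hz
    rw [conormalKernel, show z ^ 2 + 0 ^ 2 = z ^ 2 by ring,
      sq_rpow_neg_half,
      show -(1 + α) = -α - 1 by ring, Real.rpow_sub_one hz'.ne']
    nth_rw 1 [← sign_mul_abs z]
    field_simp
  rw [← h0]
  exact hc.tendsto.mono_left nhdsWithin_le_nhds

lemma tendsto_truncatedKernel {z : ℝ} (hz : z ≠ 0) :
    Tendsto (fun t => truncatedKernel α t z) (𝓝[>] 0)
      (𝓝 ((SignType.sign z : ℝ) * |z| ^ (-α))) := by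
  have hz' := abs_pos.2 hz
  refine tendsto_const_nhds.congr' ?_
  filter_upwards [Ioo_mem_nhdsGT hz'] with t ht
  rw [truncatedKernel, max_eq_left ht.2.le]

lemma integrable_truncatedKernel_mul {m : ℝ → ℝ} (hα : 0 < α) (hmc : Continuous m)
    (hm : Integrable fun s : ℝ => (s ^ 2 + 1) ^ (-(α / 2)) * m s) (x : ℝ) {t : ℝ} (ht : 0 < t) :
    Integrable fun s => truncatedKernel α t (x - s) * m s := by
  refine ((integrable_potential hα.le hmc hm le_rfl x ht).norm.const_mul
    ((2 : ℝ) ^ (α / 2))).mono' (((measurable_truncatedKernel α t).comp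
      (measurable_const.sub measurable_id)).mul hmc.measurable).aestronglyMeasurable
    (ae_of_all _ fun s => ?_)
  have h0 : 0 < max |x - s| t := ht.trans_le (le_max_right _ _)
  have h1 : (x - s) ^ 2 + t ^ 2 ≤ 2 * max |x - s| t ^ 2 := by
    have h2 : (x - s) ^ 2 ≤ max |x - s| t ^ 2 := by
      rw [← sq_abs]; gcongr; exact le_max_left _ _
    have h3 : t ^ 2 ≤ max |x - s| t ^ 2 := by gcongr; exact le_max_right _ _
    linarith
  have h2 : max |x - s| t ^ (-α) ≤ (2 : ℝ) ^ (α / 2) * ((x - s) ^ 2 + t ^ 2) ^ (-(α / 2)) := by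
    have h3 := Real.rpow_le_rpow_of_nonpos (sq_add_sq_pos (x - s) ht) h1
      (show -(α / 2) ≤ 0 by linarith)
    rw [Real.mul_rpow (by norm_num) (by positivity), sq_rpow_neg_half, abs_of_pos h0,
      Real.rpow_neg (by norm_num), inv_mul_le_iff₀ (by positivity)] at h3
    exact h3
  have h3 : (0 : ℝ) ≤ ((x - s) ^ 2 + t ^ 2) ^ (-(α / 2)) := by positivity
  rw [norm_mul, norm_mul, Real.norm_of_nonneg h3, ← mul_assoc]
  exact mul_le_mul_of_nonneg_right ((abs_truncatedKernel_le_max ht _).trans h2) (norm_nonneg _)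

/-- The function `|z|^(-1-α)` truncated on `[-ε, ε]`. -/
def farWeight (α ε z : ℝ) : ℝ := if ε < |z| then |z| ^ (-(1 + α)) else 0

lemma integral_Ioi_farWeight_of_pos (hα : 0 < α) {ε q : ℝ} (hε : 0 < ε) (hq : 0 ≤ q) :
    ∫ z in Set.Ioi q, farWeight α ε z = max q ε ^ (-α) / α := by
  have h1 : ∫ z in Set.Ioi q, farWeight α ε z = ∫ z in Set.Ioi (max q ε), z ^ (-(1 + α)) := by
    rw [← integral_indicator measurableSet_Ioi, ← integral_indicator measurableSet_Ioi]
    congr 1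
    funext z
    simp only [Set.indicator_apply, Set.mem_Ioi, farWeight, max_lt_iff]
    by_cases hz : q < z
    · rw [abs_of_pos (hq.trans_lt hz)]; simp [hz]
    · simp [hz]
  rw [h1, integral_Ioi_rpow_of_lt (by linarith) (hε.trans_le (le_max_right _ _)),
    show -(1 + α) + 1 = -α by ring, div_neg, neg_div, neg_neg]

lemma integral_farWeight (hα : 0 < α) {ε : ℝ} (hε : 0 < ε) :
    ∫ z, farWeight α ε z = 2 * ε ^ (-α) / α := by
  have h := integral_comp_abs (f := farWeight α ε)
  rw [integral_Ioi_farWeight_of_pos hα hε le_rfl, max_eq_right hε.le] at h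
  simp_rw [farWeight, abs_abs] at h ⊢
  rw [h]; ring

lemma integrable_farWeight (hα : 0 < α) {ε : ℝ} (hε : 0 < ε) : Integrable (farWeight α ε) := by
  by_contra hcon
  have h := integral_farWeight hα hε
  rw [integral_undef hcon] at h
  have : 0 < 2 * ε ^ (-α) / α := by positivity
  linarith

lemma farWeight_nonneg (α ε z : ℝ) : 0 ≤ farWeight α ε z := by
  unfold farWeight; split_ifs <;> positivity

lemma measurable_farWeight (α ε : ℝ) : Measurable (farWeight α ε) :=
  Measurable.ite (isOpen_lt continuous_const continuous_abs).measurableSet (by fun_prop)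
    measurable_const

lemma integral_Ioi_farWeight_of_neg (hα : 0 < α) {ε q : ℝ} (hε : 0 < ε) (hq : q < 0) :
    ∫ z in Set.Ioi q, farWeight α ε z = 2 * ε ^ (-α) / α - max (-q) ε ^ (-α) / α := by
  have hi := integrable_farWeight hα hε
  rw [← integral_farWeight hα hε, ← integral_Ioi_farWeight_of_pos hα hε (neg_pos.2 hq).le,
    ← integral_comp_neg_Iic q]
  simp_rw [show ∀ z, farWeight α ε (-z) = farWeight α ε z from fun z => by simp [farWeight]]
  rw [← integral_add_compl (measurableSet_Iic (a := q)) hi, Set.compl_Iic]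
  ring

/-- For `s < x` the half-line is a single tail of the weight; for `s > x` it is the whole mass minus
the opposite tail. The result is the odd truncated kernel plus a constant on `s > x`. -/
lemma integral_Iio_farWeight (hα : 0 < α) {ε x s : ℝ} (hε : 0 < ε) (hs : s ≠ x) :
    ∫ z in Set.Iio s, farWeight α ε (x - z)
      = (truncatedKernel α ε (x - s) + (Set.Ioi x).indicator (fun _ => 2 * ε ^ (-α)) s) / α := by
  have h1 : ∫ z in Set.Iio s, farWeight α ε (x - z) = ∫ z in Set.Ioi (x - s), farWeight α ε z := by
    rw [← integral_indicator measurableSet_Iio, ← integral_indicator measurableSet_Ioi,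
      ← integral_sub_left_eq_self _ volume x]
    congr 1
    funext z
    simp [Set.indicator_apply, sub_lt_comm]
  rw [h1]
  rcases lt_or_gt_of_ne hs with h | h
  · rw [integral_Ioi_farWeight_of_pos hα hε (by linarith),
      Set.indicator_of_notMem (Set.notMem_Ioi.2 h.le), truncatedKernel,
      sign_pos (sub_pos.2 h), abs_of_pos (sub_pos.2 h)]
    simp
  · rw [integral_Ioi_farWeight_of_neg hα hε (by linarith),
      Set.indicator_of_mem (Set.mem_Ioi.2 h), truncatedKernel,
      sign_neg (sub_neg.2 h), abs_of_neg (sub_neg.2 h)]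
    simp
    ring

end kernels

/-! ### The Neumann relation and bounds for the conormal derivative. -/

/-- Split `u(z) - u(x)` as `(τ - u(x)) - (τ - u(z))` and apply the layer representation to the
second term. The constant that it produces on `s > x` integrates to `τ - u(x)` times the total mass
of the weight and cancels the first term. -/
lemma IsProfile.truncated_fracLaplacian_eq {α τ : ℝ} {u m : ℝ → ℝ} (h : IsProfile α τ u m)
    (hα : 0 < α) (hC : fracLaplacianConst α ≠ 0) {x ε : ℝ} (hε : 0 < ε)
    (hi : IntegrableOn (fun z => (u z - u x) * (fracLaplacianConst α / |x - z| ^ (1 + α)))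
      {z : ℝ | ε < |x - z|}) :
    ∫ z in {z : ℝ | ε < |x - z|}, (u z - u x) * (fracLaplacianConst α / |x - z| ^ (1 + α))
      = -(fracLaplacianConst α / α) * ∫ s, truncatedKernel α ε (x - s) * m s := by
  set C := fracLaplacianConst α
  have hmeas : MeasurableSet {z : ℝ | ε < |x - z|} :=
    (isOpen_lt (by fun_prop) (by fun_prop)).measurableSet
  have e1 : ({z : ℝ | ε < |x - z|}.indicator fun z => (u z - u x) * (C / |x - z| ^ (1 + α)))
      = fun z => C * (farWeight α ε (x - z) * (u z - u x)) := by
    funext z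
    by_cases hz : ε < |x - z|
    · rw [Set.indicator_of_mem (by exact hz), farWeight, if_pos hz,
        Real.rpow_neg (abs_nonneg _)]
      ring
    · rw [Set.indicator_of_notMem (by exact hz), farWeight, if_neg hz]
      ring
  rw [← integrable_indicator_iff hmeas, e1] at hi
  have hi' : Integrable fun z => farWeight α ε (x - z) * (u z - u x) :=
    (integrable_const_mul_iff hC.isUnit _).1 hi
  have hw : Integrable fun z => farWeight α ε (x - z) := (integrable_farWeight hα hε).comp_sub_left x
  have hl := layer_integral h.hasDerivAt h.continuous_deriv h.nonneg h.tendsto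
    (k := fun z => farWeight α ε (x - z))
    ((measurable_farWeight α ε).comp (measurable_const.sub measurable_id))
    (fun z => farWeight_nonneg _ _ _) (by
      refine ((hw.mul_const (τ - u x)).sub hi').congr (ae_of_all _ fun z => ?_)
      simp only [Pi.sub_apply]; ring)
  have hne : ∀ᵐ s : ℝ, s ≠ x := by simp [ae_iff, measure_singleton]
  have e2 : ∫ s, (∫ z in Set.Iio s, farWeight α ε (x - z)) * m s
      = (1 / α) * (∫ s, truncatedKernel α ε (x - s) * m s) + (2 * ε ^ (-α) / α) * (τ - u x) := by
    rw [← integral_Ioi_eq_sub h.hasDerivAt h.nonneg h.tendsto x, ← integral_const_mul,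
      ← integral_const_mul, ← integral_indicator measurableSet_Ioi, ← integral_add]
    · refine integral_congr_ae ?_
      filter_upwards [hne] with s hs
      rw [integral_Iio_farWeight hα hε hs]
      by_cases hx : s ∈ Set.Ioi x
      · simp only [Set.indicator_of_mem hx]; ring
      · simp only [Set.indicator_of_notMem hx]; ring
    · exact (integrable_truncatedKernel_mul hα h.continuous_deriv (h.integrable_deriv hα) x
        hε).const_mul _
    · rw [integrable_indicator_iff measurableSet_Ioi]
      exact (integrableOn_Ioi_of_hasDerivAt h.hasDerivAt h.nonneg h.tendsto x).const_mul _
  rw [← integral_indicator hmeas, e1, integral_const_mul]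
  have e3 : ∀ z, farWeight α ε (x - z) * (u z - u x)
      = farWeight α ε (x - z) * (τ - u x) - farWeight α ε (x - z) * (τ - u z) := fun z => by ring
  have hi'' : Integrable fun z => farWeight α ε (x - z) * (τ - u z) := by
      refine ((hw.mul_const (τ - u x)).sub hi').congr (ae_of_all _ fun z => ?_)
      simp only [Pi.sub_apply]; ring
  simp_rw [e3]
  rw [integral_sub (hw.mul_const _) hi'', hl.2, e2, integral_mul_const,
    integral_sub_left_eq_self (farWeight α ε) volume x, integral_farWeight hα hε]
  ring

lemma rpow_neg_le_of_sq_le {K z s e : ℝ} (hK : 0 < K) (he : 0 ≤ e)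
    (h : s ^ 2 + 1 ≤ K * z ^ 2) : |z| ^ (-e) ≤ K ^ (e / 2) * (s ^ 2 + 1) ^ (-(e / 2)) := by
  have h3 := Real.rpow_le_rpow_of_nonpos (by positivity) h (show -(e / 2) ≤ 0 by linarith)
  rw [Real.mul_rpow hK.le (by positivity), sq_rpow_neg_half, Real.rpow_neg hK.le,
    inv_mul_le_iff₀ (by positivity)] at h3
  exact h3

lemma exists_far_bound (X : ℝ) {ρ e : ℝ} (hρ : 0 < ρ) (he : 0 ≤ e) :
    ∃ K ≥ 0, ∀ x, |x| ≤ X → ∀ s, ρ < |x - s| →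
      |x - s| ^ (-e) ≤ K * (s ^ 2 + 1) ^ (-(e / 2)) := by
  set K := 2 + (2 * X ^ 2 + 1) / ρ ^ 2
  have hK : 0 < K := by positivity
  refine ⟨K ^ (e / 2), by positivity, fun x hx s hs => rpow_neg_le_of_sq_le hK he ?_⟩
  have h1 : ρ ^ 2 ≤ (x - s) ^ 2 := by rw [← sq_abs (x - s)]; gcongr
  have h2 : x ^ 2 ≤ X ^ 2 := sq_le_sq' (by linarith [(abs_le.1 hx).1]) (abs_le.1 hx).2
  have h3 : 2 * X ^ 2 + 1 ≤ (2 * X ^ 2 + 1) / ρ ^ 2 * (x - s) ^ 2 := by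
    rw [div_mul_eq_mul_div, le_div_iff₀ (by positivity)]
    gcongr
  simp only [K]
  nlinarith [sq_nonneg (2 * x - s)]

lemma abs_sub_le_of_deriv_bound {m m' : ℝ → ℝ} (hd : ∀ x, HasDerivAt m (m' x) x) {x ρ A : ℝ}
    (hA : ∀ z, |z - x| ≤ ρ → |m' z| ≤ A) (s : ℝ) (hs : |x - s| ≤ ρ) :
    |m s - m x| ≤ A * |x - s| := by
  rw [abs_sub_comm x s] at hs ⊢
  have hsub : ∀ z ∈ Set.uIcc x s, |z - x| ≤ ρ := fun z hz =>
    (Set.abs_sub_left_of_mem_uIcc hz).trans hs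
  exact (convex_uIcc x s).norm_image_sub_le_of_norm_hasDerivWithin_le
    (fun z _ => (hd z).hasDerivWithinAt) (fun z hz => hA z (hsub z hz)) Set.left_mem_uIcc
    Set.right_mem_uIcc

namespace IsProfile

variable {α τ : ℝ} {u m m' : ℝ → ℝ}

lemma integrable_conormalKernel_mul (h : IsProfile α τ u m) (hα : 0 < α) (x : ℝ) {t : ℝ}
    (ht : 0 < t) : Integrable fun s => conormalKernel α t (x - s) * m s :=
  integrable_dipole hα.le h.continuous_deriv (h.integrable_deriv hα) le_rfl x ht

lemma conormalDeriv_eq (x t : ℝ) : conormalDeriv α m x t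
    = -poissonConst α * ∫ s, conormalKernel α t (x - s) * m s := rfl

/-- The conormal kernel and the truncated kernel converge to the same principal value. Uniqueness of
the limit identifies it with a multiple of `ℓ`, and `poissonConst_eq` turns the factor into `d_α`.
-/
lemma tendsto_conormalDeriv (h : IsProfile α τ u m) (hα₀ : 0 < α) (hα₂ : α < 2)
    (hd : ∀ x, HasDerivAt m (m' x) x) (hm' : Continuous m') {x ℓ : ℝ}
    (hℓ : HasFracLaplacian α u x ℓ) :
    Tendsto (fun t => conormalDeriv α m x t) (𝓝[>] 0) (𝓝 (extensionConst α * ℓ)) := by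
  obtain ⟨A, hA⟩ := (isCompact_Icc (a := x - 1) (b := x + 1)).exists_bound_of_continuousOn
    hm'.continuousOn
  have hA' : ∀ z, |z - x| ≤ 1 → |m' z| ≤ A := fun z hz =>
    hA z ⟨by linarith [(abs_le.1 hz).1], by linarith [(abs_le.1 hz).2]⟩
  have hA0 : 0 ≤ A := (abs_nonneg _).trans (hA' x (by simp))
  obtain ⟨K, hK0, hK⟩ := exists_far_bound |x| one_pos hα₀.le
  have hbi := (h.integrable_deriv hα₀).const_mul K
  have hb0 : ∀ s, 0 ≤ K * ((s ^ 2 + 1) ^ (-(α / 2)) * m s) := fun s =>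
    mul_nonneg hK0 (mul_nonneg (by positivity) (h.nonneg s))
  have hb : ∀ s, 1 < |x - s| → |x - s| ^ (-α) * |m s| ≤ K * ((s ^ 2 + 1) ^ (-(α / 2)) * m s) :=
    fun s hs => by
      rw [abs_of_nonneg (h.nonneg s), ← mul_assoc]
      exact mul_le_mul_of_nonneg_right (hK x le_rfl s hs) (h.nonneg s)
  have hL := abs_sub_le_of_deriv_bound hd hA'
  have h1 := tendsto_integral_odd_kernel (K := fun t => t ^ (-α)) hα₀ hα₂ one_pos hA0
    (fun t _ => measurable_conormalKernel α t)
    (fun t ht => abs_conormalKernel_le_const ht hα₀) (fun t _ => conormalKernel_neg t)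
    (fun t ht => abs_conormalKernel_le ht hα₀)
    (fun t ht => h.integrable_conormalKernel_mul hα₀ x ht)
    (fun z hz => tendsto_conormalKernel hz) hL hb0 hb hbi
  have h2 := tendsto_integral_odd_kernel (K := fun t => t ^ (-α)) hα₀ hα₂ one_pos hA0
    (fun t _ => measurable_truncatedKernel α t)
    (fun t ht => abs_truncatedKernel_le_const ht hα₀) (fun t _ => truncatedKernel_neg t)
    (fun t ht => abs_truncatedKernel_le ht hα₀)
    (fun t ht => integrable_truncatedKernel_mul hα₀ h.continuous_deriv (h.integrable_deriv hα₀)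
      x ht)
    (fun z hz => tendsto_truncatedKernel hz) hL hb0 hb hbi
  have hC := fracLaplacianConst_pos hα₀ hα₂
  have h3 : ℓ = -(fracLaplacianConst α / α) * principalValue α 1 m x := by
    refine tendsto_nhds_unique hℓ.2 ((h2.const_mul _).congr' ?_)
    filter_upwards [self_mem_nhdsWithin] with ε hε
    exact (h.truncated_fracLaplacian_eq hα₀ hC.ne' hε (hℓ.1 ε hε)).symm
  have h4 := h1.const_mul (-poissonConst α)
  rwa [show -poissonConst α * principalValue α 1 m x = extensionConst α * ℓ by
    rw [h3, poissonConst_eq hα₀ hα₂]; ring] at h4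

lemma exists_conormalDeriv_bound (h : IsProfile α τ u m) (hα₀ : 0 < α) (hα₂ : α < 2)
    (hd : ∀ x, HasDerivAt m (m' x) x) (hm' : Continuous m') (X : ℝ) :
    ∃ B, ∀ x, |x| ≤ X → ∀ t, 0 < t → |conormalDeriv α m x t| ≤ B := by
  obtain ⟨A, hA⟩ := (isCompact_Icc (a := -(X + 1)) (b := X + 1)).exists_bound_of_continuousOn
    hm'.continuousOn
  obtain ⟨K, hK0, hK⟩ := exists_far_bound X one_pos hα₀.le
  have hbi := (h.integrable_deriv hα₀).const_mul K
  have hp := poissonConst_pos hα₀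
  refine ⟨poissonConst α * (|A| * (2 * 1 ^ (2 - α) / (2 - α)) +
    ∫ s, K * ((s ^ 2 + 1) ^ (-(α / 2)) * m s)), fun x hx t ht => ?_⟩
  rw [conormalDeriv_eq, abs_mul, abs_neg, abs_of_pos hp]
  refine mul_le_mul_of_nonneg_left ?_ hp.le
  refine abs_integral_odd_kernel_le hα₀ hα₂ one_pos (abs_nonneg A)
    (measurable_conormalKernel α t) (abs_conormalKernel_le_const ht hα₀) (conormalKernel_neg t)
    (abs_conormalKernel_le ht hα₀) (h.integrable_conormalKernel_mul hα₀ x ht)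
    (abs_sub_le_of_deriv_bound hd fun z hz => ?_)
    (fun s => mul_nonneg hK0 (mul_nonneg (by positivity) (h.nonneg s))) (fun s hs => ?_) hbi
  · refine (hA z ?_).trans (le_abs_self A)
    exact abs_le.1 (by linarith [abs_sub_abs_le_abs_sub z x])
  · rw [abs_of_nonneg (h.nonneg s), ← mul_assoc]
    exact mul_le_mul_of_nonneg_right (hK x hx s hs) (h.nonneg s)

/-- The constant `K` depends neither on `x ≥ 1` nor on `ρ`. Far sources with `s > 0` see a kernel at
most `ρ^(-α)` and have finite total mass because `u` converges at `+∞`; for `s ≤ 0`, `x ≥ 1` gives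
`(x - s)² ≥ s² + 1`, so the weighted integral applies. -/
lemma exists_conormalDeriv_bound_right (h : IsProfile α τ u m) (hα₀ : 0 < α) (hα₂ : α < 2)
    (hd : ∀ x, HasDerivAt m (m' x) x) :
    ∃ K, ∀ x, 1 ≤ x → ∀ ρ, 0 < ρ → ρ ≤ 1 → ∀ A, 0 ≤ A → (∀ z, |z - x| ≤ ρ → |m' z| ≤ A) →
      ∀ t, 0 < t → |conormalDeriv α m x t| ≤
        poissonConst α * (A * (2 * ρ ^ (2 - α) / (2 - α)) + K * ρ ^ (-α)) := by
  have hI1 := (integrable_indicator_iff measurableSet_Ioi).2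
    (integrableOn_Ioi_of_hasDerivAt h.hasDerivAt h.nonneg h.tendsto 0)
  have hI2 := h.integrable_deriv hα₀
  have hp := poissonConst_pos hα₀
  refine ⟨∫ s, ((Set.Ioi 0).indicator m s + (s ^ 2 + 1) ^ (-(α / 2)) * m s),
    fun x hx ρ hρ hρ1 A hA0 hA t ht => ?_⟩
  rw [conormalDeriv_eq, abs_mul, abs_neg, abs_of_pos hp]
  refine mul_le_mul_of_nonneg_left ?_ hp.le
  have hbi := (hI1.add hI2).mul_const (ρ ^ (-α))
  have hi0 : ∀ s, 0 ≤ (Set.Ioi 0).indicator m s := fun s =>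
    Set.indicator_nonneg (fun s _ => h.nonneg s) s
  have hw0 : ∀ s : ℝ, 0 ≤ (s ^ 2 + 1) ^ (-(α / 2)) * m s := fun s =>
    mul_nonneg (by positivity) (h.nonneg s)
  rw [← integral_mul_const]
  refine abs_integral_odd_kernel_le hα₀ hα₂ hρ hA0
    (measurable_conormalKernel α t) (abs_conormalKernel_le_const ht hα₀) (conormalKernel_neg t)
    (abs_conormalKernel_le ht hα₀) (h.integrable_conormalKernel_mul hα₀ x ht)
    (abs_sub_le_of_deriv_bound hd hA) (fun s => ?_) (fun s hs => ?_) hbi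
  · exact mul_nonneg (add_nonneg (hi0 s) (hw0 s)) (by positivity)
  · rw [abs_of_nonneg (h.nonneg s)]
    have hρ' : 1 ≤ ρ ^ (-α) := Real.one_le_rpow_of_pos_of_le_one_of_nonpos hρ hρ1 (by linarith)
    by_cases hs0 : 0 < s
    · rw [Set.indicator_of_mem (Set.mem_Ioi.2 hs0)]
      have h1 : |x - s| ^ (-α) ≤ ρ ^ (-α) :=
        Real.rpow_le_rpow_of_nonpos hρ hs.le (by linarith)
      have h2 : 0 ≤ (s ^ 2 + 1) ^ (-(α / 2)) * m s * ρ ^ (-α) :=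
        mul_nonneg (hw0 s) (by positivity)
      nlinarith [mul_le_mul_of_nonneg_right h1 (h.nonneg s)]
    · have h1 := rpow_neg_le_of_sq_le (z := x - s) (s := s) one_pos hα₀.le (by nlinarith)
      rw [Real.one_rpow, one_mul] at h1
      have h2 := mul_le_mul_of_nonneg_right h1 (h.nonneg s)
      have h3 := hi0 s
      nlinarith [hw0 s]

end IsProfile

/-! ### The tangential derivative: bounds, trace, decay at infinity. -/

lemma tangentialDeriv_nonneg {α : ℝ} {m : ℝ → ℝ} (hα : 0 < α) (hm : ∀ s, 0 ≤ m s) (x : ℝ) {t : ℝ}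
    (ht : 0 < t) : 0 ≤ tangentialDeriv α m x t := by
  have := poissonConst_pos hα
  refine mul_nonneg (by positivity) (integral_nonneg fun s => mul_nonneg ?_ (hm s))
  positivity

/-- Near sources contribute at most `A` because the Poisson kernel has mass one; far sources carry
the factor `t^α`, which is small near the boundary and bounded on strips. -/
lemma tangentialDeriv_le {α : ℝ} (hα : 0 < α) {g b : ℝ → ℝ} {x t ρ A : ℝ} (ht : 0 < t)
    (hρ : 0 < ρ) (hA : 0 ≤ A) (hg : ∀ s, 0 ≤ g s)
    (hi : Integrable fun s => ((x - s) ^ 2 + t ^ 2) ^ (-((1 + α) / 2)) * g s)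
    (hnear : ∀ s, |x - s| ≤ ρ → g s ≤ A) (hb0 : ∀ s, 0 ≤ b s)
    (hb : ∀ s, ρ < |x - s| → |x - s| ^ (-(1 + α)) * g s ≤ b s) (hbi : Integrable b) :
    tangentialDeriv α g x t ≤ A + poissonConst α * t ^ α * ∫ s, b s := by
  have hp := poissonConst_pos hα
  have hiK : Integrable fun z : ℝ => ((x - z) ^ 2 + t ^ 2) ^ (-((1 + α) / 2)) := by
    by_contra hcon
    have h1 := poissonConst_mul_integral_sq_add_sq hα x ht
    rw [integral_undef hcon] at h1
    simp at h1
  have hle : potential ((1 + α) / 2) g x t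
      ≤ ∫ s, (((x - s) ^ 2 + t ^ 2) ^ (-((1 + α) / 2)) * A + b s) := by
    refine integral_mono hi ((hiK.mul_const A).add hbi) fun s => ?_
    have hk0 : (0 : ℝ) ≤ ((x - s) ^ 2 + t ^ 2) ^ (-((1 + α) / 2)) := by positivity
    by_cases hs : |x - s| ≤ ρ
    · exact (mul_le_mul_of_nonneg_left (hnear s hs) hk0).trans (le_add_of_nonneg_right (hb0 s))
    · have hz : 0 < |x - s| := hρ.trans (not_le.1 hs)
      have h1 : ((x - s) ^ 2 + t ^ 2) ^ (-((1 + α) / 2)) ≤ |x - s| ^ (-(1 + α)) := by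
        rw [← sq_rpow_neg_half]
        have := sq_pos_of_pos hz
        rw [sq_abs] at this
        exact Real.rpow_le_rpow_of_nonpos this (by nlinarith [sq_nonneg t]) (by linarith)
      have h2 := (mul_le_mul_of_nonneg_right h1 (hg s)).trans (hb s (not_le.1 hs))
      exact h2.trans (le_add_of_nonneg_left (mul_nonneg hk0 hA))
  rw [integral_add (hiK.mul_const A) hbi, integral_mul_const] at hle
  calc tangentialDeriv α g x t ≤ poissonConst α * t ^ α *
        ((∫ s, ((x - s) ^ 2 + t ^ 2) ^ (-((1 + α) / 2))) * A + ∫ s, b s) := by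
        unfold tangentialDeriv
        gcongr
    _ = _ := by
        linear_combination A * poissonConst_mul_integral_sq_add_sq hα x ht

namespace IsProfile

variable {α τ : ℝ} {u m m' : ℝ → ℝ}

lemma integrable_potential_deriv (h : IsProfile α τ u m) (hα : 0 < α) (x : ℝ) {t : ℝ}
    (ht : 0 < t) : Integrable fun s => ((x - s) ^ 2 + t ^ 2) ^ (-((1 + α) / 2)) * m s :=
  integrable_potential hα.le h.continuous_deriv (h.integrable_deriv hα) (by linarith) x ht

lemma weight_le (α s : ℝ) :
    (s ^ 2 + 1) ^ (-((1 + α) / 2)) ≤ (s ^ 2 + 1) ^ (-(α / 2)) :=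
  Real.rpow_le_rpow_of_exponent_le (by nlinarith [sq_nonneg s]) (by linarith)

lemma exists_tangentialDeriv_bound (h : IsProfile α τ u m) (hα : 0 < α) (X Y : ℝ) :
    ∃ B, ∀ x, |x| ≤ X → ∀ t, 0 < t → t ≤ Y → tangentialDeriv α m x t ≤ B := by
  obtain ⟨A, hA⟩ := (isCompact_Icc (a := -(X + 1)) (b := X + 1)).exists_bound_of_continuousOn
    h.continuous_deriv.continuousOn
  obtain ⟨K, hK0, hK⟩ := exists_far_bound X one_pos (e := 1 + α) (by linarith)
  have hbi := (h.integrable_deriv hα).const_mul K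
  have hp := poissonConst_pos hα
  have hb0 : ∀ s, 0 ≤ K * ((s ^ 2 + 1) ^ (-(α / 2)) * m s) := fun s =>
    mul_nonneg hK0 (mul_nonneg (by positivity) (h.nonneg s))
  refine ⟨|A| + poissonConst α * Y ^ α * ∫ s, K * ((s ^ 2 + 1) ^ (-(α / 2)) * m s),
    fun x hx t ht htY => ?_⟩
  refine (tangentialDeriv_le hα ht one_pos (abs_nonneg A) h.nonneg
    (h.integrable_potential_deriv hα x ht) (fun s hs => ?_) hb0 (fun s hs => ?_) hbi).trans ?_
  · refine (le_abs_self _).trans ((hA s ?_).trans (le_abs_self A))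
    exact abs_le.1 (by linarith [abs_sub_abs_le_abs_sub s x, abs_sub_comm s x])
  · rw [← mul_assoc]
    refine mul_le_mul_of_nonneg_right ((hK x hx s hs).trans ?_) (h.nonneg s)
    exact mul_le_mul_of_nonneg_left (weight_le α s) hK0
  · have : 0 ≤ ∫ s, K * ((s ^ 2 + 1) ^ (-(α / 2)) * m s) := integral_nonneg hb0
    gcongr

/-- Approximate identity argument. As `m` is assumed neither bounded nor integrable, the far part is
controlled through `|m(s) - m(x)| ≤ m(s) + m(x)` and the two available weights. -/
lemma tendsto_tangentialDeriv (h : IsProfile α τ u m) (hα : 0 < α) (x : ℝ) :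
    Tendsto (fun t => tangentialDeriv α m x t) (𝓝[>] 0) (𝓝 (m x)) := by
  have hp := poissonConst_pos hα
  have hiK : ∀ t : ℝ, 0 < t → Integrable fun z : ℝ =>
      ((x - z) ^ 2 + t ^ 2) ^ (-((1 + α) / 2)) := fun t ht => by
    by_contra hcon
    have h1 := poissonConst_mul_integral_sq_add_sq hα x ht
    rw [integral_undef hcon] at h1
    simp at h1
  rw [Metric.tendsto_nhds]
  intro η hη
  obtain ⟨ρ, hρ, hcont⟩ := Metric.continuous_iff.1 h.continuous_deriv x (η / 2) (half_pos hη)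
  obtain ⟨K, hK0, hK⟩ := exists_far_bound |x| (half_pos hρ) (e := 1 + α) (by linarith)
  set b : ℝ → ℝ := fun s => K * ((s ^ 2 + 1) ^ (-(α / 2)) * m s) +
    K * m x * (s ^ 2 + 1) ^ (-((1 + α) / 2)) with hb
  have hbi : Integrable b := ((h.integrable_deriv hα).const_mul K).add
    ((integrable_sq_add_one_rpow (by linarith)).const_mul _)
  have hb0 : ∀ s, 0 ≤ b s := fun s => add_nonneg
    (mul_nonneg hK0 (mul_nonneg (by positivity) (h.nonneg s)))
    (mul_nonneg (mul_nonneg hK0 (h.nonneg x)) (by positivity))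
  have hsmall : Tendsto (fun t : ℝ => η / 2 + poissonConst α * t ^ α * ∫ s, b s) (𝓝[>] 0)
      (𝓝 (η / 2 + poissonConst α * 0 ^ α * ∫ s, b s)) := by
    refine Tendsto.mono_left ?_ nhdsWithin_le_nhds
    exact (((Real.continuousAt_rpow_const 0 α (Or.inr hα.le)).const_mul _).mul_const _
      |>.const_add _).tendsto
  rw [Real.zero_rpow hα.ne'] at hsmall
  filter_upwards [self_mem_nhdsWithin, hsmall.eventually_lt_const (show _ < η by linarith)]
    with t ht hlt
  have ht : 0 < t := ht
  have hi := h.integrable_potential_deriv hα x ht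
  have hdi : Integrable fun s => ((x - s) ^ 2 + t ^ 2) ^ (-((1 + α) / 2)) * (m s - m x) :=
    (hi.sub ((hiK t ht).mul_const (m x))).congr (ae_of_all _ fun s => by
      simp only [Pi.sub_apply]; ring)
  have heq : tangentialDeriv α m x t - m x = tangentialDeriv α (fun s => m s - m x) x t := by
    have h1 : potential ((1 + α) / 2) (fun s => m s - m x) x t = potential ((1 + α) / 2) m x t
        - (∫ s, ((x - s) ^ 2 + t ^ 2) ^ (-((1 + α) / 2))) * m x := by
      unfold potential
      rw [← integral_mul_const, ← integral_sub hi ((hiK t ht).mul_const _)]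
      congr 1; funext s; ring
    unfold tangentialDeriv
    rw [h1]
    linear_combination m x * poissonConst_mul_integral_sq_add_sq hα x ht
  have habs : |tangentialDeriv α (fun s => m s - m x) x t|
      ≤ tangentialDeriv α (fun s => |m s - m x|) x t := by
    unfold tangentialDeriv potential
    rw [abs_mul, abs_of_nonneg (by positivity)]
    refine mul_le_mul_of_nonneg_left ?_ (by positivity)
    refine (abs_integral_le_integral_abs).trans_eq ?_
    congr 1; funext s
    rw [abs_mul, abs_of_nonneg (Real.rpow_nonneg (sq_add_sq_pos _ ht).le _)]
  rw [Real.dist_eq, heq]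
  refine habs.trans_lt (lt_of_le_of_lt (tangentialDeriv_le hα ht (half_pos hρ) (half_pos hη).le
    (fun s => abs_nonneg _) ?_ (fun s hs => ?_) hb0 (fun s hs => ?_) hbi) hlt)
  · refine hdi.abs.congr (ae_of_all _ fun s => ?_)
    dsimp only
    rw [abs_mul, abs_of_nonneg (Real.rpow_nonneg (sq_add_sq_pos _ ht).le _)]
  · have := hcont s (by rw [Real.dist_eq, abs_sub_comm]; linarith)
    rw [Real.dist_eq] at this
    exact this.le
  · have h1 := hK x le_rfl s hs
    have h2 : |m s - m x| ≤ m s + m x := by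
      refine (abs_sub _ _).trans_eq ?_
      rw [abs_of_nonneg (h.nonneg s), abs_of_nonneg (h.nonneg x)]
    have h3 := weight_le α s
    have hms := h.nonneg s
    have hmx := h.nonneg x
    calc |x - s| ^ (-(1 + α)) * |m s - m x|
        ≤ K * (s ^ 2 + 1) ^ (-((1 + α) / 2)) * (m s + m x) := by gcongr
      _ = K * ((s ^ 2 + 1) ^ (-((1 + α) / 2)) * m s) +
          K * m x * (s ^ 2 + 1) ^ (-((1 + α) / 2)) := by ring
      _ ≤ _ := by simp only [hb]; gcongr

/-- Split at distance `x/2`. Near sources lie beyond `x/2`, where `m` is small; far sources yield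
one power `|x - s|^(-1) ≤ 2/x`, and the remaining `|x - s|^(-α)` is compared with the weight. The
estimate is uniform in `t ∈ (0, Y]`, as needed to pass to the limit under the energy integral. -/
lemma eventually_tangentialDeriv_le (h : IsProfile α τ u m) (hα : 0 < α)
    (hm0 : Tendsto m atTop (𝓝 0)) (Y : ℝ) {η : ℝ} (hη : 0 < η) :
    ∀ᶠ x in atTop, ∀ t, 0 < t → t ≤ Y → tangentialDeriv α m x t ≤ η := by
  set I := ∫ s : ℝ, (s ^ 2 + 1) ^ (-(α / 2)) * m s with hI
  have hI0 : 0 ≤ I := integral_nonneg fun s => mul_nonneg (by positivity) (h.nonneg s)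
  have hp := poissonConst_pos hα
  obtain ⟨N, hN⟩ := eventually_atTop.1 (hm0.eventually_lt_const (half_pos hη))
  have hlim : Tendsto (fun x : ℝ => poissonConst α * Y ^ α * (13 ^ (α / 2) * 2 * I) * x⁻¹) atTop
      (𝓝 (poissonConst α * Y ^ α * (13 ^ (α / 2) * 2 * I) * 0)) :=
    tendsto_inv_atTop_zero.const_mul _
  rw [mul_zero] at hlim
  filter_upwards [hlim.eventually_lt_const (half_pos hη), eventually_ge_atTop 1,
    eventually_ge_atTop (2 * N)] with x hx hx1 hxN t ht htY
  have hx0 : 0 < x := by linarith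
  have hbi := (h.integrable_deriv hα).const_mul (13 ^ (α / 2) * 2 * x⁻¹)
  refine (tangentialDeriv_le hα ht (half_pos hx0) (half_pos hη).le h.nonneg
    (h.integrable_potential_deriv hα x ht) (fun s hs => (hN s ?_).le)
    (fun s => ?_) (fun s hs => ?_) hbi).trans ?_
  · linarith [(abs_le.1 hs).2]
  · exact mul_nonneg (by positivity) (mul_nonneg (by positivity) (h.nonneg s))
  · have hz : 0 < |x - s| := by linarith
    have h0 : x ^ 2 ≤ 4 * (x - s) ^ 2 := by
      rw [← sq_abs (x - s)]; nlinarith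
    -- From `x ≤ 2|x - s|` follow `|s| ≤ 3|x - s|` and `1 ≤ x² ≤ 4(x - s)²`, and `9 + 4 = 13`.
    have h1 := rpow_neg_le_of_sq_le (z := x - s) (s := s) (K := 13) (by norm_num) hα.le
      (by nlinarith [sq_nonneg (x + 2 * (x - s)), sq_nonneg (x - 2 * (x - s)),
          sq_nonneg (2 * x - s)])
    have h2 : |x - s|⁻¹ ≤ 2 * x⁻¹ := by
      rw [inv_le_comm₀ hz (by positivity), mul_inv, inv_inv]; linarith
    have h3 : (0 : ℝ) ≤ (s ^ 2 + 1) ^ (-(α / 2)) := by positivity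
    rw [show -(1 + α) = -α - 1 by ring, Real.rpow_sub_one hz.ne', div_eq_mul_inv]
    calc |x - s| ^ (-α) * |x - s|⁻¹ * m s
        ≤ (13 ^ (α / 2) * (s ^ 2 + 1) ^ (-(α / 2))) * (2 * x⁻¹) * m s :=
          mul_le_mul_of_nonneg_right (by gcongr) (h.nonneg s)
      _ = _ := by ring
  · rw [integral_const_mul, ← hI]
    have h4 : poissonConst α * t ^ α * (13 ^ (α / 2) * 2 * x⁻¹ * I)
        ≤ poissonConst α * Y ^ α * (13 ^ (α / 2) * 2 * x⁻¹ * I) := by gcongr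
    linarith [h4, show poissonConst α * Y ^ α * (13 ^ (α / 2) * 2 * x⁻¹ * I)
      = poissonConst α * Y ^ α * (13 ^ (α / 2) * 2 * I) * x⁻¹ by ring]

end IsProfile

/-! ### Bounding `u''` by interpolation, and decay of `u'`. -/

/-- Interpolation: a continuous function controlled at each point by a small multiple of its
supremum on small balls is bounded. -/
lemma exists_bound_of_local_estimate {w : ℝ → ℝ} (hw : Continuous w) (hw0 : ∀ x, 0 ≤ w x)
    {α K₀ K₁ K₂ : ℝ} (hα₂ : α < 2) (hK₀ : 0 ≤ K₀) (hK₂ : 0 ≤ K₂)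
    (hest : ∀ x, 1 ≤ x → ∀ ρ, 0 < ρ → ρ ≤ 1 → ∀ A, 0 ≤ A → (∀ z, |z - x| ≤ ρ → w z ≤ A) →
      w x ≤ K₀ + K₁ * A * ρ ^ (2 - α) + K₂ * ρ ^ (-α)) :
    ∃ B, ∀ x, 2 ≤ x → w x ≤ B := by
  have hsmall : Tendsto (fun θ : ℝ => K₁ * 4 * θ ^ (2 - α)) (𝓝[>] 0)
      (𝓝 (K₁ * 4 * 0 ^ (2 - α))) :=
    (((Real.continuousAt_rpow_const 0 (2 - α) (Or.inr (by linarith))).const_mul _).tendsto).mono_left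
      nhdsWithin_le_nhds
  rw [Real.zero_rpow (by linarith), mul_zero] at hsmall
  -- The condition `4 K₁ θ^(2-α) < 1/2` lets the supremum term be absorbed on the left; `θ < 1/2`
  -- keeps the ball of radius `θr` where the cutoff is at least `r/2`.
  obtain ⟨θ, hθ1, hθ2⟩ := ((hsmall.eventually_lt_const (show (0 : ℝ) < 1 / 2 by norm_num)).and
    (Ioo_mem_nhdsGT (show (0 : ℝ) < 1 / 2 by norm_num))).exists
  obtain ⟨hθ0, hθh⟩ := hθ2
  refine ⟨2 * K₀ + 2 * K₂ * θ ^ (-α), fun x₀ hx₀ => ?_⟩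
  -- Weighting by the squared distance to the endpoints makes the maximum control `w` on a whole
  -- ball around `x₁`: there `w ≤ 4 w(x₁)`. The square also absorbs `r^(-α)` at the end, since `α <
  -- 2`.
  obtain ⟨x₁, hx₁, hmax⟩ := (isCompact_Icc (a := x₀ - 1) (b := x₀ + 1)).exists_isMaxOn
    ⟨x₀, by constructor <;> linarith⟩
    (f := fun x => w x * (1 - |x - x₀|) ^ 2) (by fun_prop)
  have hmax' : ∀ z, |z - x₀| ≤ 1 →
      w z * (1 - |z - x₀|) ^ 2 ≤ w x₁ * (1 - |x₁ - x₀|) ^ 2 := fun z hz =>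
    hmax ⟨by linarith [(abs_le.1 hz).1], by linarith [(abs_le.1 hz).2]⟩
  have h0 := hmax' x₀ (by simp)
  simp only [sub_self, abs_zero, sub_zero, one_pow, mul_one] at h0
  refine h0.trans ?_
  set r := 1 - |x₁ - x₀| with hr
  have hθα : 0 < θ ^ (-α) := by positivity
  have hd1 : |x₁ - x₀| ≤ 1 := abs_le.2 ⟨by linarith [hx₁.1], by linarith [hx₁.2]⟩
  rcases eq_or_lt_of_le (show 0 ≤ r by linarith) with hr0 | hr0
  · rw [← hr0]; simp; positivity
  have hr1 : r ≤ 1 := by linarith [abs_nonneg (x₁ - x₀)]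
  have hρ : 0 < θ * r := by positivity
  have hnear : ∀ z, |z - x₁| ≤ θ * r → w z ≤ 4 * w x₁ := fun z hz => by
    have h1 : |z - x₀| ≤ |z - x₁| + |x₁ - x₀| := by
      simpa using abs_add_le (z - x₁) (x₁ - x₀)
    have h2 : r / 2 ≤ 1 - |z - x₀| := by nlinarith
    have h3 := hmax' z (by linarith)
    have h4 : w z * (r / 2) ^ 2 ≤ w x₁ * r ^ 2 :=
      (mul_le_mul_of_nonneg_left (by gcongr) (hw0 z)).trans h3
    have h5 : w z * r ^ 2 ≤ (4 * w x₁) * r ^ 2 := by linarith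
    exact le_of_mul_le_mul_right h5 (by positivity)
  have hkey := hest x₁ (by linarith [hx₁.1]) (θ * r) hρ (by nlinarith) (4 * w x₁)
    (by linarith [hw0 x₁]) hnear
  have hr2 : r ^ (2 - α) ≤ 1 := Real.rpow_le_one hr0.le hr1 (by linarith)
  have hr2' : (0 : ℝ) ≤ r ^ (2 - α) := by positivity
  rw [Real.mul_rpow hθ0.le hr0.le, Real.mul_rpow hθ0.le hr0.le] at hkey
  have h6 : K₁ * (4 * w x₁) * (θ ^ (2 - α) * r ^ (2 - α)) ≤ 1 / 2 * w x₁ := by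
    calc _ = (K₁ * 4 * θ ^ (2 - α)) * w x₁ * r ^ (2 - α) := by ring
      _ ≤ (1 / 2) * w x₁ * 1 := by
        have := hw0 x₁
        gcongr
      _ = _ := by ring
  have h7 : w x₁ ≤ 2 * K₀ + 2 * K₂ * (θ ^ (-α) * r ^ (-α)) := by linarith
  have h8 : r ^ (-α) * r ^ 2 = r ^ (2 - α) := by
    rw [← Real.rpow_natCast r 2, ← Real.rpow_add hr0]; congr 1; push_cast; ring
  calc w x₁ * r ^ 2 ≤ (2 * K₀ + 2 * K₂ * (θ ^ (-α) * r ^ (-α))) * r ^ 2 := by gcongr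
    _ = 2 * K₀ * r ^ 2 + 2 * K₂ * θ ^ (-α) * (r ^ (-α) * r ^ 2) := by ring
    _ ≤ 2 * K₀ * 1 + 2 * K₂ * θ ^ (-α) * 1 := by
        rw [h8]
        have : r ^ 2 ≤ 1 := pow_le_one₀ hr0.le hr1
        gcongr
    _ = _ := by ring

/-- Landau's inequality: `m(x)` is at most a difference quotient of `u` with step `h` plus `B h`.
For fixed `h` the quotient tends to zero because `u` converges, and `h` can be chosen small. -/
lemma tendsto_deriv_zero_of_bounded_second_deriv {u m m' : ℝ → ℝ} {τ B : ℝ}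
    (hu : ∀ x, HasDerivAt u (m x) x) (hm : ∀ x, HasDerivAt m (m' x) x) (hm0 : ∀ x, 0 ≤ m x)
    (hlim : Tendsto u atTop (𝓝 τ)) (hB : ∀ x, 2 ≤ x → |m' x| ≤ B) : Tendsto m atTop (𝓝 0) := by
  have hB0 : 0 ≤ B := (abs_nonneg _).trans (hB 2 le_rfl)
  have hstep : ∀ h, 0 < h → ∀ x, 2 ≤ x → m x ≤ (u (x + h) - u x) / h + B * h := by
    intro h hh x hx
    obtain ⟨ξ, hξ, he⟩ := exists_hasDerivAt_eq_slope u m (show x < x + h by linarith)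
      (fun z _ => (hu z).continuousAt.continuousWithinAt) (fun z _ => hu z)
    rw [add_sub_cancel_left] at he
    obtain ⟨ζ, hζ, he'⟩ := exists_hasDerivAt_eq_slope m m' (show x < ξ from hξ.1)
      (fun z _ => (hm z).continuousAt.continuousWithinAt) (fun z _ => hm z)
    have h1 := (abs_le.1 (hB ζ (by linarith [hζ.1]))).1
    have h2 : 0 < ξ - x := by linarith [hξ.1]
    rw [eq_div_iff h2.ne'] at he'
    rw [← he]
    nlinarith [hξ.2]
  rw [Metric.tendsto_nhds]
  intro η hη
  set h := η / (2 * (B + 1)) with hh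
  have hpos : 0 < h := by positivity
  have hBh : B * h ≤ η / 2 := by
    rw [hh, ← mul_div_assoc, div_le_div_iff₀ (by positivity) (by norm_num)]
    nlinarith
  have hl : Tendsto (fun x => (u (x + h) - u x) / h) atTop (𝓝 ((τ - τ) / h)) :=
    ((hlim.comp (tendsto_atTop_add_const_right _ h tendsto_id)).sub hlim).div_const h
  rw [sub_self, zero_div] at hl
  filter_upwards [hl.eventually_lt_const (half_pos hη), eventually_ge_atTop 2] with x hx hx2
  rw [Real.dist_eq, sub_zero, abs_of_nonneg (hm0 x)]
  linarith [hstep h hpos x hx2]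

/-! ### The conservation law for the energy density and its boundary form. -/

/-- Green's formula on a rectangle for a closed form `φ dt + χ dx`. -/
lemma integral_sub_eq_of_closed_form {φ χ ψ : ℝ → ℝ → ℝ}
    (hφ : ∀ x t, 0 < t → HasDerivAt (fun x => φ x t) (ψ x t) x)
    (hχ : ∀ x t, 0 < t → HasDerivAt (fun t => χ x t) (ψ x t) t)
    (hψ : ContinuousOn (fun p : ℝ × ℝ => ψ p.1 p.2) {p | 0 < p.2}) (x R : ℝ) {ε y : ℝ}
    (hε : 0 < ε) (hy : 0 < y) :
    ∫ t in ε..y, (φ R t - φ x t) = ∫ s in x..R, (χ s y - χ s ε) := by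
  have hpos : ∀ t ∈ Set.uIcc ε y, 0 < t := fun t ht => (lt_min hε hy).trans_le ht.1
  have h1 : ∀ t, 0 < t → ∫ s in x..R, ψ s t = φ R t - φ x t := fun t ht =>
    intervalIntegral.integral_eq_sub_of_hasDerivAt (fun s _ => hφ s t ht)
      (Continuous.intervalIntegrable (continuous_iff_continuousAt.2 fun s =>
        (hψ.continuousAt ((isOpen_lt continuous_const continuous_snd).mem_nhds ht)).comp
          (x := s) (f := fun s : ℝ => (s, t)) (by fun_prop)) _ _)
  have h2 : ∀ s, ∫ t in ε..y, ψ s t = χ s y - χ s ε := fun s =>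
    intervalIntegral.integral_eq_sub_of_hasDerivAt (fun t ht => hχ s t (hpos t ht))
      (ContinuousOn.intervalIntegrable fun t ht =>
        ((hψ.continuousAt ((isOpen_lt continuous_const continuous_snd).mem_nhds (hpos t ht))).comp
          (x := t) (f := fun t : ℝ => (s, t)) (by fun_prop)).continuousWithinAt)
  have h3 : ∫ t in ε..y, (φ R t - φ x t) = ∫ t in ε..y, ∫ s in x..R, ψ s t :=
    intervalIntegral.integral_congr fun t ht => (h1 t (hpos t ht)).symm
  rw [h3, ← intervalIntegral_intervalIntegral_swap (F := fun s t => ψ s t)]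
  · exact intervalIntegral.integral_congr fun s _ => h2 s
  · have hcpt : IsCompact (Set.uIcc x R ×ˢ Set.uIcc ε y) := isCompact_uIcc.prod isCompact_uIcc
    refine ContinuousOn.integrableOn_compact hcpt (hψ.mono fun p hp => hpos p.2 hp.2) |>.mono_set ?_
    exact Set.prod_mono Set.uIoc_subset_uIcc Set.uIoc_subset_uIcc

/-- The energy density `t^(1-α) ((∂_x v)² - (∂_t v)²)`. -/
def energyDensity (α : ℝ) (m : ℝ → ℝ) (x t : ℝ) : ℝ :=
  t ^ (1 - α) * (tangentialDeriv α m x t ^ 2 - (t ^ (α - 1) * conormalDeriv α m x t) ^ 2)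

lemma energyDensity_eq (α : ℝ) (m : ℝ → ℝ) (x : ℝ) {t : ℝ} (ht : 0 < t) :
    energyDensity α m x t = t ^ (1 - α) * tangentialDeriv α m x t ^ 2
      - t ^ (α - 1) * conormalDeriv α m x t ^ 2 := by
  have h : t ^ (1 - α) * t ^ (α - 1) = 1 := by rw [← Real.rpow_add ht]; simp
  unfold energyDensity
  linear_combination (-(t ^ (α - 1)) * conormalDeriv α m x t ^ 2) * h

/-- The common mixed derivative of the energy density and the flux `-2 ∂_x v · t^(1-α) ∂_t v`. -/
def mixedDeriv (α : ℝ) (m : ℝ → ℝ) (x t : ℝ) : ℝ :=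
  -2 * (poissonConst α * (α * t ^ (α - 1) * potential ((1 + α) / 2) m x t
    - (1 + α) * (t ^ α * t) * potential ((1 + α) / 2 + 1) m x t)) * conormalDeriv α m x t
  - 2 * tangentialDeriv α m x t *
    (poissonConst α * (1 + α) * t * dipole ((1 + α) / 2 + 1) m x t)

namespace IsProfile

variable {α τ : ℝ} {u m m' : ℝ → ℝ}

lemma hasDerivAt_tangentialDeriv_right (h : IsProfile α τ u m) (hα : 0 < α) (x : ℝ) {t : ℝ}
    (ht : 0 < t) : HasDerivAt (fun t => tangentialDeriv α m x t)
      (poissonConst α * (α * t ^ (α - 1) * potential ((1 + α) / 2) m x t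
        - (1 + α) * (t ^ α * t) * potential ((1 + α) / 2 + 1) m x t)) t := by
  have h1 := ((Real.hasDerivAt_rpow_const (x := t) (p := α) (Or.inl ht.ne')).const_mul
    (poissonConst α)).mul (hasDerivAt_potential_right hα.le h.continuous_deriv
      (h.integrable_deriv hα) (b := (1 + α) / 2) (by linarith) x ht)
  refine HasDerivAt.congr_deriv (f := fun _ => _) h1 ?_
  ring

lemma hasDerivAt_tangentialDeriv_left (h : IsProfile α τ u m) (hα : 0 < α) (x : ℝ) {t : ℝ}
    (ht : 0 < t) : HasDerivAt (fun x => tangentialDeriv α m x t)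
      (-poissonConst α * t ^ α * (1 + α) * dipole ((1 + α) / 2 + 1) m x t) x := by
  have h1 := (hasDerivAt_potential_left hα.le h.continuous_deriv
      (h.integrable_deriv hα) (b := (1 + α) / 2) (by linarith) x ht).const_mul
      (poissonConst α * t ^ α)
  refine HasDerivAt.congr_deriv (f := fun _ => _) h1 ?_
  ring

lemma hasDerivAt_conormalDeriv_right (h : IsProfile α τ u m) (hα : 0 < α) (x : ℝ) {t : ℝ}
    (ht : 0 < t) : HasDerivAt (fun t => conormalDeriv α m x t)
      (poissonConst α * (1 + α) * t * dipole ((1 + α) / 2 + 1) m x t) t := by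
  have h1 := (hasDerivAt_dipole_right hα.le h.continuous_deriv
      (h.integrable_deriv hα) (b := (1 + α) / 2) le_rfl x ht).const_mul (-poissonConst α)
  refine HasDerivAt.congr_deriv (f := fun _ => _) h1 ?_
  ring

lemma hasDerivAt_conormalDeriv_left (h : IsProfile α τ u m) (hα : 0 < α) (x : ℝ) {t : ℝ}
    (ht : 0 < t) : HasDerivAt (fun x => conormalDeriv α m x t)
      (poissonConst α * (α * potential ((1 + α) / 2) m x t
        - (1 + α) * t ^ 2 * potential ((1 + α) / 2 + 1) m x t)) x := by
  have h1 := (hasDerivAt_dipole_left hα.le h.continuous_deriv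
      (h.integrable_deriv hα) (b := (1 + α) / 2) le_rfl x ht).const_mul (-poissonConst α)
  refine HasDerivAt.congr_deriv (f := fun _ => _) h1 ?_
  ring

/-- With `p = ∂_x v` and `w = t^(1-α) ∂_t v`, the system `∂_x w = t^(1-α) ∂_t p`, `∂_t w = -t^(1-α)
∂_x p` makes this `x`-derivative coincide with the `t`-derivative in `hasDerivAt_flux`. -/
lemma hasDerivAt_energyDensity (h : IsProfile α τ u m) (hα : 0 < α) (x : ℝ) {t : ℝ}
    (ht : 0 < t) : HasDerivAt (fun x => energyDensity α m x t) (mixedDeriv α m x t) x := by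
  have h1 := (((h.hasDerivAt_tangentialDeriv_left hα x ht).pow 2).const_mul (t ^ (1 - α))).sub
    (((h.hasDerivAt_conormalDeriv_left hα x ht).pow 2).const_mul (t ^ (α - 1)))
  simp_rw [energyDensity_eq α m _ ht]
  refine HasDerivAt.congr_deriv (f := fun _ => _) h1 ?_
  have e1 : t ^ (1 - α) * t ^ α = t := by rw [← Real.rpow_add ht]; simp
  have e2 : t ^ (α - 1) * t = t ^ α := by rw [← Real.rpow_add_one ht.ne']; simp
  unfold mixedDeriv
  push_cast
  linear_combination (-2 * poissonConst α * (1 + α) * tangentialDeriv α m x t *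
    dipole ((1 + α) / 2 + 1) m x t) * e1 + (2 * poissonConst α * (1 + α) * t *
      potential ((1 + α) / 2 + 1) m x t * conormalDeriv α m x t) * e2

lemma hasDerivAt_flux (h : IsProfile α τ u m) (hα : 0 < α) (x : ℝ) {t : ℝ} (ht : 0 < t) :
    HasDerivAt (fun t => -2 * (tangentialDeriv α m x t * conormalDeriv α m x t))
      (mixedDeriv α m x t) t := by
  have h1 := ((h.hasDerivAt_tangentialDeriv_right hα x ht).mul
    (h.hasDerivAt_conormalDeriv_right hα x ht)).const_mul (-2)
  refine HasDerivAt.congr_deriv (f := fun _ => _) h1 ?_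
  unfold mixedDeriv
  ring

lemma continuousOn_tangentialDeriv (h : IsProfile α τ u m) (hα : 0 < α) :
    ContinuousOn (fun p : ℝ × ℝ => tangentialDeriv α m p.1 p.2) {p | 0 < p.2} := by
  have h1 := continuousOn_potential hα.le h.continuous_deriv (h.integrable_deriv hα)
    (b := (1 + α) / 2) (by linarith)
  have h2 : ContinuousOn (fun p : ℝ × ℝ => p.2 ^ α) {p | 0 < p.2} :=
    continuous_snd.continuousOn.rpow_const fun p hp => Or.inl (ne_of_gt hp)
  exact (h2.const_mul (poissonConst α)).mul h1

lemma continuousOn_conormalDeriv (h : IsProfile α τ u m) (hα : 0 < α) :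
    ContinuousOn (fun p : ℝ × ℝ => conormalDeriv α m p.1 p.2) {p | 0 < p.2} :=
  (continuousOn_dipole hα.le h.continuous_deriv (h.integrable_deriv hα) le_rfl).const_mul _

lemma continuousOn_mixedDeriv (h : IsProfile α τ u m) (hα : 0 < α) :
    ContinuousOn (fun p : ℝ × ℝ => mixedDeriv α m p.1 p.2) {p | 0 < p.2} := by
  have h1 := continuousOn_potential hα.le h.continuous_deriv (h.integrable_deriv hα)
    (b := (1 + α) / 2) (by linarith)
  have h1' := continuousOn_potential hα.le h.continuous_deriv (h.integrable_deriv hα)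
    (b := (1 + α) / 2 + 1) (by linarith)
  have h2 := continuousOn_dipole hα.le h.continuous_deriv (h.integrable_deriv hα)
    (b := (1 + α) / 2 + 1) (by linarith)
  have hr : ∀ e : ℝ, ContinuousOn (fun p : ℝ × ℝ => p.2 ^ e) {p | 0 < p.2} := fun e =>
    continuous_snd.continuousOn.rpow_const fun p hp => Or.inl (ne_of_gt hp)
  have h3 := h.continuousOn_tangentialDeriv hα
  have h4 := h.continuousOn_conormalDeriv hα
  have h5 := hr α
  have h6 := hr (α - 1)
  unfold mixedDeriv
  fun_prop

lemma continuous_tangentialDeriv_left (h : IsProfile α τ u m) (hα : 0 < α) {t : ℝ} (ht : 0 < t) :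
    Continuous fun x => tangentialDeriv α m x t :=
  continuous_iff_continuousAt.2 fun x => (h.hasDerivAt_tangentialDeriv_left hα x ht).continuousAt

lemma continuous_conormalDeriv_left (h : IsProfile α τ u m) (hα : 0 < α) {t : ℝ} (ht : 0 < t) :
    Continuous fun x => conormalDeriv α m x t :=
  continuous_iff_continuousAt.2 fun x => (h.hasDerivAt_conormalDeriv_left hα x ht).continuousAt

/-- Both `∂_x v` and `t^(1-α) ∂_t v` stay bounded as `t → 0`, so the density is dominated by
multiples of `t^(1-α)` and `t^(α-1)`, integrable at `0` exactly because `0 < α < 2`. -/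
lemma intervalIntegrable_energyDensity (h : IsProfile α τ u m) (hα₀ : 0 < α) (hα₂ : α < 2)
    (hd : ∀ x, HasDerivAt m (m' x) x) (hm' : Continuous m') (x : ℝ) {y : ℝ} (hy : 0 ≤ y) :
    IntervalIntegrable (energyDensity α m x) volume 0 y := by
  obtain ⟨B₁, hB₁⟩ := h.exists_tangentialDeriv_bound hα₀ |x| y
  obtain ⟨B₂, hB₂⟩ := h.exists_conormalDeriv_bound hα₀ hα₂ hd hm' |x|
  have hdom : IntervalIntegrable (fun t : ℝ => t ^ (1 - α) * B₁ ^ 2 + t ^ (α - 1) * B₂ ^ 2)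
      volume 0 y :=
    ((intervalIntegral.intervalIntegrable_rpow' (by linarith)).mul_const _).add
      ((intervalIntegral.intervalIntegrable_rpow' (by linarith)).mul_const _)
  rw [intervalIntegrable_iff_integrableOn_Ioc_of_le hy] at hdom ⊢
  refine hdom.mono' ?_ ((ae_restrict_iff' measurableSet_Ioc).2 (ae_of_all _ fun t ht => ?_))
  · refine ContinuousOn.aestronglyMeasurable (fun t ht => ?_) measurableSet_Ioc
    have h1 := h.hasDerivAt_tangentialDeriv_right hα₀ x ht.1
    have h2 := h.hasDerivAt_conormalDeriv_right hα₀ x ht.1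
    have hr : ∀ e : ℝ, ContinuousAt (fun t : ℝ => t ^ e) t := fun e =>
      Real.continuousAt_rpow_const t e (Or.inl ht.1.ne')
    exact ((hr _).mul ((h1.continuousAt.pow 2).sub
      (((hr _).mul h2.continuousAt).pow 2))).continuousWithinAt
  · have ht0 : 0 < t := ht.1
    have h1 := tangentialDeriv_nonneg hα₀ h.nonneg x ht0
    have h2 := hB₁ x le_rfl t ht0 ht.2
    have h3 := abs_le.1 (hB₂ x le_rfl t ht0)
    have h4 : tangentialDeriv α m x t ^ 2 ≤ B₁ ^ 2 := by gcongr
    have h5 : conormalDeriv α m x t ^ 2 ≤ B₂ ^ 2 := sq_le_sq' h3.1 h3.2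
    rw [energyDensity_eq α m x ht0]
    refine (norm_sub_le _ _).trans ?_
    rw [Real.norm_of_nonneg (by positivity), Real.norm_of_nonneg (by positivity)]
    gcongr

/-- Passage to the limit `ε → 0` in Green's formula. -/
lemma integral_energyDensity_sub (h : IsProfile α τ u m) (hα₀ : 0 < α) (hα₂ : α < 2)
    (hd : ∀ x, HasDerivAt m (m' x) x) (hm' : Continuous m') {ℓ : ℝ → ℝ}
    (hℓ : ∀ x, HasFracLaplacian α u x (ℓ x)) {x R y : ℝ} (hy : 0 < y) :
    (∫ t in (0 : ℝ)..y, energyDensity α m R t) - ∫ t in (0 : ℝ)..y, energyDensity α m x t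
      = 2 * extensionConst α * (∫ s in x..R, m s * ℓ s)
        - 2 * ∫ s in x..R, tangentialDeriv α m s y * conormalDeriv α m s y := by
  have hiR := h.intervalIntegrable_energyDensity hα₀ hα₂ hd hm' R hy.le
  have hix := h.intervalIntegrable_energyDensity hα₀ hα₂ hd hm' x hy.le
  have hi := hiR.sub hix
  have hc : ∀ t, 0 < t → IntervalIntegrable
      (fun s => tangentialDeriv α m s t * conormalDeriv α m s t) volume x R := fun t ht =>
    ((h.continuous_tangentialDeriv_left hα₀ ht).mul
      (h.continuous_conormalDeriv_left hα₀ ht)).intervalIntegrable _ _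
  have hgreen : ∀ ε, 0 < ε → ε < y →
      ∫ t in ε..y, (energyDensity α m R t - energyDensity α m x t)
        = 2 * (∫ s in x..R, tangentialDeriv α m s ε * conormalDeriv α m s ε)
          - 2 * ∫ s in x..R, tangentialDeriv α m s y * conormalDeriv α m s y := by
    intro ε hε _
    rw [integral_sub_eq_of_closed_form (fun x t ht => h.hasDerivAt_energyDensity hα₀ x ht)
      (fun x t ht => h.hasDerivAt_flux hα₀ x ht) (h.continuousOn_mixedDeriv hα₀) x R hε hy,
      intervalIntegral.integral_sub ((hc y hy).const_mul _) ((hc ε hε).const_mul _),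
      intervalIntegral.integral_const_mul, intervalIntegral.integral_const_mul]
    ring
  have hlim1 : Tendsto (fun ε => ∫ t in ε..y, (energyDensity α m R t - energyDensity α m x t))
      (𝓝[>] 0) (𝓝 (∫ t in (0 : ℝ)..y, (energyDensity α m R t - energyDensity α m x t))) := by
    have hcont := intervalIntegral.continuousOn_primitive_interval' hi.symm Set.left_mem_uIcc
    have h0 := (hcont 0 Set.right_mem_uIcc).neg
    simp_rw [Pi.neg_def, ← intervalIntegral.integral_symm] at h0
    refine h0.tendsto.mono_left ?_
    rw [Set.uIcc_of_ge hy.le]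
    exact nhdsWithin_le_of_mem (mem_of_superset (Ioo_mem_nhdsGT hy) Set.Ioo_subset_Icc_self)
  -- At the boundary the flux converges pointwise to `m · d_α ℓ`; the bounds uniform in height over
  -- the compact range of `s` provide the domination.
  have hlim2 : Tendsto (fun ε => ∫ s in x..R, tangentialDeriv α m s ε * conormalDeriv α m s ε)
      (𝓝[>] 0) (𝓝 (∫ s in x..R, m s * (extensionConst α * ℓ s))) := by
    obtain ⟨B₁, hB₁⟩ := h.exists_tangentialDeriv_bound hα₀ (max |x| |R|) 1
    obtain ⟨B₂, hB₂⟩ := h.exists_conormalDeriv_bound hα₀ hα₂ hd hm' (max |x| |R|)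
    have hev : ∀ᶠ ε : ℝ in 𝓝[>] 0, ε ∈ Set.Ioo (0 : ℝ) 1 := Ioo_mem_nhdsGT one_pos
    refine intervalIntegral.tendsto_integral_filter_of_dominated_convergence (fun _ => B₁ * B₂)
      ?_ ?_ intervalIntegrable_const (ae_of_all _ fun s _ =>
        (h.tendsto_tangentialDeriv hα₀ s).mul (h.tendsto_conormalDeriv hα₀ hα₂ hd hm' (hℓ s)))
    · filter_upwards [hev] with ε hε
      exact ((h.continuous_tangentialDeriv_left hα₀ hε.1).mul
        (h.continuous_conormalDeriv_left hα₀ hε.1)).aestronglyMeasurable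
    · filter_upwards [hev] with ε hε
      refine ae_of_all _ fun s hs => ?_
      have hs' : |s| ≤ max |x| |R| := by
        have h1 := Set.uIoc_subset_uIcc hs
        rw [Set.mem_uIcc] at h1
        rcases h1 with h1 | h1
        · exact abs_le_max_abs_abs h1.1 h1.2
        · rw [max_comm]; exact abs_le_max_abs_abs h1.1 h1.2
      have h1 := tangentialDeriv_nonneg hα₀ h.nonneg s hε.1
      have h2 := hB₁ s hs' ε hε.1 hε.2.le
      have h3 := hB₂ s hs' ε hε.1
      rw [norm_mul, Real.norm_of_nonneg h1, Real.norm_eq_abs]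
      exact mul_le_mul h2 h3 (abs_nonneg _) (h1.trans h2)
  have hlim3 := ((hlim2.const_mul 2).sub_const
    (2 * ∫ s in x..R, tangentialDeriv α m s y * conormalDeriv α m s y)).congr' (by
      filter_upwards [Ioo_mem_nhdsGT hy] with ε hε using (hgreen ε hε.1 hε.2).symm)
  rw [← intervalIntegral.integral_sub hiR hix, tendsto_nhds_unique hlim1 hlim3]
  simp_rw [mul_left_comm (m _)]
  rw [intervalIntegral.integral_const_mul]
  ring

end IsProfile

/-! ### Sign of the flux: pairs of sources and oddness about the midpoint. -/

section odd

variable {G : ℝ → ℝ} {c x : ℝ}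

/-- The integral over a right half-line of a function which is odd about `c`, and nonnegative to
the right of `c`, only sees the part to the right of `max x (2c - x)`. -/
lemma integral_Ioi_eq_of_odd_about (hi : Integrable G) (hodd : ∀ z, G (2 * c - z) = -G z) :
    ∫ z in Set.Ioi x, G z = ∫ z in Set.Ioi (max x (2 * c - x)), G z := by
  rcases le_total (2 * c - x) x with h | h
  · rw [max_eq_left h]
  · rw [max_eq_right h, ← intervalIntegral.integral_interval_add_Ioi hi.integrableOn
      (hi.integrableOn (s := Set.Ioi (2 * c - x)))]
    have h1 := intervalIntegral.integral_comp_sub_left (a := x) (b := 2 * c - x) G (2 * c)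
    simp_rw [hodd, intervalIntegral.integral_neg, sub_sub_cancel] at h1
    linarith

lemma integral_Ioi_nonneg_of_odd_about (hi : Integrable G) (hodd : ∀ z, G (2 * c - z) = -G z)
    (hG : ∀ z, c ≤ z → 0 ≤ G z) : 0 ≤ ∫ z in Set.Ioi x, G z := by
  rw [integral_Ioi_eq_of_odd_about hi hodd]
  refine setIntegral_nonneg measurableSet_Ioi fun z hz => hG z ?_
  rw [Set.mem_Ioi, max_lt_iff] at hz
  linarith [hz.1, hz.2]

lemma mul_le_integral_Ioi_of_odd_about (hi : Integrable G) (hodd : ∀ z, G (2 * c - z) = -G z)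
    (hG : ∀ z, c ≤ z → 0 ≤ G z) {q t κ : ℝ} (ht : 0 ≤ t) (hq : x ≤ q) (hq' : 2 * c - x ≤ q)
    (hκ : ∀ z ∈ Set.Ioc q (q + t), κ ≤ G z) : t * κ ≤ ∫ z in Set.Ioi x, G z := by
  rw [integral_Ioi_eq_of_odd_about hi hodd]
  calc t * κ = ∫ _ in Set.Ioc q (q + t), κ := by
        rw [setIntegral_const, measureReal_def, Real.volume_Ioc, add_sub_cancel_left,
          ENNReal.toReal_ofReal ht, smul_eq_mul]
    _ ≤ ∫ z in Set.Ioc q (q + t), G z :=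
        setIntegral_mono_on (integrableOn_const (by simp)) hi.integrableOn measurableSet_Ioc hκ
    _ ≤ _ := by
        refine setIntegral_mono_set hi.integrableOn ((ae_restrict_iff' measurableSet_Ioi).2
          (ae_of_all _ fun z hz => ?_)) (Set.Ioc_subset_Ioi_self.trans
            (Set.Ioi_subset_Ioi (max_le hq hq'))).eventuallyLE
        rw [Set.mem_Ioi, max_lt_iff] at hz
        exact hG z (by linarith [hz.1, hz.2])

end odd

section pair

variable {b t : ℝ}

lemma integrable_sq_add_sq_rpow (hb : 1 / 2 < b) (ht : 0 < t) (s : ℝ) :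
    Integrable fun z : ℝ => ((z - s) ^ 2 + t ^ 2) ^ (-b) := by
  have h := (((integrable_sq_add_one_rpow hb).comp_div ht.ne').const_mul
    (t ^ (-(2 * b)))).comp_sub_right s
  refine h.congr (ae_of_all _ fun z => ?_)
  exact (sq_add_sq_rpow_eq_scaled _ _ ht).symm

lemma integrable_pair (hb : 1 / 2 < b) (ht : 0 < t) (s r : ℝ) :
    Integrable fun z : ℝ => (z - s) * ((z - s) ^ 2 + t ^ 2) ^ (-b) *
      ((z - r) ^ 2 + t ^ 2) ^ (-b) := by
  have hc : ∀ s : ℝ, Continuous fun z : ℝ => ((z - s) ^ 2 + t ^ 2) ^ (-b) := fun s =>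
    Continuous.rpow_const (by fun_prop) fun z => Or.inl (sq_add_sq_pos _ ht).ne'
  refine ((integrable_sq_add_sq_rpow hb ht r).const_mul ((t ^ 2) ^ (-(b - 1 / 2)))).mono'
    (((continuous_id.sub continuous_const).mul (hc s)).mul (hc r)).aestronglyMeasurable
    (ae_of_all _ fun z => ?_)
  have h1 := (abs_mul_rpow_neg_le (z - s) b ht).trans (Real.rpow_le_rpow_of_nonpos
    (by positivity) (by nlinarith [sq_nonneg (z - s)] : t ^ 2 ≤ (z - s) ^ 2 + t ^ 2)
      (by linarith))
  have h2 : (0 : ℝ) ≤ ((z - r) ^ 2 + t ^ 2) ^ (-b) := by positivity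
  rw [norm_mul, Real.norm_of_nonneg h2, Real.norm_eq_abs]
  exact mul_le_mul_of_nonneg_right h1 h2

/-- The symmetrized pair interaction. -/
def pairKernel (b t s r z : ℝ) : ℝ :=
  (2 * z - s - r) * (((z - s) ^ 2 + t ^ 2) ^ (-b) * ((z - r) ^ 2 + t ^ 2) ^ (-b))

lemma pairKernel_eq (s r z : ℝ) : pairKernel b t s r z
    = (z - s) * ((z - s) ^ 2 + t ^ 2) ^ (-b) * ((z - r) ^ 2 + t ^ 2) ^ (-b)
      + (z - r) * ((z - r) ^ 2 + t ^ 2) ^ (-b) * ((z - s) ^ 2 + t ^ 2) ^ (-b) := by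
  unfold pairKernel; ring

lemma integrable_pairKernel (hb : 1 / 2 < b) (ht : 0 < t) (s r : ℝ) :
    Integrable (pairKernel b t s r) := by
  refine ((integrable_pair hb ht s r).add (integrable_pair hb ht r s)).congr
    (ae_of_all _ fun z => ?_)
  exact (pairKernel_eq s r z).symm

lemma pairKernel_odd (s r z : ℝ) :
    pairKernel b t s r (2 * ((s + r) / 2) - z) = -pairKernel b t s r z := by
  unfold pairKernel
  rw [show (2 * ((s + r) / 2) - z - s) ^ 2 = (z - r) ^ 2 by ring,
    show (2 * ((s + r) / 2) - z - r) ^ 2 = (z - s) ^ 2 by ring]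
  ring

lemma pairKernel_nonneg {s r z : ℝ} (hz : (s + r) / 2 ≤ z) : 0 ≤ pairKernel b t s r z := by
  refine mul_nonneg (by linarith) ?_
  positivity

lemma integral_pairKernel_nonneg (hb : 1 / 2 < b) (ht : 0 < t) (x s r : ℝ) :
    0 ≤ ∫ z in Set.Ioi x, pairKernel b t s r z :=
  integral_Ioi_nonneg_of_odd_about (integrable_pairKernel hb ht s r) (pairKernel_odd s r)
    fun _ hz => pairKernel_nonneg hz

/-- Sources on opposite sides of `x`, at distance between `1` and `2`. On the window `(r, r + t]`
one has `z - r ≤ t`, `z - s ≤ 4 + t` and `2z - s - r ≥ 2`. The length `t` of the window produces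
`t^(1-2b)`, which for `b = (1 + α)/2` cancels the factor `t^α` of the tangential derivative. -/
lemma le_integral_pairKernel (hb : 1 / 2 < b) (ht : 0 < t) {x s r : ℝ}
    (hs : s ∈ Set.Icc (x - 2) (x - 1)) (hr : r ∈ Set.Icc (x + 1) (x + 2)) :
    2 * (t ^ (1 - 2 * b) * 2 ^ (-b) * ((4 + t) ^ 2 + t ^ 2) ^ (-b))
      ≤ ∫ z in Set.Ioi x, pairKernel b t s r z := by
  have h2t : (2 * t ^ 2) ^ (-b) = 2 ^ (-b) * t ^ (-(2 * b)) := by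
    rw [Real.mul_rpow (by norm_num) (by positivity), ← Real.rpow_natCast t 2,
      ← Real.rpow_mul ht.le]
    congr 2; push_cast; ring
  have h := mul_le_integral_Ioi_of_odd_about (x := x) (q := r) (t := t)
    (κ := 2 * (((4 + t) ^ 2 + t ^ 2) ^ (-b) * (2 * t ^ 2) ^ (-b)))
    (integrable_pairKernel hb ht s r) (pairKernel_odd s r)
    (fun _ hz => pairKernel_nonneg hz) ht.le (by linarith [hr.1]) (by linarith [hs.2])
    (fun z hz => by
      have h1 : (4 + t) ^ 2 ≥ (z - s) ^ 2 :=
        sq_le_sq' (by linarith [hz.1, hr.1, hs.2]) (by linarith [hz.2, hr.2, hs.1])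
      have h2 : (z - r) ^ 2 ≤ t ^ 2 := sq_le_sq' (by linarith [hz.1]) (by linarith [hz.2])
      have h3 := Real.rpow_le_rpow_of_nonpos (sq_add_sq_pos (z - s) ht)
        (by linarith : (z - s) ^ 2 + t ^ 2 ≤ (4 + t) ^ 2 + t ^ 2) (show -b ≤ 0 by linarith)
      have h4 := Real.rpow_le_rpow_of_nonpos (sq_add_sq_pos (z - r) ht)
        (by linarith : (z - r) ^ 2 + t ^ 2 ≤ 2 * t ^ 2) (show -b ≤ 0 by linarith)
      unfold pairKernel
      have h5 : 2 ≤ 2 * z - s - r := by linarith [hz.1, hr.1, hs.2]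
      gcongr)
  refine le_trans (le_of_eq ?_) h
  rw [h2t, show 1 - 2 * b = 1 + -(2 * b) by ring, Real.rpow_one_add' ht.le (by linarith)]
  ring

end pair

namespace IsProfile

variable {α τ : ℝ} {u m : ℝ → ℝ}

lemma extensionFunction_le (h : IsProfile α τ u m) (hα : 0 < α) (x : ℝ) {t : ℝ} (ht : 0 < t) :
    extensionFunction α u x t ≤ τ := by
  rw [h.extensionFunction_eq hα x ht]
  have h1 : 0 ≤ ∫ s, tailIntegral ((1 + α) / 2) ((x - s) / t) * m s :=
    integral_nonneg fun s => mul_nonneg (tailIntegral_nonneg _ _) (h.nonneg s)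
  have := mul_nonneg (poissonConst_pos hα).le h1
  linarith

/-- At fixed height the extension is nondecreasing in `x` and bounded above by `τ`, so its
derivative is integrable towards `+∞`. -/
lemma integrableOn_tangentialDeriv (h : IsProfile α τ u m) (hα : 0 < α) (x : ℝ) {t : ℝ}
    (ht : 0 < t) : IntegrableOn (fun s => tangentialDeriv α m s t) (Set.Ioi x) := by
  have hd := fun s => h.hasDerivAt_extensionFunction_left hα s ht
  have h0 := fun s => tangentialDeriv_nonneg hα h.nonneg s ht
  exact integrableOn_Ioi_deriv_of_nonneg' (fun s _ => hd s) (fun s _ => h0 s)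
    (tendsto_atTop_ciSup (monotone_of_hasDerivAt_nonneg hd h0)
      ⟨τ, by rintro _ ⟨s, rfl⟩; exact h.extensionFunction_le hα s ht⟩)

lemma integrableOn_potential (h : IsProfile α τ u m) (hα : 0 < α) (x : ℝ) {t : ℝ}
    (ht : 0 < t) : IntegrableOn (fun s => potential ((1 + α) / 2) m s t) (Set.Ioi x) := by
  have h1 := h.integrableOn_tangentialDeriv hα x ht
  have hne : poissonConst α * t ^ α ≠ 0 :=
    mul_ne_zero (poissonConst_pos hα).ne' (Real.rpow_pos_of_pos ht α).ne'
  exact (integrable_const_mul_iff hne.isUnit _).1 h1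

/-- Uniformity in `z > x` comes from two regimes: sources beyond `x` have finite mass and a kernel
bounded in terms of `t`, while sources before `x` are farther from `z` than from `x`. -/
lemma exists_abs_dipole_bound (h : IsProfile α τ u m) (hα : 0 < α) (x : ℝ) {t : ℝ}
    (ht : 0 < t) : ∃ B, ∀ z, x < z →
      ∫ s, ‖(z - s) * ((z - s) ^ 2 + t ^ 2) ^ (-((1 + α) / 2)) * m s‖ ≤ B := by
  have hI1 := ((integrable_indicator_iff measurableSet_Ioi).2
    (integrableOn_Ioi_of_hasDerivAt h.hasDerivAt h.nonneg h.tendsto x)).const_mul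
      ((t ^ 2) ^ (-(α / 2)))
  have hI2 := integrable_potential hα.le h.continuous_deriv (h.integrable_deriv hα) le_rfl x ht
  refine ⟨∫ s, ((t ^ 2) ^ (-(α / 2)) * (Set.Ioi x).indicator m s +
    ((x - s) ^ 2 + t ^ 2) ^ (-(α / 2)) * m s), fun z hz => ?_⟩
  refine integral_mono (integrable_dipole hα.le h.continuous_deriv (h.integrable_deriv hα)
    le_rfl z ht).norm (hI1.add hI2) fun s => ?_
  have h1 := abs_mul_rpow_neg_le (z - s) ((1 + α) / 2) ht
  rw [show -((1 + α) / 2 - 1 / 2) = -(α / 2) by ring] at h1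
  have hm := h.nonneg s
  have h2 : (0 : ℝ) ≤ ((x - s) ^ 2 + t ^ 2) ^ (-(α / 2)) * m s := mul_nonneg (by positivity) hm
  rw [norm_mul, Real.norm_of_nonneg hm, Real.norm_eq_abs]
  by_cases hs : s ∈ Set.Ioi x
  · rw [Set.indicator_of_mem hs]
    have h3 := h1.trans (Real.rpow_le_rpow_of_nonpos (by positivity)
      (by nlinarith [sq_nonneg (z - s)] : t ^ 2 ≤ (z - s) ^ 2 + t ^ 2) (by linarith))
    linarith [mul_le_mul_of_nonneg_right h3 hm]
  · rw [Set.indicator_of_notMem hs, mul_zero, zero_add]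
    have hs' : s ≤ x := not_lt.1 hs
    have h3 := h1.trans (Real.rpow_le_rpow_of_nonpos (sq_add_sq_pos (x - s) ht)
      (by nlinarith : (x - s) ^ 2 + t ^ 2 ≤ (z - s) ^ 2 + t ^ 2) (by linarith))
    exact mul_le_mul_of_nonneg_right h3 hm

/-- The interaction integrand, on the half-line times the plane of pairs of sources. -/
lemma integrable_interaction (h : IsProfile α τ u m) (hα : 0 < α) (x : ℝ) {t : ℝ}
    (ht : 0 < t) : Integrable (fun p : ℝ × ℝ × ℝ =>
      ((p.1 - p.2.1) * ((p.1 - p.2.1) ^ 2 + t ^ 2) ^ (-((1 + α) / 2)) * m p.2.1) *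
        (((p.1 - p.2.2) ^ 2 + t ^ 2) ^ (-((1 + α) / 2)) * m p.2.2))
      ((volume.restrict (Set.Ioi x)).prod (volume.prod volume)) := by
  have hmc := h.continuous_deriv
  have hcont : Continuous fun p : ℝ × ℝ × ℝ =>
      ((p.1 - p.2.1) * ((p.1 - p.2.1) ^ 2 + t ^ 2) ^ (-((1 + α) / 2)) * m p.2.1) *
        (((p.1 - p.2.2) ^ 2 + t ^ 2) ^ (-((1 + α) / 2)) * m p.2.2) := by
    have h1 : Continuous fun p : ℝ × ℝ × ℝ =>
        ((p.1 - p.2.1) ^ 2 + t ^ 2) ^ (-((1 + α) / 2)) :=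
      Continuous.rpow_const (by fun_prop) fun p => Or.inl (sq_add_sq_pos _ ht).ne'
    have h2 : Continuous fun p : ℝ × ℝ × ℝ =>
        ((p.1 - p.2.2) ^ 2 + t ^ 2) ^ (-((1 + α) / 2)) :=
      Continuous.rpow_const (by fun_prop) fun p => Or.inl (sq_add_sq_pos _ ht).ne'
    fun_prop
  have hsm := hcont.aestronglyMeasurable
    (μ := (volume.restrict (Set.Ioi x)).prod ((volume : Measure ℝ).prod volume))
  obtain ⟨B, hB⟩ := h.exists_abs_dipole_bound hα x ht
  rw [integrable_prod_iff hsm]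
  constructor
  · refine ae_of_all _ fun z => ?_
    exact (integrable_dipole hα.le hmc (h.integrable_deriv hα) le_rfl z ht).mul_prod
      (h.integrable_potential_deriv hα z ht)
  · refine ((h.integrableOn_potential hα x ht).const_mul B).mono' hsm.norm.integral_prod_right'
      ((ae_restrict_iff' measurableSet_Ioi).2 (ae_of_all _ fun z hz => ?_))
    simp_rw [norm_mul _ (((z - _) ^ 2 + t ^ 2) ^ (-((1 + α) / 2)) * m _)]
    rw [integral_prod_mul (fun s => ‖(z - s) * ((z - s) ^ 2 + t ^ 2) ^ (-((1 + α) / 2)) * m s‖)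
      (fun s => ‖((z - s) ^ 2 + t ^ 2) ^ (-((1 + α) / 2)) * m s‖)]
    have h1 : ∫ s, ‖((z - s) ^ 2 + t ^ 2) ^ (-((1 + α) / 2)) * m s‖
        = potential ((1 + α) / 2) m z t := by
      unfold potential
      congr 1; funext s
      exact Real.norm_of_nonneg (mul_nonneg (by positivity) (h.nonneg s))
    have h2 : 0 ≤ potential ((1 + α) / 2) m z t :=
      integral_nonneg fun s => mul_nonneg (by positivity) (h.nonneg s)
    rw [h1, Real.norm_of_nonneg (mul_nonneg (integral_nonneg fun _ => norm_nonneg _) h2)]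
    exact mul_le_mul_of_nonneg_right (hB z hz) h2

/-- The product is a double integral over sources `(s, r)`. After Fubini, adding the integrand with
`s` and `r` exchanged gives `pairKernel`, whose half-line integral is nonnegative for every pair;
only pairs straddling `x` are kept for the lower bound. -/
lemma le_integral_dipole_mul_potential (h : IsProfile α τ u m) (hα : 0 < α) (x : ℝ) {t : ℝ}
    (ht : 0 < t) :
    IntegrableOn (fun z => dipole ((1 + α) / 2) m z t * potential ((1 + α) / 2) m z t)
      (Set.Ioi x) ∧
    t ^ (-α) * 2 ^ (-((1 + α) / 2)) * ((4 + t) ^ 2 + t ^ 2) ^ (-((1 + α) / 2)) *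
        ((∫ s in Set.Icc (x - 2) (x - 1), m s) * ∫ s in Set.Icc (x + 1) (x + 2), m s)
      ≤ ∫ z in Set.Ioi x, dipole ((1 + α) / 2) m z t * potential ((1 + α) / 2) m z t := by
  set β := (1 + α) / 2 with hβ
  have hb : 1 / 2 < β := by linarith
  have hint := h.integrable_interaction hα x ht
  rw [← hβ] at hint
  have hin : ∀ z, ∫ q : ℝ × ℝ, ((z - q.1) * ((z - q.1) ^ 2 + t ^ 2) ^ (-β) * m q.1) *
      (((z - q.2) ^ 2 + t ^ 2) ^ (-β) * m q.2) ∂(volume.prod volume)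
      = dipole β m z t * potential β m z t := fun z =>
    integral_prod_mul (fun s => (z - s) * ((z - s) ^ 2 + t ^ 2) ^ (-β) * m s)
      (fun s => ((z - s) ^ 2 + t ^ 2) ^ (-β) * m s)
  have hI : IntegrableOn (fun z => dipole β m z t * potential β m z t) (Set.Ioi x) :=
    hint.integral_prod_left.congr (ae_of_all _ hin)
  refine ⟨hI, ?_⟩
  have hQ := hint.integral_prod_right
  have hswap := integral_integral_swap (f := fun z (q : ℝ × ℝ) =>
    ((z - q.1) * ((z - q.1) ^ 2 + t ^ 2) ^ (-β) * m q.1) *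
      (((z - q.2) ^ 2 + t ^ 2) ^ (-β) * m q.2)) hint
  simp_rw [hin] at hswap
  rw [hswap]
  set Q : ℝ × ℝ → ℝ := fun q => ∫ z in Set.Ioi x,
    ((z - q.1) * ((z - q.1) ^ 2 + t ^ 2) ^ (-β) * m q.1) *
      (((z - q.2) ^ 2 + t ^ 2) ^ (-β) * m q.2) with hQdef
  have hsum : ∀ q : ℝ × ℝ, Q q + Q q.swap
      = (m q.1 * m q.2) * ∫ z in Set.Ioi x, pairKernel β t q.1 q.2 z := by
    intro q
    have e : ∀ s r : ℝ, (fun z => ((z - s) * ((z - s) ^ 2 + t ^ 2) ^ (-β) * m s) *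
        (((z - r) ^ 2 + t ^ 2) ^ (-β) * m r)) = fun z => (m s * m r) *
          ((z - s) * ((z - s) ^ 2 + t ^ 2) ^ (-β) * ((z - r) ^ 2 + t ^ 2) ^ (-β)) := by
      intro s r; funext z; ring
    simp only [hQdef, Prod.fst_swap, Prod.snd_swap, e, pairKernel_eq]
    rw [integral_const_mul, integral_const_mul, integral_add
      (integrable_pair hb ht q.1 q.2).integrableOn (integrable_pair hb ht q.2 q.1).integrableOn]
    ring
  have hQs : Integrable (fun q => Q q + Q q.swap) (volume.prod volume) := hQ.add hQ.swap
  have h2I : ∫ q, (Q q + Q q.swap) ∂(volume.prod volume) = 2 * ∫ q, Q q ∂(volume.prod volume) := by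
    have hs : ∫ q, Q q.swap ∂(volume.prod volume) = ∫ q, Q q ∂(volume.prod volume) :=
      integral_prod_swap Q
    rw [integral_add hQ (by exact hQ.swap), hs]
    ring
  set κ := t ^ (-α) * 2 ^ (-β) * ((4 + t) ^ 2 + t ^ 2) ^ (-β) with hκ
  set Bx := Set.Icc (x - 2) (x - 1) ×ˢ Set.Icc (x + 1) (x + 2) with hBx
  have hmm : IntegrableOn (fun q : ℝ × ℝ => m q.1 * m q.2) Bx (volume.prod volume) := by
    have hc : Continuous fun q : ℝ × ℝ => m q.1 * m q.2 :=
      (h.continuous_deriv.comp continuous_fst).mul (h.continuous_deriv.comp continuous_snd)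
    exact hc.continuousOn.integrableOn_compact (isCompact_Icc.prod isCompact_Icc)
  have hlow : 2 * κ * ((∫ s in Set.Icc (x - 2) (x - 1), m s) *
      ∫ s in Set.Icc (x + 1) (x + 2), m s) ≤ ∫ q, (Q q + Q q.swap) ∂(volume.prod volume) := by
    calc _ = ∫ q in Bx, 2 * κ * (m q.1 * m q.2) ∂(volume.prod volume) := by
          rw [integral_const_mul, hBx, setIntegral_prod_mul]
      _ ≤ ∫ q in Bx, (Q q + Q q.swap) ∂(volume.prod volume) := by
          refine setIntegral_mono_on (hmm.const_mul _) hQs.integrableOn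
            (measurableSet_Icc.prod measurableSet_Icc) fun q hq => ?_
          rw [hsum, mul_comm]
          refine mul_le_mul_of_nonneg_left ?_ (mul_nonneg (h.nonneg _) (h.nonneg _))
          have h1 := le_integral_pairKernel hb ht hq.1 hq.2
          rwa [show 1 - 2 * β = -α by rw [hβ]; ring] at h1
      _ ≤ _ := by
          refine setIntegral_le_integral hQs (ae_of_all _ fun q => ?_)
          simp only [Pi.zero_apply, hsum]
          exact mul_nonneg (mul_nonneg (h.nonneg _) (h.nonneg _))
            (integral_pairKernel_nonneg hb ht x _ _)
  linarith

/-- Strict negativity of the flux through a right half-line. -/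
lemma integral_flux_le (h : IsProfile α τ u m) (hα : 0 < α) (x : ℝ) {t : ℝ} (ht : 0 < t) :
    IntegrableOn (fun z => tangentialDeriv α m z t * conormalDeriv α m z t) (Set.Ioi x) ∧
    ∫ z in Set.Ioi x, tangentialDeriv α m z t * conormalDeriv α m z t
      ≤ -(poissonConst α ^ 2 * 2 ^ (-((1 + α) / 2)) *
        ((∫ s in Set.Icc (x - 2) (x - 1), m s) * ∫ s in Set.Icc (x + 1) (x + 2), m s)) *
          ((4 + t) ^ 2 + t ^ 2) ^ (-((1 + α) / 2)) := by
  obtain ⟨h1, h2⟩ := h.le_integral_dipole_mul_potential hα x ht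
  have e : (fun z => tangentialDeriv α m z t * conormalDeriv α m z t) = fun z =>
      -(poissonConst α ^ 2 * t ^ α) *
        (dipole ((1 + α) / 2) m z t * potential ((1 + α) / 2) m z t) := by
    funext z; unfold tangentialDeriv conormalDeriv; ring
  rw [e]
  refine ⟨h1.const_mul _, ?_⟩
  rw [integral_const_mul]
  have hta := Real.rpow_pos_of_pos ht α
  have h3 := mul_le_mul_of_nonneg_left h2 (show 0 ≤ poissonConst α ^ 2 * t ^ α by positivity)
  have h4 : t ^ α * t ^ (-α) = 1 := by rw [← Real.rpow_add ht]; simp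
  calc _ ≤ -(poissonConst α ^ 2 * t ^ α * (t ^ (-α) * 2 ^ (-((1 + α) / 2)) *
        ((4 + t) ^ 2 + t ^ 2) ^ (-((1 + α) / 2)) *
        ((∫ s in Set.Icc (x - 2) (x - 1), m s) * ∫ s in Set.Icc (x + 1) (x + 2), m s))) := by
        linarith
    _ = _ := by
        linear_combination (-(poissonConst α ^ 2 * 2 ^ (-((1 + α) / 2)) *
          ((4 + t) ^ 2 + t ^ 2) ^ (-((1 + α) / 2)) *
          ((∫ s in Set.Icc (x - 2) (x - 1), m s) * ∫ s in Set.Icc (x + 1) (x + 2), m s))) * h4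

end IsProfile

/-! ### The Hamiltonian inequality for solutions. -/

namespace IsProfile

variable {α τ c : ℝ} {u m m' f F ℓ : ℝ → ℝ}

/-- The equation reads `u'' = -cℓ - f(u)`. Here `f(u)` is bounded on `x ≥ 1`, where `u` stays in `[u
1, τ]`, and `ℓ` inherits the uniform conormal bound as `t → 0`; this is the local self-estimate for
`|u''|` required by the interpolation lemma. -/
lemma tendsto_deriv_zero (h : IsProfile α τ u m) (hα₀ : 0 < α) (hα₂ : α < 2)
    (hd : ∀ x, HasDerivAt m (m' x) x) (hm' : Continuous m') (hf : Continuous f) (hc : 0 < c)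
    (hℓ : ∀ x, HasFracLaplacian α u x (ℓ x)) (heq : ∀ x, m' x + c * ℓ x + f (u x) = 0) :
    Tendsto m atTop (𝓝 0) := by
  obtain ⟨K, hK⟩ := h.exists_conormalDeriv_bound_right hα₀ hα₂ hd
  obtain ⟨Mf, hMf⟩ := (isCompact_Icc (a := u 1) (b := τ)).exists_bound_of_continuousOn
    hf.continuousOn
  have hp := poissonConst_pos hα₀
  have hdα := extensionConst_pos hα₀ hα₂
  set q := c * poissonConst α / extensionConst α with hq
  have hq0 : 0 < q := by positivity
  obtain ⟨B, hB⟩ := exists_bound_of_local_estimate (w := fun x => |m' x|) hm'.abs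
    (fun x => abs_nonneg _) (K₀ := |Mf|) (K₁ := q * (2 / (2 - α))) (K₂ := q * |K|) hα₂
    (abs_nonneg _) (by positivity) (fun x hx ρ hρ hρ1 A hA0 hA => by
      have hlim := (h.tendsto_conormalDeriv hα₀ hα₂ hd hm' (hℓ x)).abs
      have h1 : |extensionConst α * ℓ x| ≤
          poissonConst α * (A * (2 * ρ ^ (2 - α) / (2 - α)) + K * ρ ^ (-α)) :=
        le_of_tendsto hlim (by
          filter_upwards [self_mem_nhdsWithin] with t ht using hK x hx ρ hρ hρ1 A hA0 hA t ht)
      rw [abs_mul, abs_of_pos hdα] at h1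
      have h2 : c * |ℓ x| ≤ q * (A * (2 * ρ ^ (2 - α) / (2 - α)) + |K| * ρ ^ (-α)) := by
        have h3 : c / extensionConst α * (extensionConst α * |ℓ x|) ≤ c / extensionConst α *
            (poissonConst α * (A * (2 * ρ ^ (2 - α) / (2 - α)) + |K| * ρ ^ (-α))) := by
          refine mul_le_mul_of_nonneg_left (h1.trans ?_) (by positivity)
          gcongr
          exact le_abs_self K
        calc c * |ℓ x| = c / extensionConst α * (extensionConst α * |ℓ x|) := by field_simp
          _ ≤ _ := h3
          _ = _ := by rw [hq]; ring
      have h4 : |f (u x)| ≤ |Mf| :=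
        (hMf _ ⟨h.monotone hx, h.le_lim x⟩).trans (le_abs_self _)
      have h5 : m' x = -(c * ℓ x) + -f (u x) := by linarith [heq x]
      have h6 : |m' x| ≤ c * |ℓ x| + |f (u x)| := by
        rw [h5]
        refine (abs_add_le _ _).trans_eq ?_
        rw [abs_neg, abs_neg, abs_mul, abs_of_pos hc]
      calc |m' x| ≤ c * |ℓ x| + |f (u x)| := h6
        _ ≤ q * (A * (2 * ρ ^ (2 - α) / (2 - α)) + |K| * ρ ^ (-α)) + |Mf| := add_le_add h2 h4
        _ = _ := by ring)
  exact tendsto_deriv_zero_of_bounded_second_deriv h.hasDerivAt hd h.nonneg h.tendsto hB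

/-- By the equation, `2F(u) - m²` is a primitive of `2c m ℓ`. -/
lemma integral_deriv_mul_fracLaplacian (h : IsProfile α τ u m)
    (hd : ∀ x, HasDerivAt m (m' x) x) (hm' : Continuous m') (hf : Continuous f)
    (hF : ∀ s, HasDerivAt F (-f s) s) (heq : ∀ x, m' x + c * ℓ x + f (u x) = 0) (x R : ℝ) :
    2 * c * ∫ s in x..R, m s * ℓ s
      = m x ^ 2 - m R ^ 2 + 2 * (F (u R) - F (u x)) := by
  have h1 : ∀ s, HasDerivAt (fun s => 2 * F (u s) - m s ^ 2) (2 * c * (m s * ℓ s)) s := fun s => by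
    have h2 := (((hF (u s)).comp s (h.hasDerivAt s)).const_mul 2).sub ((hd s).pow 2)
    refine HasDerivAt.congr_deriv (f := fun _ => _) h2 ?_
    push_cast
    linear_combination (-2 * m s) * heq s
  -- Continuity of `ℓ` is not known directly; the equation replaces it by continuous terms.
  have hint : IntervalIntegrable (fun s => 2 * c * (m s * ℓ s)) volume x R := by
    have e : (fun s => 2 * c * (m s * ℓ s)) = fun s => -2 * m s * (m' s + f (u s)) := by
      funext s; linear_combination (2 * m s) * heq s
    have hmc := h.continuous_deriv
    have huc := h.continuous
    rw [e]
    exact Continuous.intervalIntegrable (by fun_prop) _ _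
  rw [← intervalIntegral.integral_const_mul,
    intervalIntegral.integral_eq_sub_of_hasDerivAt (fun s _ => h1 s) hint]
  ring

/-- The term in `∂_t v` enters with a negative sign and is dropped, so at `R → ∞` only the decay of
`∂_x v` is needed. -/
lemma integral_energyDensity_le (h : IsProfile α τ u m) (hα₀ : 0 < α) (hα₂ : α < 2)
    (hd : ∀ x, HasDerivAt m (m' x) x) (hm' : Continuous m') {R y η : ℝ} (hy : 0 ≤ y)
    (hη : ∀ t, 0 < t → t ≤ y → tangentialDeriv α m R t ≤ η) :
    ∫ t in (0 : ℝ)..y, energyDensity α m R t ≤ η ^ 2 * (y ^ (2 - α) / (2 - α)) := by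
  have hi := h.intervalIntegrable_energyDensity hα₀ hα₂ hd hm' R hy
  calc _ ≤ ∫ t in (0 : ℝ)..y, η ^ 2 * t ^ (1 - α) := by
        refine intervalIntegral.integral_mono_on_of_le_Ioo hy hi
          ((intervalIntegral.intervalIntegrable_rpow' (by linarith)).const_mul _) fun t ht => ?_
        have ht0 := ht.1
        have h1 := tangentialDeriv_nonneg hα₀ h.nonneg R ht0
        have h2 := hη t ht0 ht.2.le
        have h3 : tangentialDeriv α m R t ^ 2 ≤ η ^ 2 := by gcongr
        have h4 : 0 ≤ t ^ (α - 1) * conormalDeriv α m R t ^ 2 := by positivity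
        rw [energyDensity_eq α m R ht0]
        have h5 := mul_le_mul_of_nonneg_left h3 (Real.rpow_nonneg ht0.le (1 - α))
        linarith
    _ = _ := by
        rw [intervalIntegral.integral_const_mul, integral_rpow (Or.inl (by linarith)),
          show 1 - α + 1 = 2 - α by ring, Real.zero_rpow (by linarith), sub_zero]

/-- The Hamiltonian is bounded by the flux through the right half-line. -/
lemma hamiltonian_le_flux (h : IsProfile α τ u m) (hα₀ : 0 < α) (hα₂ : α < 2)
    (hd : ∀ x, HasDerivAt m (m' x) x) (hm' : Continuous m') (hf : Continuous f) (hc : 0 < c)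
    (hF : ∀ s, HasDerivAt F (-f s) s)
    (hℓ : ∀ x, HasFracLaplacian α u x (ℓ x)) (heq : ∀ x, m' x + c * ℓ x + f (u x) = 0)
    (x : ℝ) {y : ℝ} (hy : 0 < y) :
    extensionConst α * m x ^ 2 + c * (∫ t in (0 : ℝ)..y, energyDensity α m x t)
        - 2 * extensionConst α * (F (u x) - F τ)
      ≤ 2 * c * ∫ z in Set.Ioi x, tangentialDeriv α m z y * conormalDeriv α m z y := by
  set d := extensionConst α
  set J := ∫ z in Set.Ioi x, tangentialDeriv α m z y * conormalDeriv α m z y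
  set E := ∫ t in (0 : ℝ)..y, energyDensity α m x t
  have hm0 := h.tendsto_deriv_zero hα₀ hα₂ hd hm' hf hc hℓ heq
  have hid : ∀ R, d * m x ^ 2 + c * E - 2 * d * (F (u x) - F (u R))
      = d * m R ^ 2 + c * (∫ t in (0 : ℝ)..y, energyDensity α m R t)
        + 2 * c * ∫ z in x..R, tangentialDeriv α m z y * conormalDeriv α m z y := fun R => by
    linear_combination (-c) * h.integral_energyDensity_sub hα₀ hα₂ hd hm' hℓ (x := x) (R := R) hy
      - d * h.integral_deriv_mul_fracLaplacian hd hm' hf hF heq x R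
  have hFlim : Tendsto (fun R => F (u R)) atTop (𝓝 (F τ)) :=
    (hF τ).continuousAt.tendsto.comp h.tendsto
  have hL : Tendsto (fun R => d * m x ^ 2 + c * E - 2 * d * (F (u x) - F (u R))) atTop
      (𝓝 (d * m x ^ 2 + c * E - 2 * d * (F (u x) - F τ))) :=
    ((hFlim.const_sub _).const_mul _).const_sub _
  have hJ : Tendsto (fun R => ∫ z in x..R, tangentialDeriv α m z y * conormalDeriv α m z y) atTop
      (𝓝 J) := intervalIntegral_tendsto_integral_Ioi x (h.integral_flux_le hα₀ x hy).1 tendsto_id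
  -- First `R → ∞` with `η` fixed, which leaves an error of order `η²`; then `η → 0`.
  have hη : ∀ η : ℝ, 0 < η → d * m x ^ 2 + c * E - 2 * d * (F (u x) - F τ)
      ≤ d * 0 ^ 2 + c * (η ^ 2 * (y ^ (2 - α) / (2 - α))) + 2 * c * J := fun η hη => by
    refine le_of_tendsto_of_tendsto hL ((((hm0.pow 2).const_mul d).add_const
      (c * (η ^ 2 * (y ^ (2 - α) / (2 - α))))).add (hJ.const_mul (2 * c))) ?_
    filter_upwards [h.eventually_tangentialDeriv_le hα₀ hm0 y hη] with R hR
    rw [hid R]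
    have := h.integral_energyDensity_le hα₀ hα₂ hd hm' hy.le hR
    gcongr
  have hlim : Tendsto (fun η : ℝ => d * 0 ^ 2 + c * (η ^ 2 * (y ^ (2 - α) / (2 - α))) + 2 * c * J)
      (𝓝[>] 0) (𝓝 (d * 0 ^ 2 + c * (0 ^ 2 * (y ^ (2 - α) / (2 - α))) + 2 * c * J)) :=
    ((by fun_prop : Continuous fun η : ℝ => d * 0 ^ 2 + c * (η ^ 2 * (y ^ (2 - α) / (2 - α)))
      + 2 * c * J).tendsto 0).mono_left nhdsWithin_le_nhds
  have := ge_of_tendsto hlim (by filter_upwards [self_mem_nhdsWithin] with η h0 using hη η h0)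
  simpa using this

/-- Strict negativity of the Hamiltonian. -/
lemma hamiltonian_neg (h : IsProfile α τ u m) (hα₀ : 0 < α) (hα₂ : α < 2)
    (hd : ∀ x, HasDerivAt m (m' x) x) (hm' : Continuous m') (hf : Continuous f) (hc : 0 < c)
    (hF : ∀ s, HasDerivAt F (-f s) s)
    (hℓ : ∀ x, HasFracLaplacian α u x (ℓ x)) (heq : ∀ x, m' x + c * ℓ x + f (u x) = 0)
    (hpos : ∀ x, 0 < m x) (x : ℝ) {y : ℝ} (hy : 0 ≤ y) :
    extensionConst α * m x ^ 2 + c * (∫ t in (0 : ℝ)..y, energyDensity α m x t)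
        < 2 * extensionConst α * (F (u x) - F τ) := by
  have hp := poissonConst_pos hα₀
  have hintpos : ∀ a b : ℝ, a < b → 0 < ∫ s in Set.Icc a b, m s := fun a b hab => by
    rw [integral_Icc_eq_integral_Ioc, ← intervalIntegral.integral_of_le hab.le]
    exact intervalIntegral.intervalIntegral_pos_of_pos
      (h.continuous_deriv.intervalIntegrable _ _) hpos hab
  set D := poissonConst α ^ 2 * 2 ^ (-((1 + α) / 2)) *
    ((∫ s in Set.Icc (x - 2) (x - 1), m s) * ∫ s in Set.Icc (x + 1) (x + 2), m s) with hD
  have hD0 : 0 < D := by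
    have h1 := hintpos (x - 2) (x - 1) (by linarith)
    have h2 := hintpos (x + 1) (x + 2) (by linarith)
    positivity
  have hmain : ∀ t, 0 < t →
      extensionConst α * m x ^ 2 + c * (∫ s in (0 : ℝ)..t, energyDensity α m x s)
        - 2 * extensionConst α * (F (u x) - F τ)
      ≤ -(2 * c * (D * ((4 + t) ^ 2 + t ^ 2) ^ (-((1 + α) / 2)))) := fun t ht => by
    have h1 := h.hamiltonian_le_flux hα₀ hα₂ hd hm' hf hc hF hℓ heq x ht
    have h2 := mul_le_mul_of_nonneg_left (h.integral_flux_le hα₀ x ht).2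
      (show 0 ≤ 2 * c by linarith)
    rw [← hD] at h2
    linarith
  -- At `y = 0` there is no flux bound; the estimate at heights `t > 0` is passed to the limit `t →
  -- 0`. It stays strict because its right side tends to a negative number.
  rcases hy.eq_or_lt with rfl | hy
  · have hi := h.intervalIntegrable_energyDensity hα₀ hα₂ hd hm' x zero_le_one
    have hE : Tendsto (fun t => ∫ s in (0 : ℝ)..t, energyDensity α m x s) (𝓝[>] 0)
        (𝓝 (∫ s in (0 : ℝ)..0, energyDensity α m x s)) := by
      have hcont := intervalIntegral.continuousOn_primitive_interval' hi Set.left_mem_uIcc 0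
        Set.left_mem_uIcc
      refine hcont.tendsto.mono_left ?_
      rw [Set.uIcc_of_le zero_le_one]
      exact nhdsWithin_le_of_mem
        (mem_of_superset (Ioo_mem_nhdsGT one_pos) Set.Ioo_subset_Icc_self)
    have hR : Tendsto (fun t : ℝ => -(2 * c * (D * ((4 + t) ^ 2 + t ^ 2) ^ (-((1 + α) / 2)))))
        (𝓝[>] 0) (𝓝 (-(2 * c * (D * ((4 + 0) ^ 2 + 0 ^ 2) ^ (-((1 + α) / 2)))))) := by
      refine Tendsto.mono_left (ContinuousAt.tendsto ?_) nhdsWithin_le_nhds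
      have : ContinuousAt (fun t : ℝ => ((4 + t) ^ 2 + t ^ 2) ^ (-((1 + α) / 2))) 0 :=
        ContinuousAt.rpow_const (by fun_prop) (Or.inl (by norm_num))
      fun_prop
    have hle := le_of_tendsto_of_tendsto
      (((hE.const_mul c).const_add (extensionConst α * m x ^ 2)).sub_const
        (2 * extensionConst α * (F (u x) - F τ))) hR (by
        filter_upwards [self_mem_nhdsWithin] with t ht using hmain t ht)
    have : 0 < 2 * c * (D * ((4 + 0) ^ 2 + 0 ^ 2) ^ (-((1 + α) / 2))) := by positivity
    linarith
  · have h1 := hmain y hy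
    have : 0 < 2 * c * (D * ((4 + y) ^ 2 + y ^ 2) ^ (-((1 + α) / 2))) := by positivity
    linarith

end IsProfile
end

/-! ### The theorem in terms of derivatives of the extension. -/

theorem theorem2p8 (α c τ : ℝ) (hα₀ : 0 < α) (hα₂ : α < 2) (hc : 0 < c)
    (f F u : ℝ → ℝ) (v : ℝ → ℝ → ℝ)
    (hf : ContDiff ℝ 1 f) (hF : ∀ s : ℝ, HasDerivAt F (-f s) s)
    (hu : IsSolution α c f u)
    (hv : v = extensionFunction α u)
    (hmono : ∀ x : ℝ, 0 < deriv (fun s => v s 0) x)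
    (hlim : Tendsto (fun x => v x 0) atTop (𝓝 τ)) :
    ∀ x y : ℝ, 0 ≤ y →
      IntervalIntegrable
        (fun t => t ^ (1 - α) * ((deriv (fun s => v s t) x) ^ 2 - (deriv (fun r => v x r) t) ^ 2))
        volume 0 y ∧
      extensionConst α * (deriv (fun s => v s 0) x) ^ 2 +
          c * ∫ t in (0 : ℝ)..y,
            t ^ (1 - α) * ((deriv (fun s => v s t) x) ^ 2 - (deriv (fun r => v x r) t) ^ 2)
        < 2 * extensionConst α * (F (v x 0) - F τ) := by
  obtain ⟨hu2, hsol⟩ := hu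
  choose ℓ hℓ heq using hsol
  have hv0 : ∀ s, v s 0 = u s := fun s => by simp [hv, extensionFunction]
  simp_rw [hv0] at hmono hlim ⊢
  obtain ⟨hu1, -, hm⟩ := (contDiff_succ_iff_deriv (n := 1)).1 hu2
  have hd : ∀ x, HasDerivAt (deriv u) (deriv (deriv u) x) x := fun x =>
    (hm.differentiable one_ne_zero x).hasDerivAt
  have hm' : Continuous (deriv (deriv u)) := hm.continuous_deriv le_rfl
  have h : IsProfile α τ u (deriv u) :=
    ⟨fun x => (hu1 x).hasDerivAt, hm.continuous, fun x => (hmono x).le, hlim,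
      (hℓ 0).integrable_weight_mul hα₀ hα₂ τ hu2.continuous⟩
  intro x y hy
  -- The derivative formulas hold only for `t > 0`, which suffices because the integrals from `0` to
  -- `y` are taken over `(0, y]`.
  have hcongr : ∀ t, 0 < t → t ^ (1 - α) * ((deriv (fun s => v s t) x) ^ 2
      - (deriv (fun r => v x r) t) ^ 2) = energyDensity α (deriv u) x t := fun t ht => by
    subst hv
    rw [(h.hasDerivAt_extensionFunction_left hα₀ x ht).deriv,
      (h.hasDerivAt_extensionFunction_right hα₀ x ht).deriv, energyDensity]
  have hmem : ∀ t ∈ Set.uIoc 0 y, 0 < t := fun t ht => by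
    rw [Set.uIoc_of_le hy] at ht; exact ht.1
  refine ⟨(h.intervalIntegrable_energyDensity hα₀ hα₂ hd hm' x hy).congr
    fun t ht => (hcongr t (hmem t ht)).symm, ?_⟩
  rw [intervalIntegral.integral_congr_ae (ae_of_all _ fun t ht => hcongr t (hmem t ht))]
  exact h.hamiltonian_neg hα₀ hα₂ hd hm' hf.continuous hc hF hℓ heq hmono x hy
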